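/- Let $\mu=(\mu_1,\dots,\mu_n)\in\mathbb R^n$ with $\mu_i>-\tfrac12$ for all $i$, let $\mathbb R^n_+=(0,\infty)^n$, write $x^{\beta}=\prod_i x_i^{\beta_i}$, and put $r(x)=x^{-\mu-1/2}$, $s(x)=x^{2\mu+1}/C_\mu$ with $C_\mu=\prod_i 2^{\mu_i}\Gamma(\mu_i+1)$. Let $$S_\mu=\sum_{i=1}^n\Big(\frac{\partial^2}{\partial x_i^2}-\frac{4\mu_i^2-1}{4x_i^2}\Big).$$ Let $\mathcal H_\mu$ be the Zemanian space of all $\phi\in C^\infty(\mathbb R^n_+)$ such that $\sup_{x\in\mathbb R^n_+}|(1+\|x\|^2)^mT^k\{x^{-\mu-1/2}\phi(x)\}|<\infty$ for all $m\in\mathbb N_0$, $k\in\mathbb N_0^n$, where $T^k=T_n^{k_n}\circ\cdots\circ T_1^{k_1}$ and $T_i=x_i^{-1}\partial/\partial x_i$. Let $Y=L^1(\mathbb R^n_+,sr)\cap L^\infty(\mathbb R^n_+,r)$ (complex-valued functions), where $\|f\|_{L^1(sr)}=\int_{\mathbb R^n_+}|f|\,sr\,dx$ and $\|f\|_{L^\infty(r)}=\operatorname{ess\,sup}|rf|$,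 with norm $\|f\|_Y=\max\{\|f\|_{L^1(sr)},\|f\|_{L^\infty(r)}\}$. For $f,g\in Y$ we write $S_\mu f=g$ if $\int_{\mathbb R^n_+} g\,\phi\,dx=\int_{\mathbb R^n_+} f\,S_\mu\phi\,dx$ for all $\phi\in\mathcal H_\mu$ (that is, equality in $\mathcal H_\mu'$, on which $S_\mu$ acts by transposition). Let $$\mathcal B=\{f\in Y:\ S_\mu^kf\in Y\ \text{ for } k=0,1,2,\dots\},$$ with the topology generated by the seminorms $\rho_m(f)=\max_{0\le k\le m}\|S_\mu^kf\|_Y$, $m=0,1,2,\dots$. Let $\mathcal B'$ be the space of continuous linear functionals on $\mathcal B$ with the strong dual topology (uniform convergence on bounded subsets of $\mathcal B$), and let $(S_\mu)_{\mathcal B'}:\mathcal B'\to\mathcal B'$ be defined by $((S_\mu)_{\mathcal B'}T,\phi)=(T,S_\mu\phi)$ for $T\in\mathcal B'$, $\phi\in\mathcal B$. A closed linear operator $A:D(A)\subset X\to X$ in a Hausdorff locally convex space $X$ is called non-negative if $(-\infty,0)\subset\rho(A)$ (that is, for every $\lambda>0$ the operator $\lambda+A:D(A)\to X$ is bijective with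 continuous inverse) and the family $\{\lambda(\lambda+A)^{-1}\}_{\lambda>0}$ is equicontinuous. **Theorem.** The operator $-(S_\mu)_{\mathcal B'}$ is continuous and non-negative on $\mathcal B'$ with the strong topology. Moreover, $\mathcal B'$ is sequentially complete. -/

import Mathlib

open MeasureTheory Filter Topology
open scoped ContDiff

noncomputable section

namespace FractionalBessel

variable {n : ℕ}

/-! ### The domain, the weights and the differential operators -/

/-- The open orthant of `n`-tuples of positive real numbers. -/
def orthant (n : ℕ) : Set (Fin n → ℝ) := {x | ∀ i, 0 < x i}

/-- Lebesgue measure on the open orthant. -/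
def orthantMeasure (n : ℕ) : Measure (Fin n → ℝ) := volume.restrict (orthant n)

/-- The power `x ^ β = ∏ i, x i ^ β i`. -/
def mpow (x β : Fin n → ℝ) : ℝ := ∏ i, x i ^ β i

/-- The constant `C_μ = 2 ^ μ * ∏ i, Γ (μ i + 1)`. -/
def constC (μ : Fin n → ℝ) : ℝ := (∏ i, (2 : ℝ) ^ μ i) * ∏ i, Real.Gamma (μ i + 1)

/-- The weight `s(x) = x ^ (2μ + 1) / C_μ`. -/
def weightS (μ : Fin n → ℝ) (x : Fin n → ℝ) : ℝ := mpow x (fun i => 2 * μ i + 1) / constC μ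

/-- The weight `r(x) = x ^ (-μ - 1/2)`. -/
def weightR (μ : Fin n → ℝ) (x : Fin n → ℝ) : ℝ := mpow x (fun i => -μ i - 1 / 2)

/-- The partial derivative `∂φ/∂x_i`. -/
def pderiv (i : Fin n) (φ : (Fin n → ℝ) → ℂ) (x : Fin n → ℝ) : ℂ :=
  fderiv ℝ φ x (Pi.single i 1)

/-- The operator `T_i = x_i⁻¹ ∂/∂x_i`. -/
def opT (i : Fin n) (φ : (Fin n → ℝ) → ℂ) (x : Fin n → ℝ) : ℂ :=
  ((x i)⁻¹ : ℝ) * pderiv i φ x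

/-- The operator `T^k = T_n^{k_n} ∘ ⋯ ∘ T_1^{k_1}` (the one with the smallest index acts first). -/
def opTpow (k : Fin n → ℕ) (φ : (Fin n → ℝ) → ℂ) : (Fin n → ℝ) → ℂ :=
  (List.finRange n).foldl (fun g i => (opT i)^[k i] g) φ

/-- The Bessel differential operator
`S_μ = ∑ i, (∂²/∂x_i² - (4 μ_i² - 1) / (4 x_i²))` on (smooth) functions. -/
def bessel (μ : Fin n → ℝ) (φ : (Fin n → ℝ) → ℂ) (x : Fin n → ℝ) : ℂ :=
  ∑ i, (pderiv i (pderiv i φ) x - ((4 * μ i ^ 2 - 1) / (4 * x i ^ 2) : ℝ) * φ x)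

/-- The Zemanian space `H_μ`: smooth functions on the orthant such that all the quantities
`sup_x |(1 + ‖x‖²)^m T^k {x^(-μ-1/2) φ(x)}|` are finite. (Values outside the orthant are
irrelevant.) -/
def zemanian (μ : Fin n → ℝ) : Set ((Fin n → ℝ) → ℂ) :=
  {φ | ContDiffOn ℝ ∞ φ (orthant n) ∧
    ∀ (m : ℕ) (k : Fin n → ℕ), ∃ C : ℝ, ∀ x ∈ orthant n,
      ‖(((1 + ∑ i, x i ^ 2) ^ m : ℝ) : ℂ) *
        opTpow k (fun y => (weightR μ y : ℂ) * φ y) x‖ ≤ C}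

/-! ### The Banach space `Y = L¹(s r) ∩ L^∞(r)` -/

/-- `L¹(ℝⁿ₊, s r) ∩ L^∞(ℝⁿ₊, r)` as a subspace of the space of
classes of measurable functions on the orthant modulo equality almost everywhere. -/
def submoduleY (μ : Fin n → ℝ) : Submodule ℂ ((Fin n → ℝ) →ₘ[orthantMeasure n] ℂ) where
  carrier := {f |
    MemLp (fun x => ((weightS μ x * weightR μ x : ℝ) : ℂ) * f x) 1 (orthantMeasure n) ∧
    MemLp (fun x => ((weightR μ x : ℝ) : ℂ) * f x) ⊤ (orthantMeasure n)}
  zero_mem' := by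
    have h := AEEqFun.coeFn_zero (α := Fin n → ℝ) (β := ℂ) (μ := orthantMeasure n)
    constructor
    · refine (MemLp.zero' (ε := ℂ)).ae_eq ?_
      filter_upwards [h] with x hx
      simp [hx]
    · refine (MemLp.zero' (ε := ℂ)).ae_eq ?_
      filter_upwards [h] with x hx
      simp [hx]
  add_mem' := by
    rintro f g ⟨hf1, hf2⟩ ⟨hg1, hg2⟩
    have h := AEEqFun.coeFn_add f g
    constructor
    · refine (hf1.add hg1).ae_eq ?_
      filter_upwards [h] with x hx
      simp [hx, mul_add]
    · refine (hf2.add hg2).ae_eq ?_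
      filter_upwards [h] with x hx
      simp [hx, mul_add]
  smul_mem' := by
    rintro c f ⟨hf1, hf2⟩
    have h := AEEqFun.coeFn_smul c f
    constructor
    · refine (hf1.const_smul c).ae_eq ?_
      filter_upwards [h] with x hx
      simp [hx, mul_left_comm]
    · refine (hf2.const_smul c).ae_eq ?_
      filter_upwards [h] with x hx
      simp [hx, mul_left_comm]

/-- The space `Y = L¹(ℝⁿ₊, s r) ∩ L^∞(ℝⁿ₊, r)`. -/
def spaceY (μ : Fin n → ℝ) : Type := ↥(submoduleY μ)

instance (μ : Fin n → ℝ) : AddCommGroup (spaceY μ) :=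
  inferInstanceAs (AddCommGroup ↥(submoduleY μ))

instance (μ : Fin n → ℝ) : Module ℂ (spaceY μ) :=
  inferInstanceAs (Module ℂ ↥(submoduleY μ))

/-- The class of functions underlying an element of `Y`. -/
def toFn {μ : Fin n → ℝ} (f : spaceY μ) : (Fin n → ℝ) →ₘ[orthantMeasure n] ℂ := f.1

@[simp] lemma toFn_zero {μ : Fin n → ℝ} : toFn (0 : spaceY μ) = 0 := rfl

@[simp] lemma toFn_add {μ : Fin n → ℝ} (f g : spaceY μ) : toFn (f + g) = toFn f + toFn g := rfl

@[simp] lemma toFn_smul {μ : Fin n → ℝ} (c : ℂ) (f : spaceY μ) : toFn (c • f) = c • toFn f := rfl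

lemma toFn_injective {μ : Fin n → ℝ} : Function.Injective (toFn (μ := μ)) := Subtype.val_injective

lemma memLp_one_toFn {μ : Fin n → ℝ} (f : spaceY μ) :
    MemLp (fun x => ((weightS μ x * weightR μ x : ℝ) : ℂ) * toFn f x) 1 (orthantMeasure n) :=
  f.2.1

lemma memLp_top_toFn {μ : Fin n → ℝ} (f : spaceY μ) :
    MemLp (fun x => ((weightR μ x : ℝ) : ℂ) * toFn f x) ⊤ (orthantMeasure n) :=
  f.2.2

/-- The norm of `L¹(ℝⁿ₊, s r)`, as a seminorm on `Y`. -/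
def normL1 (μ : Fin n → ℝ) : Seminorm ℂ (spaceY μ) :=
  Seminorm.of
    (fun f => (eLpNorm (fun x => ((weightS μ x * weightR μ x : ℝ) : ℂ) *
      toFn f x) 1 (orthantMeasure n)).toReal)
    (by
      intro f g
      rw [← ENNReal.toReal_add (memLp_one_toFn f).eLpNorm_ne_top (memLp_one_toFn g).eLpNorm_ne_top]
      refine ENNReal.toReal_mono
        (ENNReal.add_ne_top.2 ⟨(memLp_one_toFn f).eLpNorm_ne_top, (memLp_one_toFn g).eLpNorm_ne_top⟩) ?_
      refine le_trans (le_of_eq (eLpNorm_congr_ae ?_))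
        (eLpNorm_add_le (memLp_one_toFn f).1 (memLp_one_toFn g).1 le_rfl)
      filter_upwards [AEEqFun.coeFn_add (toFn f) (toFn g)] with x hx
      simp [hx, mul_add])
    (by
      intro c f
      rw [← toReal_enorm, ← ENNReal.toReal_mul, ← eLpNorm_const_smul]
      congr 1
      refine eLpNorm_congr_ae ?_
      filter_upwards [AEEqFun.coeFn_smul c (toFn f)] with x hx
      simp [hx, mul_left_comm])

/-- The norm of `L^∞(ℝⁿ₊, r)`, as a seminorm on `Y`. -/
def normLinfty (μ : Fin n → ℝ) : Seminorm ℂ (spaceY μ) :=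
  Seminorm.of
    (fun f => (eLpNorm (fun x => ((weightR μ x : ℝ) : ℂ) *
      toFn f x) ⊤ (orthantMeasure n)).toReal)
    (by
      intro f g
      rw [← ENNReal.toReal_add (memLp_top_toFn f).eLpNorm_ne_top (memLp_top_toFn g).eLpNorm_ne_top]
      refine ENNReal.toReal_mono
        (ENNReal.add_ne_top.2 ⟨(memLp_top_toFn f).eLpNorm_ne_top, (memLp_top_toFn g).eLpNorm_ne_top⟩) ?_
      refine le_trans (le_of_eq (eLpNorm_congr_ae ?_))
        (eLpNorm_add_le (memLp_top_toFn f).1 (memLp_top_toFn g).1 le_top)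
      filter_upwards [AEEqFun.coeFn_add (toFn f) (toFn g)] with x hx
      simp [hx, mul_add])
    (by
      intro c f
      rw [← toReal_enorm, ← ENNReal.toReal_mul, ← eLpNorm_const_smul]
      congr 1
      refine eLpNorm_congr_ae ?_
      filter_upwards [AEEqFun.coeFn_smul c (toFn f)] with x hx
      simp [hx, mul_left_comm])

/-- The norm of `Y`, the maximum of the norms of `L¹(ℝⁿ₊, s r)` and `L^∞(ℝⁿ₊, r)`. -/
def normY (μ : Fin n → ℝ) : Seminorm ℂ (spaceY μ) := normL1 μ ⊔ normLinfty μ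

/-! ### Helper facts: elements of `Y` can be paired with `H_μ` -/

lemma isOpen_orthant : IsOpen (orthant n) := by
  have : orthant n = Set.pi Set.univ (fun _ => Set.Ioi (0 : ℝ)) := by
    ext x; simp [orthant]
  rw [this]
  exact isOpen_set_pi Set.finite_univ (fun _ _ => isOpen_Ioi)

lemma mpow_pos {x : Fin n → ℝ} (hx : x ∈ orthant n) (β : Fin n → ℝ) : 0 < mpow x β :=
  Finset.prod_pos fun i _ => Real.rpow_pos_of_pos (hx i) _

lemma mpow_add {x : Fin n → ℝ} (hx : x ∈ orthant n) (β γ : Fin n → ℝ) :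
    mpow x (fun i => β i + γ i) = mpow x β * mpow x γ := by
  simp only [mpow, ← Finset.prod_mul_distrib]
  exact Finset.prod_congr rfl fun i _ => Real.rpow_add (hx i) _ _

lemma constC_pos {μ : Fin n → ℝ} (hμ : ∀ i, -(1 / 2 : ℝ) < μ i) : 0 < constC μ := by
  refine mul_pos (Finset.prod_pos fun i _ => by positivity) (Finset.prod_pos fun i _ => ?_)
  exact Real.Gamma_pos_of_pos (by linarith [hμ i])

/-- `s r r = 1 / C_μ` on the orthant. -/
lemma weight_mul (μ : Fin n → ℝ) {x : Fin n → ℝ} (hx : x ∈ orthant n) :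
    weightS μ x * weightR μ x * weightR μ x = 1 / constC μ := by
  have h : mpow x (fun i => 2 * μ i + 1) * weightR μ x * weightR μ x = 1 := by
    rw [weightR, ← mpow_add hx, ← mpow_add hx]
    simp only [mpow]
    refine Finset.prod_eq_one fun i _ => ?_
    rw [show 2 * μ i + 1 + (-μ i - 1 / 2) + (-μ i - 1 / 2) = 0 by ring, Real.rpow_zero]
  rw [weightS, div_mul_eq_mul_div, div_mul_eq_mul_div, h]

lemma contDiffOn_mpow (β : Fin n → ℝ) : ContDiffOn ℝ ∞ (fun x => mpow x β) (orthant n) := by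
  unfold mpow
  refine contDiffOn_prod fun i _ => ?_
  refine ContDiffOn.rpow_const_of_ne ?_ fun x hx => (hx i).ne'
  exact (contDiff_apply ℝ ℝ i).contDiffOn

lemma contDiffOn_weight (μ : Fin n → ℝ) {φ : (Fin n → ℝ) → ℂ}
    (hφ : ContDiffOn ℝ ∞ φ (orthant n)) :
    ContDiffOn ℝ ∞ (fun y => (weightR μ y : ℂ) * φ y) (orthant n) :=
  (Complex.ofRealCLM.contDiff.comp_contDiffOn (contDiffOn_mpow _)).mul hφ

lemma contDiffOn_pderiv (i : Fin n) {φ : (Fin n → ℝ) → ℂ}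
    (hφ : ContDiffOn ℝ ∞ φ (orthant n)) : ContDiffOn ℝ ∞ (pderiv i φ) (orthant n) :=
  (hφ.fderiv_of_isOpen isOpen_orthant (m := ∞) (by simp)).clm_apply contDiffOn_const

lemma contDiffOn_opT (i : Fin n) {φ : (Fin n → ℝ) → ℂ}
    (hφ : ContDiffOn ℝ ∞ φ (orthant n)) : ContDiffOn ℝ ∞ (opT i φ) (orthant n) := by
  refine ContDiffOn.mul ?_ (contDiffOn_pderiv i hφ)
  refine Complex.ofRealCLM.contDiff.comp_contDiffOn ?_
  exact (contDiff_apply ℝ ℝ i).contDiffOn.inv fun x hx => (hx i).ne'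

lemma contDiffOn_bessel (μ : Fin n → ℝ) {φ : (Fin n → ℝ) → ℂ}
    (hφ : ContDiffOn ℝ ∞ φ (orthant n)) : ContDiffOn ℝ ∞ (bessel μ φ) (orthant n) := by
  refine ContDiffOn.sum fun i _ => ?_
  refine (contDiffOn_pderiv i (contDiffOn_pderiv i hφ)).sub (ContDiffOn.mul ?_ hφ)
  refine Complex.ofRealCLM.contDiff.comp_contDiffOn ?_
  refine contDiffOn_const.div (contDiffOn_const.mul ((contDiff_apply ℝ ℝ i).contDiffOn.pow 2))
    fun x hx => ?_
  have := hx i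
  positivity

/-- Induction principle for `T^k`. -/
lemma opTpow_induction (P : ((Fin n → ℝ) → ℂ) → Prop) (hP : ∀ i g, P g → P (opT i g))
    (k : Fin n → ℕ) {φ : (Fin n → ℝ) → ℂ} (hφ : P φ) : P (opTpow k φ) := by
  have hit : ∀ i m g, P g → P ((opT i)^[m] g) := by
    intro i m
    induction m with
    | zero => intro g hg; exact hg
    | succ m ih => intro g hg; exact ih _ (hP i g hg)
  unfold opTpow
  generalize List.finRange n = l
  induction l generalizing φ with
  | nil => exact hφ
  | cons a l ih => exact ih (hit a _ _ hφ)

lemma opTpow_single (i : Fin n) (m : ℕ) (φ : (Fin n → ℝ) → ℂ) :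
    opTpow (Pi.single i m) φ = (opT i)^[m] φ := by
  have key : ∀ (l : List (Fin n)) (g : (Fin n → ℝ) → ℂ), l.Nodup →
      l.foldl (fun g j => (opT j)^[(Pi.single i m : Fin n → ℕ) j] g) g =
        if i ∈ l then (opT i)^[m] g else g := by
    intro l
    induction l with
    | nil => intro g _; simp
    | cons a l ih =>
      intro g hl
      rw [List.nodup_cons] at hl
      rw [List.foldl_cons, ih _ hl.2]
      by_cases h : a = i
      · subst h
        simp [hl.1]
      · have h' : i ≠ a := fun h2 => h h2.symm
        simp [h, h']
  rw [opTpow, key _ _ (List.nodup_finRange n), if_pos (List.mem_finRange i)]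

/-- `∂_i` of `x^(μ+1/2) g`. -/
lemma pderiv_mpow_mul (β : Fin n → ℝ) (i : Fin n) {g : (Fin n → ℝ) → ℂ} {x : Fin n → ℝ}
    (hx : x ∈ orthant n) (hg : DifferentiableAt ℝ g x) :
    pderiv i (fun y => (mpow y β : ℂ) * g y) x =
      (mpow x β : ℂ) * (((β i / x i : ℝ) : ℂ) * g x + pderiv i g x) := by
  have hw : DifferentiableAt ℝ (fun y => mpow y β) x :=
    ((contDiffOn_mpow β).contDiffAt (isOpen_orthant.mem_nhds hx)).differentiableAt (by simp)
  have hwd : fderiv ℝ (fun y => mpow y β) x (Pi.single i 1) = mpow x β * (β i / x i) := by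
    have h1 : HasFDerivAt (fun y : Fin n → ℝ => mpow y β)
        (∑ j, (∏ l ∈ Finset.univ.erase j, x l ^ β l) •
          ((β j * x j ^ (β j - 1)) • ContinuousLinearMap.proj (R := ℝ) (φ := fun _ => ℝ) j)) x := by
      unfold mpow
      refine HasFDerivAt.finsetProd fun j _ => ?_
      exact (hasFDerivAt_apply j x).rpow_const (Or.inl (hx j).ne')
    rw [h1.fderiv]
    simp only [sum_apply, smul_apply,
      ContinuousLinearMap.proj_apply, smul_eq_mul]
    rw [Finset.sum_eq_single i]
    · rw [Pi.single_eq_same, mpow, ← Finset.mul_prod_erase _ _ (Finset.mem_univ i),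
        Real.rpow_sub_one (hx i).ne']
      ring
    · intro j _ hj
      rw [Pi.single_eq_of_ne hj]
      ring
    · simp
  have hwc : HasFDerivAt (fun y => (mpow y β : ℂ))
      (Complex.ofRealCLM.comp (fderiv ℝ (fun y => mpow y β) x)) x :=
    Complex.ofRealCLM.hasFDerivAt.comp x hw.hasFDerivAt
  have hprod : HasFDerivAt (fun y => (mpow y β : ℂ) * g y) _ x := hwc.mul hg.hasFDerivAt
  rw [pderiv, hprod.fderiv]
  simp only [add_apply, smul_apply,
    ContinuousLinearMap.comp_apply, hwd, Complex.ofRealCLM_apply, smul_eq_mul, pderiv]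
  push_cast
  ring

lemma pderiv_congr (i : Fin n) {f g : (Fin n → ℝ) → ℂ} (h : Set.EqOn f g (orthant n)) :
    Set.EqOn (pderiv i f) (pderiv i g) (orthant n) := by
  intro x hx
  have : f =ᶠ[𝓝 x] g := by
    filter_upwards [isOpen_orthant.mem_nhds hx] with y hy using h hy
  rw [pderiv, pderiv, this.fderiv_eq]

/-- `x^(-μ-1/2) S_μ φ = ∑ i, ((2 μ_i + 2) T_i + x_i² T_i²) (x^(-μ-1/2) φ)` on the orthant. -/
lemma weight_mul_bessel (μ : Fin n → ℝ) {φ : (Fin n → ℝ) → ℂ}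
    (hφ : ContDiffOn ℝ ∞ φ (orthant n)) {x : Fin n → ℝ} (hx : x ∈ orthant n) :
    (weightR μ x : ℂ) * bessel μ φ x =
      ∑ i, ((2 * μ i + 2 : ℝ) * opT i (fun y => (weightR μ y : ℂ) * φ y) x +
        (x i ^ 2 : ℝ) * opT i (opT i (fun y => (weightR μ y : ℂ) * φ y)) x) := by
  set ψ : (Fin n → ℝ) → ℂ := fun y => (weightR μ y : ℂ) * φ y with hψdef
  set a : Fin n → ℝ := fun i => μ i + 1 / 2 with ha
  have hψ : ContDiffOn ℝ ∞ ψ (orthant n) := contDiffOn_weight μ hφ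
  have hdiff : ∀ {g : (Fin n → ℝ) → ℂ} (_ : ContDiffOn ℝ ∞ g (orthant n)) {y : Fin n → ℝ}
      (_ : y ∈ orthant n), DifferentiableAt ℝ g y := fun hg _ hy =>
    (hg.contDiffAt (isOpen_orthant.mem_nhds hy)).differentiableAt (by simp)
  have hrw : ∀ {y : Fin n → ℝ} (_ : y ∈ orthant n), weightR μ y * mpow y a = 1 := by
    intro y hy
    rw [weightR, ← mpow_add hy]
    simp only [mpow, ha]
    refine Finset.prod_eq_one fun i _ => ?_
    rw [show -μ i - 1 / 2 + (μ i + 1 / 2) = 0 by ring, Real.rpow_zero]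
  have hrwC : ∀ {y : Fin n → ℝ} (_ : y ∈ orthant n), (weightR μ y : ℂ) * (mpow y a : ℂ) = 1 := by
    intro y hy
    rw [← Complex.ofReal_mul, hrw hy, Complex.ofReal_one]
  have hφψ : Set.EqOn φ (fun y => (mpow y a : ℂ) * ψ y) (orthant n) := by
    intro y hy
    simp only [hψdef]
    rw [← mul_assoc, mul_comm (mpow y a : ℂ), hrwC hy, one_mul]
  rw [bessel, Finset.mul_sum]
  refine Finset.sum_congr rfl fun i _ => ?_
  have hxi : (x i : ℂ) ≠ 0 := by exact_mod_cast (hx i).ne'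
  -- the function `∂_i ψ` in terms of `T_i`
  have hTψ : Set.EqOn (pderiv i ψ) (fun y => (mpow y (Pi.single i 1) : ℂ) * opT i ψ y)
      (orthant n) := by
    intro y hy
    have hyi : (y i : ℂ) ≠ 0 := by exact_mod_cast (hy i).ne'
    have : mpow y (Pi.single i 1) = y i := by
      rw [mpow, Finset.prod_eq_single i]
      · simp
      · intro j _ hj; simp [Pi.single_eq_of_ne hj]
      · simp
    simp only [this, opT]
    push_cast
    rw [← mul_assoc, mul_inv_cancel₀ hyi, one_mul]
  have hsing : mpow x (Pi.single i 1) = x i := by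
    rw [mpow, Finset.prod_eq_single i]
    · simp
    · intro j _ hj; simp [Pi.single_eq_of_ne hj]
    · simp
  have e1 : pderiv i ψ x = (x i : ℂ) * opT i ψ x := by
    have := hTψ hx
    simpa [hsing] using this
  have e2' : pderiv i (opT i ψ) x = (x i : ℂ) * opT i (opT i ψ) x := by
    simp only [opT]
    push_cast
    rw [← mul_assoc, mul_inv_cancel₀ hxi, one_mul]
  have e2 : pderiv i (pderiv i ψ) x =
      opT i ψ x + (x i : ℂ) * ((x i : ℂ) * opT i (opT i ψ) x) := by
    rw [pderiv_congr i hTψ hx, pderiv_mpow_mul _ i hx (hdiff (contDiffOn_opT i hψ) hx), hsing,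
      e2', Pi.single_eq_same]
    push_cast
    field_simp
  have d1 : Set.EqOn (pderiv i φ)
      (fun y => (mpow y a : ℂ) * (((a i / y i : ℝ) : ℂ) * ψ y + pderiv i ψ y)) (orthant n) := by
    intro y hy
    rw [pderiv_congr i hφψ hy, pderiv_mpow_mul a i hy (hdiff hψ hy)]
  -- differentiate `(a / y_i) ψ + ∂_i ψ`
  have hinv : Set.EqOn (fun y : Fin n → ℝ => ((a i / y i : ℝ) : ℂ) * ψ y)
      (fun y => (mpow y (Pi.single i (-1)) : ℂ) * ((a i : ℂ) * ψ y)) (orthant n) := by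
    intro y hy
    have : mpow y (Pi.single i (-1)) = (y i)⁻¹ := by
      rw [mpow, Finset.prod_eq_single i]
      · simp [Real.rpow_neg_one]
      · intro j _ hj; simp [Pi.single_eq_of_ne hj]
      · simp
    simp only [this]
    push_cast
    ring
  have hinvx : mpow x (Pi.single i (-1)) = (x i)⁻¹ := by
    rw [mpow, Finset.prod_eq_single i]
    · simp [Real.rpow_neg_one]
    · intro j _ hj; simp [Pi.single_eq_of_ne hj]
    · simp
  have haψ : ContDiffOn ℝ ∞ (fun y => (a i : ℂ) * ψ y) (orthant n) := contDiffOn_const.mul hψ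
  have haψd : pderiv i (fun y => (a i : ℂ) * ψ y) x = (a i : ℂ) * pderiv i ψ x := by
    rw [pderiv, ((hdiff hψ hx).hasFDerivAt.const_mul (a i : ℂ)).fderiv]
    simp [pderiv]
  have hq : ContDiffOn ℝ ∞ (fun y : Fin n → ℝ => ((a i / y i : ℝ) : ℂ) * ψ y) (orthant n) := by
    refine ContDiffOn.mul ?_ hψ
    refine Complex.ofRealCLM.contDiff.comp_contDiffOn ?_
    exact contDiffOn_const.div (contDiff_apply ℝ ℝ i).contDiffOn fun x hx => (hx i).ne'
  have d2 : pderiv i (fun y => ((a i / y i : ℝ) : ℂ) * ψ y + pderiv i ψ y) x =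
      ((x i : ℂ)⁻¹ * (-(x i : ℂ)⁻¹ * ((a i : ℂ) * ψ x) + (a i : ℂ) * pderiv i ψ x)) +
        pderiv i (pderiv i ψ) x := by
    have : pderiv i (fun y => ((a i / y i : ℝ) : ℂ) * ψ y + pderiv i ψ y) x =
        pderiv i (fun y => ((a i / y i : ℝ) : ℂ) * ψ y) x + pderiv i (pderiv i ψ) x := by
      have hsum : HasFDerivAt (fun y => ((a i / y i : ℝ) : ℂ) * ψ y + pderiv i ψ y) _ x :=
        (hdiff hq hx).hasFDerivAt.add (hdiff (contDiffOn_pderiv i hψ) hx).hasFDerivAt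
      rw [pderiv, hsum.fderiv]
      rfl
    rw [this, pderiv_congr i hinv hx, pderiv_mpow_mul _ i hx (hdiff haψ hx), hinvx, haψd,
      Pi.single_eq_same]
    push_cast
    ring
  rw [pderiv_congr i d1 hx, pderiv_mpow_mul a i hx (hdiff (hq.add (contDiffOn_pderiv i hψ)) hx), d2,
    hφψ hx]
  have hxr := hrwC hx
  simp only [e1, e2]
  have : ∀ A B : ℂ, (weightR μ x : ℂ) * ((mpow x a : ℂ) * A - B * ((mpow x a : ℂ) * ψ x)) =
      A - B * ψ x := by
    intro A B
    linear_combination (A - B * ψ x) * hxr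
  rw [this]
  simp only [ha]
  push_cast
  field_simp
  ring

/-- An element of `Y` times a continuous function `w` with `r w` bounded is integrable. -/
lemma integrable_mul {μ : Fin n → ℝ} (hμ : ∀ i, -(1 / 2 : ℝ) < μ i) (f : spaceY μ)
    {w : (Fin n → ℝ) → ℂ} (hw : ContinuousOn w (orthant n))
    (hb : ∃ C : ℝ, ∀ x ∈ orthant n, ‖(weightR μ x : ℂ) * w x‖ ≤ C) :
    Integrable (fun x => toFn f x * w x)
      (orthantMeasure n) := by
  obtain ⟨C, hC⟩ := hb
  have h1 : Integrable (fun x => ((weightS μ x * weightR μ x : ℝ) : ℂ) *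
      toFn f x) (orthantMeasure n) := memLp_one_iff_integrable.1 (memLp_one_toFn f)
  have hr : ContinuousOn (fun x => (weightR μ x : ℂ) * w x) (orthant n) :=
    (Complex.continuous_ofReal.comp_continuousOn (contDiffOn_mpow _).continuousOn).mul hw
  have hmeas : AEStronglyMeasurable (fun x => (weightR μ x : ℂ) * w x) (orthantMeasure n) :=
    hr.aestronglyMeasurable isOpen_orthant.measurableSet
  have hae : ∀ᵐ x ∂(orthantMeasure n), x ∈ orthant n :=
    ae_restrict_mem isOpen_orthant.measurableSet
  have h2 := h1.mul_bdd (c := C) hmeas (by filter_upwards [hae] with x hx using hC x hx)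
  refine (h2.const_mul (constC μ : ℂ)).congr ?_
  filter_upwards [hae] with x hx
  have h3 : ((weightS μ x * weightR μ x * weightR μ x : ℝ) : ℂ) * (constC μ : ℂ) = 1 := by
    rw [weight_mul μ hx, ← Complex.ofReal_mul, one_div,
      inv_mul_cancel₀ (constC_pos hμ).ne', Complex.ofReal_one]
  push_cast at h3 ⊢
  linear_combination (toFn f x * w x) * h3

lemma zemanian_bound {μ : Fin n → ℝ} {φ : (Fin n → ℝ) → ℂ} (hφ : φ ∈ zemanian μ) :
    ∃ C : ℝ, ∀ x ∈ orthant n, ‖(weightR μ x : ℂ) * φ x‖ ≤ C := by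
  obtain ⟨C, hC⟩ := hφ.2 0 0
  refine ⟨C, fun x hx => ?_⟩
  have h0 : opTpow (0 : Fin n → ℕ) (fun y => (weightR μ y : ℂ) * φ y) =
      fun y => (weightR μ y : ℂ) * φ y := by
    have : ∀ (l : List (Fin n)) (g : (Fin n → ℝ) → ℂ),
        l.foldl (fun g i => (opT i)^[(0 : Fin n → ℕ) i] g) g = g := by
      intro l
      induction l with
      | nil => intro g; rfl
      | cons a l ih => intro g; exact ih g
    exact this _ _
  simpa [h0] using hC x hx

lemma zemanian_bessel_bound {μ : Fin n → ℝ} {φ : (Fin n → ℝ) → ℂ} (hφ : φ ∈ zemanian μ) :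
    ∃ C : ℝ, ∀ x ∈ orthant n, ‖(weightR μ x : ℂ) * bessel μ φ x‖ ≤ C := by
  choose C1 hC1 using fun i : Fin n => hφ.2 0 (Pi.single i 1)
  choose C2 hC2 using fun i : Fin n => hφ.2 1 (Pi.single i 2)
  refine ⟨∑ i, (|2 * μ i + 2| * C1 i + C2 i), fun x hx => ?_⟩
  rw [weight_mul_bessel μ hφ.1 hx]
  refine norm_sum_le_of_le _ fun i _ => ?_
  have h1 := hC1 i x hx
  have h2 := hC2 i x hx
  rw [opTpow_single] at h1 h2
  simp only [pow_zero, Complex.ofReal_one, one_mul, pow_one,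
    Function.iterate_succ, Function.comp, Function.iterate_zero, id] at h1 h2
  refine (norm_add_le _ _).trans (add_le_add ?_ ?_)
  · rw [norm_mul, Complex.norm_real, Real.norm_eq_abs]
    exact mul_le_mul_of_nonneg_left h1 (abs_nonneg _)
  · refine le_trans ?_ h2
    rw [norm_mul, norm_mul, Complex.norm_real, Complex.norm_real, Real.norm_eq_abs,
      Real.norm_eq_abs]
    refine mul_le_mul_of_nonneg_right ?_ (norm_nonneg _)
    have hs : x i ^ 2 ≤ ∑ j, x j ^ 2 :=
      Finset.single_le_sum (f := fun j => x j ^ 2) (fun j _ => sq_nonneg _) (Finset.mem_univ i)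
    rw [abs_of_nonneg (sq_nonneg _), abs_of_nonneg (by linarith [sq_nonneg (x i)])]
    linarith

/-! ### The part of the Bessel operator in `Y` -/

/-- The pairs `(f, g)` of elements of `Y` with `S_μ f = g` in the dual `H_μ'` of the Zemanian
space, where `S_μ` acts by transposition and functions act by integration:
`∫ g φ = ∫ f S_μ φ` for all `φ ∈ H_μ`. -/
def besselGraph (μ : Fin n → ℝ) (hμ : ∀ i, -(1 / 2 : ℝ) < μ i) :
    Submodule ℂ (spaceY μ × spaceY μ) where
  carrier := {p | ∀ φ ∈ zemanian μ,
    ∫ x, toFn p.2 x * φ x ∂(orthantMeasure n) =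
      ∫ x, toFn p.1 x * bessel μ φ x ∂(orthantMeasure n)}
  zero_mem' := by
    intro φ _
    have h := AEEqFun.coeFn_zero (α := Fin n → ℝ) (β := ℂ) (μ := orthantMeasure n)
    rw [integral_eq_zero_of_ae, integral_eq_zero_of_ae]
    · filter_upwards [h] with x hx
      simp [hx]
    · filter_upwards [h] with x hx
      simp [hx]
  add_mem' := by
    rintro ⟨f, g⟩ ⟨f', g'⟩ h h' φ hφ
    have key : ∀ (u v : spaceY μ) {w : (Fin n → ℝ) → ℂ} (_ : ContinuousOn w (orthant n))
        (_ : ∃ C : ℝ, ∀ x ∈ orthant n, ‖(weightR μ x : ℂ) * w x‖ ≤ C),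
        ∫ x, toFn (u + v) x * w x
            ∂(orthantMeasure n) =
          (∫ x, toFn u x * w x ∂(orthantMeasure n)) +
          ∫ x, toFn v x * w x ∂(orthantMeasure n) := by
      intro u v w hw hb
      rw [← integral_add (integrable_mul hμ u hw hb) (integrable_mul hμ v hw hb)]
      refine integral_congr_ae ?_
      filter_upwards [AEEqFun.coeFn_add (toFn u) (toFn v)] with x hx
      simp [hx, add_mul]
    have e1 := key g g' hφ.1.continuousOn (zemanian_bound hφ)
    have e2 := key f f' (contDiffOn_bessel μ hφ.1).continuousOn (zemanian_bessel_bound hφ)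
    exact e1.trans ((congrArg₂ (· + ·) (h φ hφ) (h' φ hφ)).trans e2.symm)
  smul_mem' := by
    rintro c ⟨f, g⟩ h φ hφ
    have key : ∀ (u : spaceY μ) (w : (Fin n → ℝ) → ℂ),
        ∫ x, toFn (c • u) x * w x
            ∂(orthantMeasure n) =
          c * ∫ x, toFn u x * w x ∂(orthantMeasure n) := by
      intro u w
      rw [← integral_const_mul]
      refine integral_congr_ae ?_
      filter_upwards [AEEqFun.coeFn_smul c (toFn u)] with x hx
      simp [hx, mul_assoc]
    exact (key g φ).trans ((congrArg (c * ·) (h φ hφ)).trans (key f _).symm)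

/-- Smooth functions with compact support in the orthant belong to `H_μ`. -/
lemma mem_zemanian_of_hasCompactSupport (μ : Fin n → ℝ) {φ : (Fin n → ℝ) → ℂ}
    (hφ : ContDiff ℝ ∞ φ) (hc : HasCompactSupport φ) (hs : tsupport φ ⊆ orthant n) :
    φ ∈ zemanian μ := by
  refine ⟨hφ.contDiffOn, fun m k => ?_⟩
  have key := opTpow_induction
    (P := fun g => ContDiffOn ℝ ∞ g (orthant n) ∧ ∀ x ∉ tsupport φ, g x = 0)
    (by
      rintro i g ⟨h1, h2⟩
      refine ⟨contDiffOn_opT i h1, fun x hx => ?_⟩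
      have : g =ᶠ[𝓝 x] fun _ => (0 : ℂ) := by
        filter_upwards [(isClosed_tsupport φ).isOpen_compl.mem_nhds hx] with y hy using h2 y hy
      simp [opT, pderiv, this.fderiv_eq])
    k (φ := fun y => (weightR μ y : ℂ) * φ y)
    ⟨contDiffOn_weight μ hφ.contDiffOn, fun x hx => by simp [image_eq_zero_of_notMem_tsupport hx]⟩
  set g := opTpow k (fun y => (weightR μ y : ℂ) * φ y)
  have hcont : ContinuousOn (fun x : Fin n → ℝ => (((1 + ∑ i, x i ^ 2) ^ m : ℝ) : ℂ) * g x)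
      (tsupport φ) := by
    refine ContinuousOn.mul (Continuous.continuousOn ?_) (key.1.continuousOn.mono hs)
    fun_prop
  obtain ⟨C, hC⟩ := hc.isCompact.exists_bound_of_continuousOn hcont
  refine ⟨max C 0, fun x _ => ?_⟩
  by_cases hx : x ∈ tsupport φ
  · exact (hC x hx).trans (le_max_left _ _)
  · simp [key.2 x hx]

/-- `S_μ f` is uniquely determined as an element of `Y`. -/
lemma besselGraph_functional (μ : Fin n → ℝ) (hμ : ∀ i, -(1 / 2 : ℝ) < μ i)
    (p : spaceY μ × spaceY μ) (hp : p ∈ besselGraph μ hμ) (hp0 : p.1 = 0) : p.2 = 0 := by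
  obtain ⟨f, g⟩ := p
  obtain rfl : f = 0 := hp0
  have hz : ∀ φ ∈ zemanian μ,
      ∫ x, toFn g x * φ x ∂(orthantMeasure n) = 0 := by
    intro φ hφ
    refine (hp φ hφ).trans (integral_eq_zero_of_ae ?_)
    filter_upwards [AEEqFun.coeFn_zero (α := Fin n → ℝ) (β := ℂ) (μ := orthantMeasure n)] with x hx
    simp [hx]
  have hae : ∀ᵐ x ∂(orthantMeasure n), x ∈ orthant n :=
    ae_restrict_mem isOpen_orthant.measurableSet
  -- work with `h = r s g`, which is integrable
  set G : (Fin n → ℝ) → ℂ := fun x => ((weightS μ x * weightR μ x : ℝ) : ℂ) *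
      toFn g x with hG
  have hGint : Integrable G (orthantMeasure n) := memLp_one_iff_integrable.1 (memLp_one_toFn g)
  have hGloc : LocallyIntegrableOn
      (fun x => toFn g x) (orthant n) (orthantMeasure n) := by
    have h1 : LocallyIntegrableOn G (orthant n) (orthantMeasure n) :=
      hGint.locallyIntegrable.locallyIntegrableOn _
    have h2 : ContinuousOn (fun x => (constC μ : ℂ) * (weightR μ x : ℂ)) (orthant n) := by
      refine continuousOn_const.mul ?_
      exact Complex.continuous_ofReal.comp_continuousOn (contDiffOn_mpow _).continuousOn
    rw [locallyIntegrableOn_iff isOpen_orthant.isLocallyClosed] at h1 ⊢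
    intro K hKs hK
    have h3 : IntegrableOn
        (fun x => ((constC μ : ℂ) * (weightR μ x : ℂ)) * G x) K (orthantMeasure n) :=
      (h1 K hKs hK).continuousOn_mul (h2.mono hKs) hK
    refine Integrable.congr h3 ?_
    filter_upwards [ae_restrict_of_ae hae] with x hx
    have h4 : ((weightS μ x * weightR μ x * weightR μ x : ℝ) : ℂ) * (constC μ : ℂ) = 1 := by
      rw [weight_mul μ hx, ← Complex.ofReal_mul, one_div,
        inv_mul_cancel₀ (constC_pos hμ).ne', Complex.ofReal_one]
    simp only [hG]
    push_cast at h4 ⊢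
    linear_combination (toFn g x) * h4
  have hzero := isOpen_orthant.ae_eq_zero_of_integral_contDiff_smul_eq_zero hGloc (by
    intro φ hφ hc hs
    have hφ' : ContDiff ℝ ∞ (fun x => (φ x : ℂ)) := Complex.ofRealCLM.contDiff.comp hφ
    have hsupp : tsupport (fun x => (φ x : ℂ)) ⊆ tsupport φ :=
      closure_mono fun x hx h0 => hx (by simp [h0])
    have hc' : HasCompactSupport (fun x => (φ x : ℂ)) :=
      hc.comp_left (g := fun t : ℝ => (t : ℂ)) Complex.ofReal_zero
    refine Eq.trans ?_
      (hz _ (mem_zemanian_of_hasCompactSupport μ hφ' hc' (hsupp.trans hs)))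
    refine integral_congr_ae (Eventually.of_forall fun x => ?_)
    simp [mul_comm])
  refine toFn_injective (AEEqFun.ext ?_)
  filter_upwards [hzero, hae, AEEqFun.coeFn_zero (α := Fin n → ℝ) (β := ℂ)
    (μ := orthantMeasure n)] with x h1 h2 h3
  rw [h1 h2]
  simp [h3]

/-- The part `(S_μ)_Y` of the Bessel operator in `Y`: its domain is
`{f ∈ Y : S_μ f ∈ Y}`, and it is given there by `f ↦ S_μ f`. -/
def besselY (μ : Fin n → ℝ) (hμ : ∀ i, -(1 / 2 : ℝ) < μ i) : spaceY μ →ₗ.[ℂ] spaceY μ :=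
  (besselGraph μ hμ).toLinearPMap

/-! ### The Fréchet space `B` -/

/-- The domain of the `k`-th power of `(S_μ)_Y`: `D(A⁰) = Y` and
`D(A^(k+1)) = {f ∈ D(A) : A f ∈ D(A^k)}`. -/
def powDomain (μ : Fin n → ℝ) (hμ : ∀ i, -(1 / 2 : ℝ) < μ i) : ℕ → Submodule ℂ (spaceY μ)
  | 0 => ⊤
  | k + 1 => ((powDomain μ hμ k).comap (besselY μ hμ).toFun).map (besselY μ hμ).domain.subtype

/-- The space `B = ⋂ k, D((S_μ)_Y ^ k)`. -/
def spaceB (μ : Fin n → ℝ) (hμ : ∀ i, -(1 / 2 : ℝ) < μ i) : Type :=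
  ↥(⨅ k, powDomain μ hμ k)

instance (μ : Fin n → ℝ) (hμ : ∀ i, -(1 / 2 : ℝ) < μ i) : AddCommGroup (spaceB μ hμ) :=
  inferInstanceAs (AddCommGroup ↥(⨅ k, powDomain μ hμ k))

instance (μ : Fin n → ℝ) (hμ : ∀ i, -(1 / 2 : ℝ) < μ i) : Module ℂ (spaceB μ hμ) :=
  inferInstanceAs (Module ℂ ↥(⨅ k, powDomain μ hμ k))

/-- The inclusion of `B` in `Y`. -/
def inclB (μ : Fin n → ℝ) (hμ : ∀ i, -(1 / 2 : ℝ) < μ i) : spaceB μ hμ →ₗ[ℂ] spaceY μ :=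
  (⨅ k, powDomain μ hμ k).subtype

lemma inclB_mem_domain {μ : Fin n → ℝ} {hμ : ∀ i, -(1 / 2 : ℝ) < μ i} (f : spaceB μ hμ) :
    inclB μ hμ f ∈ (besselY μ hμ).domain := by
  obtain ⟨y, -, hy⟩ := (Submodule.mem_iInf _).1 f.2 1
  exact (congrArg (· ∈ (besselY μ hμ).domain) hy).mp y.2

lemma besselY_inclB_mem {μ : Fin n → ℝ} {hμ : ∀ i, -(1 / 2 : ℝ) < μ i} (f : spaceB μ hμ) :
    besselY μ hμ ⟨inclB μ hμ f, inclB_mem_domain f⟩ ∈ ⨅ k, powDomain μ hμ k := by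
  refine (Submodule.mem_iInf _).2 fun k => ?_
  obtain ⟨y, hy, hyf⟩ := (Submodule.mem_iInf _).1 f.2 (k + 1)
  have : y = ⟨inclB μ hμ f, inclB_mem_domain f⟩ := Subtype.ext hyf
  rw [← this]
  exact hy

/-- The Bessel operator `(S_μ)_B : B → B`, the restriction of `(S_μ)_Y`. -/
def besselB (μ : Fin n → ℝ) (hμ : ∀ i, -(1 / 2 : ℝ) < μ i) : spaceB μ hμ →ₗ[ℂ] spaceB μ hμ where
  toFun f := ⟨besselY μ hμ ⟨inclB μ hμ f, inclB_mem_domain f⟩, besselY_inclB_mem f⟩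
  map_add' f g := Subtype.ext ((besselY μ hμ).map_add
    ⟨inclB μ hμ f, inclB_mem_domain f⟩ ⟨inclB μ hμ g, inclB_mem_domain g⟩)
  map_smul' c f := Subtype.ext ((besselY μ hμ).map_smul c ⟨inclB μ hμ f, inclB_mem_domain f⟩)

/-- The seminorms `ρ_m(f) = max_{0 ≤ k ≤ m} ‖S_μ^k f‖_Y` on `B`. -/
def rho (μ : Fin n → ℝ) (hμ : ∀ i, -(1 / 2 : ℝ) < μ i) : SeminormFamily ℂ (spaceB μ hμ) ℕ :=
  fun m => (Finset.range (m + 1)).sup fun k =>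
    (normY μ).comp (inclB μ hμ ∘ₗ (besselB μ hμ ^ k))

/-- The topology of `B` is the one generated by the seminorms `ρ_m`. -/
instance (μ : Fin n → ℝ) (hμ : ∀ i, -(1 / 2 : ℝ) < μ i) : TopologicalSpace (spaceB μ hμ) :=
  (rho μ hμ).moduleFilterBasis.topology

lemma withSeminorms_rho (μ : Fin n → ℝ) (hμ : ∀ i, -(1 / 2 : ℝ) < μ i) :
    WithSeminorms (rho μ hμ) := ⟨rfl⟩

instance (μ : Fin n → ℝ) (hμ : ∀ i, -(1 / 2 : ℝ) < μ i) : IsTopologicalAddGroup (spaceB μ hμ) :=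
  (withSeminorms_rho μ hμ).topologicalAddGroup

instance (μ : Fin n → ℝ) (hμ : ∀ i, -(1 / 2 : ℝ) < μ i) : ContinuousSMul ℂ (spaceB μ hμ) :=
  (withSeminorms_rho μ hμ).continuousSMul

/-- `(S_μ)_B` is continuous, so that it can be transposed. -/
lemma continuous_besselB (μ : Fin n → ℝ) (hμ : ∀ i, -(1 / 2 : ℝ) < μ i) :
    Continuous (besselB μ hμ) := by
  refine (withSeminorms_rho μ hμ).continuous_of_isBounded (withSeminorms_rho μ hμ) _
    fun m => ⟨{m + 1}, 1, ?_⟩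
  intro f
  have h0 : 0 ≤ rho μ hμ (m + 1) f := apply_nonneg _ _
  simp only [Finset.sup_singleton, one_smul, Seminorm.comp_apply]
  refine Seminorm.finset_sup_apply_le h0 fun k hk => ?_
  have hk' : k + 1 ∈ Finset.range (m + 1 + 1) := by
    have := Finset.mem_range.1 hk
    exact Finset.mem_range.2 (by omega)
  have h1 := Seminorm.le_finset_sup_apply (x := f)
    (p := fun k => (normY μ).comp (inclB μ hμ ∘ₗ (besselB μ hμ ^ k))) hk'
  refine le_trans (le_of_eq ?_) h1
  simp [Seminorm.comp_apply, pow_succ]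

/-! ### The strong dual `B'` and the transposed operator -/

/-- The dual space `B'` of continuous linear functionals on `B`. Its topology (an instance on
`E →L[ℂ] ℂ`) is the strong topology, that is the topology of uniform convergence on the bounded
subsets of `B`. -/
abbrev dualB (μ : Fin n → ℝ) (hμ : ∀ i, -(1 / 2 : ℝ) < μ i) : Type := spaceB μ hμ →L[ℂ] ℂ

/-- The Bessel operator `(S_μ)_{B'}` on `B'`, defined by `(S_μ T, φ) = (T, S_μ φ)`. -/
def besselDual (μ : Fin n → ℝ) (hμ : ∀ i, -(1 / 2 : ℝ) < μ i) :
    dualB μ hμ →ₗ[ℂ] dualB μ hμ where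
  toFun T := T.comp ⟨besselB μ hμ, continuous_besselB μ hμ⟩
  map_add' _ _ := rfl
  map_smul' _ _ := rfl

/-! ### Non-negative operators -/

/-- A linear operator `A : D(A) ⊆ X → X` in a Hausdorff locally convex space is non-negative if it
is closed, `(-∞, 0)` is contained in its resolvent set (for every `l > 0` the operator
`l + A : D(A) → X` has a continuous everywhere defined two-sided inverse `R l`), and the
family of operators `l (l + A)⁻¹`, `l > 0`, is equicontinuous. -/
def IsNonnegativeOperator {X : Type*} [AddCommGroup X] [Module ℂ X] [Module ℝ X]
    [IsScalarTower ℝ ℂ X] [TopologicalSpace X] [T2Space X] [LocallyConvexSpace ℝ X]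
    (A : X →ₗ.[ℂ] X) : Prop :=
  A.IsClosed ∧
  ∃ R : ℝ → X →L[ℂ] X,
    (∀ l : ℝ, 0 < l →
      (∀ x : X, ∃ y : A.domain, (y : X) = R l x ∧ (l : ℂ) • (y : X) + A y = x) ∧
      (∀ y : A.domain, R l ((l : ℂ) • (y : X) + A y) = y)) ∧
    ∀ p : Seminorm ℂ X, Continuous p → ∃ q : Seminorm ℂ X, Continuous q ∧
      ∀ l : ℝ, 0 < l → ∀ x : X, p ((l : ℂ) • R l x) ≤ q x

end FractionalBessel

end

open scoped ENNReal

noncomputable section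

namespace FractionalBessel

variable {n : ℕ}

/-! Everything rests on one estimate: for each `l > 0` the operator `l - S_μ` has on `Y` an inverse
`R_l` with `‖l R_l‖ ≤ 1`. Since `R_l` commutes with `S_μ`, it maps `B` into itself and `ρ_m(l R_l f)
≤ ρ_m(f)` for every `m`. So all the operators `l R_l` together carry a bounded set of `B` into one
bounded set, and their transposes form an equicontinuous family on the strong dual. The remaining
claims are soft: the transpose of a continuous operator is strongly continuous, and the strong dual
of a space defined by countably many seminorms is complete.

`R_l` is the Laplace transform in time of the heat semigroup of `S_μ`. In one variable the heat
kernel is `2 τ √(xy) exp (-τ (x² + y²)) I_ν(2 τ x y)` with `τ = 1 / (4t)`; it is used through the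
power series of `I_ν`, which shows at once that it is positive and symmetric and how it acts on
Gaussians. It preserves `w = x ^ (μ + 1/2)`, so the kernel of `R_l` maps `w` to `w / l`
(`lintegral_resolventKernel_weight`). With positivity this bounds `l R_l` on `L^∞(r)`, and with
symmetry it does so on `L¹(s r)`.

That `R_l` inverts `l - S_μ` is proved without differentiating the kernel. The heat flow sends a
Gaussian `w exp (-∑ a_i x_i²)` to an explicit multiple `w H_t` of another Gaussian. Hence, if `g =
S_μ f`, the derivative in `t` of `⟨f, w H_t⟩` is `⟨g, w H_t⟩`, and integrating against `exp (-l t)`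
gives `R_l (l f - g) = f` when paired with Gaussians (`integral_exp_mul_heatPairing`). Gaussians
separate the points of `Y` (`eq_zero_of_integral_gauss`), so `R_l` is a left inverse
(`resolventY_smul_sub`). For the right inverse, integration by parts shows that each `φ` in `H_μ`
satisfies `φ = R_l (l φ - S_μ φ)`; the symmetry of `R_l` then moves it onto the other factor
(`resolventY_mem_graph`). -/

/-! ### The heat kernel of the Bessel operator -/

/-- Tonelli's theorem for a finite product of functions of one variable. -/
lemma lintegral_fin_prod_eq_prod : ∀ {n : ℕ} (ν : Fin n → Measure ℝ) [∀ i, SigmaFinite (ν i)]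
    {f : Fin n → ℝ → ℝ≥0∞} (_ : ∀ i, Measurable (f i)),
    ∫⁻ x, ∏ i, f i (x i) ∂(Measure.pi ν) = ∏ i, ∫⁻ y, f i y ∂(ν i)
  | 0, ν, _, f, hf => by
    simp only [Finset.univ_eq_empty, Finset.prod_empty, lintegral_const, one_mul]
    rw [← Set.pi_univ Set.univ, Measure.pi_pi]
    simp
  | n + 1, ν, _, f, hf => by
    have hm : Measurable fun x : Fin n → ℝ => ∏ i : Fin n, f i.succ (x i) :=
      Finset.measurable_fun_prod _ fun i _ => (hf i.succ).comp (measurable_pi_apply i)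
    rw [← ((measurePreserving_piFinSuccAbove ν 0).symm).lintegral_comp_emb
      (MeasurableEquiv.measurableEmbedding _)]
    simp only [Fin.prod_univ_succ, MeasurableEquiv.piFinSuccAbove_symm_apply, Fin.insertNthEquiv,
      Fin.insertNth_zero, Equiv.coe_fn_mk, Fin.cons_succ, Fin.zero_succAbove, Fin.cons_zero]
    refine (lintegral_prod_mul (μ := ν 0) (ν := Measure.pi fun j : Fin n => ν j.succ)
      (hf 0).aemeasurable hm.aemeasurable).trans ?_
    rw [lintegral_fin_prod_eq_prod _ fun i => hf i.succ]

lemma orthantMeasure_eq_pi (n : ℕ) :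
    orthantMeasure n = Measure.pi fun _ : Fin n => volume.restrict (Set.Ioi (0 : ℝ)) := by
  have h : orthant n = Set.pi Set.univ fun _ => Set.Ioi (0 : ℝ) := by
    ext x; simp [orthant]
  rw [orthantMeasure, h, volume_pi, Measure.restrict_pi_pi]

instance (n : ℕ) : SigmaFinite (orthantMeasure n) := by
  unfold orthantMeasure; infer_instance

lemma ae_mem_orthant (n : ℕ) : ∀ᵐ x ∂(orthantMeasure n), x ∈ orthant n :=
  ae_restrict_mem isOpen_orthant.measurableSet

/-- The terms of the series defining the one-dimensional heat kernel. -/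
def heatTerm (ν τ x y : ℝ) (k : ℕ) : ℝ :=
  2 * τ ^ (ν + 1) * Real.exp (-(τ * (x ^ 2 + y ^ 2))) * (x * y) ^ (ν + 1 / 2) *
    (τ * (x * y)) ^ (2 * k) / (k.factorial * Real.Gamma (k + ν + 1))

/-- The heat kernel of `d²/dx² - (4ν² - 1) / (4x²)` on the half line, with respect to Lebesgue
measure; the time is `1 / (4τ)`. -/
def heatKernelOne (ν τ x y : ℝ) : ℝ≥0∞ := ∑' k, ENNReal.ofReal (heatTerm ν τ x y k)

lemma heatKernelOne_comm (ν τ x y : ℝ) : heatKernelOne ν τ x y = heatKernelOne ν τ y x := by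
  simp only [heatKernelOne, heatTerm, mul_comm x y, add_comm (x ^ 2)]

lemma measurable_heatKernelOne (ν : ℝ) {α : Type*} [MeasurableSpace α] {t x y : α → ℝ}
    (ht : Measurable t) (hx : Measurable x) (hy : Measurable y) :
    Measurable fun z => heatKernelOne ν (t z) (x z) (y z) := by
  unfold heatKernelOne heatTerm
  refine Measurable.tsum fun k => Measurable.ennreal_ofReal ?_
  fun_prop

/-- Each term reduces to the Gamma integral of `y ^ (2ν + 1 + 2k) exp (-(τ + a) y²)`, whose value
contains `Γ(k + ν + 1) / 2`. This cancels the Gamma factor and the leading `2` of `heatTerm` and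
leaves a term of an exponential series. -/
lemma integral_heatTerm_mul {ν τ a x : ℝ} (hν : -1 < ν) (hτ : 0 < τ) (ha : 0 ≤ a) (hx : 0 < x)
    (k : ℕ) :
    ∫⁻ y in Set.Ioi (0 : ℝ), ENNReal.ofReal (heatTerm ν τ x y k) *
        ENNReal.ofReal (y ^ (ν + 1 / 2) * Real.exp (-(a * y ^ 2))) =
      ENNReal.ofReal (x ^ (ν + 1 / 2) * (τ / (τ + a)) ^ (ν + 1) * Real.exp (-(τ * x ^ 2)) *
        ((τ ^ 2 * x ^ 2 / (τ + a)) ^ k / k.factorial)) := by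
  have hG : 0 < Real.Gamma (k + ν + 1) := Real.Gamma_pos_of_pos (by
    have : (0 : ℝ) ≤ k := k.cast_nonneg
    linarith)
  have hτa : 0 < τ + a := by linarith
  set A : ℝ := 2 * τ ^ (ν + 1) * Real.exp (-(τ * x ^ 2)) * x ^ (ν + 1 / 2) * (τ * x) ^ (2 * k) /
    (k.factorial * Real.Gamma (k + ν + 1)) with hA
  have hq : (-1 : ℝ) < 2 * ν + 1 + 2 * k := by
    have : (0 : ℝ) ≤ k := k.cast_nonneg
    linarith
  have hpt : ∀ y ∈ Set.Ioi (0 : ℝ), ENNReal.ofReal (heatTerm ν τ x y k) *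
        ENNReal.ofReal (y ^ (ν + 1 / 2) * Real.exp (-(a * y ^ 2))) =
      ENNReal.ofReal (A * (y ^ (2 * ν + 1 + 2 * k) * Real.exp (-(τ + a) * y ^ (2 : ℝ)))) := by
    intro y hy
    have hy : 0 < y := hy
    rw [← ENNReal.ofReal_mul' (by positivity)]
    congr 1
    have e1 : y ^ (2 * ν + 1 + 2 * k) = y ^ (ν + 1 / 2) * y ^ (ν + 1 / 2) * y ^ (2 * k) := by
      rw [← Real.rpow_natCast, ← Real.rpow_add hy, ← Real.rpow_add hy]
      congr 1; push_cast; ring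
    have e2 : Real.exp (-(τ + a) * y ^ (2 : ℝ)) * Real.exp (-(τ * x ^ 2)) =
        Real.exp (-(τ * (x ^ 2 + y ^ 2))) * Real.exp (-(a * y ^ 2)) := by
      rw [← Real.exp_add, ← Real.exp_add, Real.rpow_two]; congr 1; ring
    rw [heatTerm, hA, e1, Real.mul_rpow hx.le hy.le, ← mul_assoc τ x y, mul_pow (τ * x)]
    linear_combination (-(2 * τ ^ (ν + 1) * x ^ (ν + 1 / 2) * (τ * x) ^ (2 * k) /
      (k.factorial * Real.Gamma (k + ν + 1)) * (y ^ (ν + 1 / 2) * y ^ (ν + 1 / 2) * y ^ (2 * k)))) * e2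
  rw [setLIntegral_congr_fun measurableSet_Ioi hpt, ← ofReal_integral_eq_lintegral_ofReal]
  · rw [integral_const_mul, integral_rpow_mul_exp_neg_mul_rpow (by norm_num) hq hτa]
    congr 1
    have e3 : -(2 * ν + 1 + 2 * k + 1) / 2 = -(ν + 1) - (k : ℝ) := by ring
    have e4 : (2 * ν + 1 + 2 * k + 1) / 2 = k + ν + 1 := by ring
    rw [e3, e4, Real.rpow_sub hτa, Real.rpow_neg hτa.le, Real.rpow_natCast,
      Real.div_rpow hτ.le hτa.le, hA]
    have : 0 < (τ + a) ^ (ν + 1) := Real.rpow_pos_of_pos hτa _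
    have h2 : ((τ + a) ^ k)⁻¹ * (τ + a) ^ k = 1 := inv_mul_cancel₀ (pow_pos hτa k).ne'
    rw [div_pow, mul_pow, mul_pow, ← pow_mul, ← pow_mul]
    field_simp
  · exact (integrableOn_rpow_mul_exp_neg_mul_rpow hq (by norm_num) hτa).const_mul A
  · refine (ae_restrict_mem measurableSet_Ioi).mono fun y hy => ?_
    have hy : 0 < y := hy
    have : (0 : ℝ) < k.factorial := by positivity
    positivity

/-- The heat kernel maps Gaussians to Gaussians. -/
lemma lintegral_heatKernelOne_mul {ν τ a x : ℝ} (hν : -1 < ν) (hτ : 0 < τ) (ha : 0 ≤ a)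
    (hx : 0 < x) :
    ∫⁻ y in Set.Ioi (0 : ℝ), heatKernelOne ν τ x y *
        ENNReal.ofReal (y ^ (ν + 1 / 2) * Real.exp (-(a * y ^ 2))) =
      ENNReal.ofReal (x ^ (ν + 1 / 2) * (τ / (τ + a)) ^ (ν + 1) *
        Real.exp (-(τ * a / (τ + a) * x ^ 2))) := by
  have hτa : 0 < τ + a := by linarith
  simp only [heatKernelOne, ← ENNReal.tsum_mul_right]
  rw [lintegral_tsum]
  · simp only [integral_heatTerm_mul hν hτ ha hx]
    -- The terms sum to `exp (τ² x² / (τ + a))`; multiplied by `exp (-τ x²)` this has the exponent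
    -- `-τ a x² / (τ + a)`.
    have hs := (NormedSpace.expSeries_div_hasSum_exp (τ ^ 2 * x ^ 2 / (τ + a))).mul_left
      (x ^ (ν + 1 / 2) * (τ / (τ + a)) ^ (ν + 1) * Real.exp (-(τ * x ^ 2)))
    rw [← ENNReal.ofReal_tsum_of_nonneg _ hs.summable, hs.tsum_eq, ← Real.exp_eq_exp_ℝ, mul_assoc,
      ← Real.exp_add]
    · congr 3
      field_simp
      ring
    · intro k
      positivity
  · intro k
    unfold heatTerm
    fun_prop

/-! ### Gaussians and their evolution -/

/-- The weight `w(x) = x ^ (μ + 1/2) = 1 / r(x)`. -/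
def weightW (μ x : Fin n → ℝ) : ℝ := mpow x fun i => μ i + 1 / 2

/-- The function `exp (-∑ a_i x_i²)`. -/
def expSq (a x : Fin n → ℝ) : ℝ := Real.exp (-∑ i, a i * x i ^ 2)

/-- The Gaussian `x ^ (μ + 1/2) exp (-∑ a_i x_i²)`. -/
def gauss (μ a x : Fin n → ℝ) : ℝ := weightW μ x * expSq a x

/-- The parameters of the Gaussian with initial parameters `a` at time `t`. -/
def heatParam (a : Fin n → ℝ) (t : ℝ) (i : Fin n) : ℝ := a i / (1 + 4 * a i * t)

/-- The factor of the Gaussian with initial parameters `a` at time `t`. -/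
def heatCoeff (μ a : Fin n → ℝ) (t : ℝ) : ℝ := ∏ i, (1 + 4 * a i * t) ^ (-(μ i + 1))

/-- The factor `H_t(x) = c(t) exp (-∑ b_i(t) x_i²)` in the evolution of Gaussians. -/
def heatExp (μ a : Fin n → ℝ) (t : ℝ) (x : Fin n → ℝ) : ℝ :=
  heatCoeff μ a t * expSq (heatParam a t) x

lemma weightW_pos (μ : Fin n → ℝ) {x : Fin n → ℝ} (hx : x ∈ orthant n) : 0 < weightW μ x :=
  mpow_pos hx _

lemma expSq_pos (a x : Fin n → ℝ) : 0 < expSq a x := Real.exp_pos _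

/-- The heat kernel of `S_μ`, with respect to Lebesgue measure; the time is `1 / (4τ)`. -/
def heatKernel (μ : Fin n → ℝ) (τ : ℝ) (x y : Fin n → ℝ) : ℝ≥0∞ :=
  ∏ i, heatKernelOne (μ i) τ (x i) (y i)

/-- The integral splits over the coordinates, and `τ = (4t)⁻¹` gives `τ / (τ + a) = 1 / (1 + 4at)`.
Vanishing parameters are allowed so that the weight `w` itself is covered. -/
lemma lintegral_heatKernel_mul {μ : Fin n → ℝ} (hμ : ∀ i, -(1 / 2 : ℝ) < μ i) {t : ℝ} (ht : 0 < t)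
    {a : Fin n → ℝ} (ha : ∀ i, 0 ≤ a i) {x : Fin n → ℝ} (hx : x ∈ orthant n) :
    ∫⁻ y, heatKernel μ (4 * t)⁻¹ x y * ENNReal.ofReal (gauss μ a y) ∂(orthantMeasure n) =
      ENNReal.ofReal (weightW μ x * heatExp μ a t x) := by
  have h1 : ∀ y ∈ orthant n, heatKernel μ (4 * t)⁻¹ x y * ENNReal.ofReal (gauss μ a y) =
      ∏ i, heatKernelOne (μ i) (4 * t)⁻¹ (x i) (y i) *
        ENNReal.ofReal (y i ^ (μ i + 1 / 2) * Real.exp (-(a i * y i ^ 2))) := by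
    intro y hy
    rw [Finset.prod_mul_distrib, heatKernel, ← ENNReal.ofReal_prod_of_nonneg, gauss, weightW, mpow,
      expSq, Finset.prod_mul_distrib, ← Real.exp_sum, Finset.sum_neg_distrib]
    intro i _
    have := hy i
    positivity
  rw [lintegral_congr_ae ((ae_mem_orthant n).mono h1), orthantMeasure_eq_pi]
  refine (lintegral_fin_prod_eq_prod (fun _ => volume.restrict (Set.Ioi (0 : ℝ)))
    (f := fun i y => heatKernelOne (μ i) (4 * t)⁻¹ (x i) y *
        ENNReal.ofReal (y ^ (μ i + 1 / 2) * Real.exp (-(a i * y ^ 2)))) ?_).trans ?_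
  rotate_left
  · have h2 : ∀ i, ∫⁻ y in Set.Ioi (0 : ℝ), heatKernelOne (μ i) (4 * t)⁻¹ (x i) y *
        ENNReal.ofReal (y ^ (μ i + 1 / 2) * Real.exp (-(a i * y ^ 2))) =
        ENNReal.ofReal (x i ^ (μ i + 1 / 2) * ((1 + 4 * a i * t) ^ (-(μ i + 1)) *
          Real.exp (-(heatParam a t i * x i ^ 2)))) := by
      intro i
      have := ha i
      have h3 : 0 < 1 + 4 * a i * t := by positivity
      rw [lintegral_heatKernelOne_mul (by linarith [hμ i]) (by positivity) (ha i) (hx i),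
        heatParam, Real.rpow_neg h3.le, ← Real.inv_rpow h3.le, mul_assoc]
      have e1 : (4 * t)⁻¹ / ((4 * t)⁻¹ + a i) = (1 + 4 * a i * t)⁻¹ := by
        field_simp
      have e2 : (4 * t)⁻¹ * a i / ((4 * t)⁻¹ + a i) = a i / (1 + 4 * a i * t) := by
        field_simp
      rw [e1, e2]
    simp only [h2]
    rw [← ENNReal.ofReal_prod_of_nonneg, weightW, mpow, heatExp, heatCoeff, expSq,
      Finset.prod_mul_distrib, Finset.prod_mul_distrib, ← Real.exp_sum, Finset.sum_neg_distrib]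
    intro i _
    have := hx i
    have := ha i
    positivity
  · intro i
    refine (measurable_heatKernelOne _ measurable_const measurable_const measurable_id).mul ?_
    fun_prop

/-- The kernel of the resolvent `(l - S_μ)⁻¹`. -/
def resolventKernel (μ : Fin n → ℝ) (l : ℝ) (x y : Fin n → ℝ) : ℝ≥0∞ :=
  ∫⁻ t in Set.Ioi (0 : ℝ), ENNReal.ofReal (Real.exp (-(l * t))) * heatKernel μ (4 * t)⁻¹ x y

lemma measurable_heatKernel (μ : Fin n → ℝ) {α : Type*} [MeasurableSpace α] {t : α → ℝ}
    {x y : α → Fin n → ℝ} (ht : Measurable t) (hx : Measurable x) (hy : Measurable y) :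
    Measurable fun z => heatKernel μ (t z) (x z) (y z) := by
  unfold heatKernel
  refine Finset.measurable_fun_prod _ fun i _ => ?_
  exact measurable_heatKernelOne _ ht ((measurable_pi_apply i).comp hx)
    ((measurable_pi_apply i).comp hy)

lemma resolventKernel_comm (μ : Fin n → ℝ) (l : ℝ) (x y : Fin n → ℝ) :
    resolventKernel μ l x y = resolventKernel μ l y x := by
  simp only [resolventKernel, heatKernel]
  simp_rw [fun (t : ℝ) (i : Fin n) => heatKernelOne_comm (μ i) (4 * t)⁻¹ (x i) (y i)]

lemma measurable_resolventKernel (μ : Fin n → ℝ) (l : ℝ) :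
    Measurable (Function.uncurry (resolventKernel μ l)) := by
  unfold resolventKernel Function.uncurry
  refine Measurable.lintegral_prod_right' (f := fun z : ((Fin n → ℝ) × (Fin n → ℝ)) × ℝ =>
    ENNReal.ofReal (Real.exp (-(l * z.2))) * heatKernel μ (4 * z.2)⁻¹ z.1.1 z.1.2) ?_
  refine Measurable.mul (by fun_prop) ?_
  exact measurable_heatKernel μ (by fun_prop) (by fun_prop) (by fun_prop)

/-- The resolvent kernel applied to a Gaussian. -/
lemma lintegral_resolventKernel_mul {μ : Fin n → ℝ} (hμ : ∀ i, -(1 / 2 : ℝ) < μ i) (l : ℝ)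
    {a : Fin n → ℝ} (ha : ∀ i, 0 ≤ a i) {x : Fin n → ℝ} (hx : x ∈ orthant n) :
    ∫⁻ y, resolventKernel μ l x y * ENNReal.ofReal (gauss μ a y) ∂(orthantMeasure n) =
      ∫⁻ t in Set.Ioi (0 : ℝ),
        ENNReal.ofReal (Real.exp (-(l * t)) * (weightW μ x * heatExp μ a t x)) := by
  have hg : Measurable fun y : Fin n → ℝ => ENNReal.ofReal (gauss μ a y) := by
    unfold gauss weightW expSq mpow
    fun_prop
  have hk : Measurable fun z : (Fin n → ℝ) × ℝ =>
      ENNReal.ofReal (Real.exp (-(l * z.2))) * heatKernel μ (4 * z.2)⁻¹ x z.1 :=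
    Measurable.mul (by fun_prop)
      (measurable_heatKernel μ (by fun_prop) (by fun_prop) (by fun_prop))
  have h1 : ∀ y, resolventKernel μ l x y * ENNReal.ofReal (gauss μ a y) =
      ∫⁻ t in Set.Ioi (0 : ℝ), ENNReal.ofReal (Real.exp (-(l * t))) *
        heatKernel μ (4 * t)⁻¹ x y * ENNReal.ofReal (gauss μ a y) := by
    intro y
    rw [resolventKernel, lintegral_mul_const]
    exact hk.comp (measurable_const.prodMk measurable_id)
  simp only [h1]
  rw [lintegral_lintegral_swap]
  · refine setLIntegral_congr_fun measurableSet_Ioi fun t ht => ?_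
    simp only [mul_assoc]
    rw [lintegral_const_mul, lintegral_heatKernel_mul hμ ht ha hx,
      ENNReal.ofReal_mul (Real.exp_nonneg _)]
    exact (measurable_heatKernel μ measurable_const measurable_const measurable_id).mul hg
  · exact (hk.mul (hg.comp measurable_fst)).aemeasurable

lemma heatExp_zero_param (μ : Fin n → ℝ) (t : ℝ) (x : Fin n → ℝ) : heatExp μ 0 t x = 1 := by
  simp [heatExp, heatCoeff, expSq, heatParam]

lemma gauss_zero_param (μ x : Fin n → ℝ) : gauss μ 0 x = weightW μ x := by
  simp [gauss, expSq]

/-- The case `a = 0`: the heat kernel preserves `w`, and only `∫ exp (-l t) dt = 1 / l` remains. All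
bounds on the resolvent come from this identity. -/
lemma lintegral_resolventKernel_weight {μ : Fin n → ℝ} (hμ : ∀ i, -(1 / 2 : ℝ) < μ i) {l : ℝ}
    (hl : 0 < l) {x : Fin n → ℝ} (hx : x ∈ orthant n) :
    ∫⁻ y, resolventKernel μ l x y * ENNReal.ofReal (weightW μ y) ∂(orthantMeasure n) =
      ENNReal.ofReal l⁻¹ * ENNReal.ofReal (weightW μ x) := by
  have h := lintegral_resolventKernel_mul hμ l (a := 0) (fun _ => le_rfl) hx
  simp only [gauss_zero_param, heatExp_zero_param, mul_one] at h
  simp only [h, ENNReal.ofReal_mul (Real.exp_nonneg _)]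
  rw [lintegral_mul_const _ (by fun_prop)]
  congr 1
  rw [← ofReal_integral_eq_lintegral_ofReal]
  · congr 1
    simpa [neg_mul] using integral_exp_mul_Ioi (a := -l) (by linarith) 0
  · have h2 : IntegrableOn (fun t => Real.exp (-(l * t))) (Set.Ioi (0 : ℝ)) := by
      simpa [neg_mul] using integrableOn_exp_mul_Ioi (a := -l) (by linarith) 0
    exact h2
  · exact Eventually.of_forall fun t => Real.exp_nonneg _

/-! ### Elements of `Y` -/

lemma weightR_mul_weightW (μ : Fin n → ℝ) {x : Fin n → ℝ} (hx : x ∈ orthant n) :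
    weightR μ x * weightW μ x = 1 := by
  rw [weightR, weightW, ← mpow_add hx]
  simp only [mpow]
  refine Finset.prod_eq_one fun i _ => ?_
  rw [show -μ i - 1 / 2 + (μ i + 1 / 2) = 0 by ring, Real.rpow_zero]

lemma weightS_mul_weightR (μ : Fin n → ℝ) {x : Fin n → ℝ} (hx : x ∈ orthant n) :
    weightS μ x * weightR μ x = weightW μ x / constC μ := by
  rw [weightS, weightR, weightW, div_mul_eq_mul_div, ← mpow_add hx]
  congr 3
  ext i
  ring

lemma measurable_weightW (μ : Fin n → ℝ) : Measurable (weightW μ) := by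
  unfold weightW mpow
  fun_prop

lemma measurable_gauss (μ a : Fin n → ℝ) : Measurable (gauss μ a) := by
  unfold gauss weightW mpow expSq
  fun_prop

lemma normL1_eq {μ : Fin n → ℝ} (hμ : ∀ i, -(1 / 2 : ℝ) < μ i) (f : spaceY μ) :
    ENNReal.ofReal (normL1 μ f) =
      ∫⁻ x, ENNReal.ofReal (weightW μ x / constC μ) * ‖toFn f x‖ₑ ∂(orthantMeasure n) := by
  have h : normL1 μ f = (eLpNorm (fun x => ((weightS μ x * weightR μ x : ℝ) : ℂ) *
      toFn f x) 1 (orthantMeasure n)).toReal := rfl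
  rw [h, ENNReal.ofReal_toReal (memLp_one_toFn f).eLpNorm_ne_top, eLpNorm_one_eq_lintegral_enorm]
  refine lintegral_congr_ae ?_
  filter_upwards [ae_mem_orthant n] with x hx
  rw [enorm_mul, weightS_mul_weightR μ hx]
  congr 1
  rw [← ofReal_norm, Complex.norm_real, Real.norm_eq_abs]
  rw [abs_of_nonneg (div_nonneg (weightW_pos μ hx).le (constC_pos hμ).le)]

lemma norm_toFn_le (μ : Fin n → ℝ) (f : spaceY μ) :
    ∀ᵐ x ∂(orthantMeasure n), ‖toFn f x‖ ≤ normLinfty μ f * weightW μ x := by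
  have h : normLinfty μ f = (eLpNorm (fun x => ((weightR μ x : ℝ) : ℂ) *
      toFn f x) ⊤ (orthantMeasure n)).toReal := rfl
  filter_upwards [ae_le_eLpNormEssSup (f := fun x => ((weightR μ x : ℝ) : ℂ) * toFn f x)
    (μ := orthantMeasure n), ae_mem_orthant n] with x h1 hx
  rw [← eLpNorm_exponent_top] at h1
  have h2 := ENNReal.toReal_mono (memLp_top_toFn f).eLpNorm_ne_top h1
  rw [← h, toReal_enorm, norm_mul, Complex.norm_real, Real.norm_eq_abs,
    abs_of_pos (show 0 < weightR μ x from mpow_pos hx _)] at h2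
  have hw := weightW_pos μ hx
  calc ‖toFn f x‖ = (weightR μ x * weightW μ x) * ‖toFn f x‖ := by
        rw [weightR_mul_weightW μ hx, one_mul]
    _ = weightR μ x * ‖toFn f x‖ * weightW μ x := by ring
    _ ≤ _ := by gcongr

lemma normLinfty_le (μ : Fin n → ℝ) (f : spaceY μ) {M : ℝ} (hM : 0 ≤ M)
    (h : ∀ᵐ x ∂(orthantMeasure n), ‖toFn f x‖ ≤ M * weightW μ x) : normLinfty μ f ≤ M := by
  have h0 : normLinfty μ f = (eLpNorm (fun x => ((weightR μ x : ℝ) : ℂ) *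
      toFn f x) ⊤ (orthantMeasure n)).toReal := rfl
  rw [h0]
  refine ENNReal.toReal_le_of_le_ofReal hM ?_
  rw [eLpNorm_exponent_top]
  refine eLpNormEssSup_le_of_ae_bound ?_
  filter_upwards [h, ae_mem_orthant n] with x h1 hx
  have hr : 0 < weightR μ x := mpow_pos hx _
  rw [norm_mul, Complex.norm_real, Real.norm_eq_abs, abs_of_pos hr]
  calc weightR μ x * ‖toFn f x‖ ≤ weightR μ x * (M * weightW μ x) := by gcongr
    _ = M * (weightR μ x * weightW μ x) := by ring
    _ = M := by rw [weightR_mul_weightW μ hx, mul_one]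

/-- Membership in `Y` in terms of the weight `w`. -/
lemma mem_submoduleY {μ : Fin n → ℝ} (hμ : ∀ i, -(1 / 2 : ℝ) < μ i)
    {f : (Fin n → ℝ) →ₘ[orthantMeasure n] ℂ}
    (h1 : ∫⁻ x, ENNReal.ofReal (weightW μ x / constC μ) * ‖f x‖ₑ ∂(orthantMeasure n) ≠ ⊤) {M : ℝ}
    (h2 : ∀ᵐ x ∂(orthantMeasure n), ‖f x‖ ≤ M * weightW μ x) : f ∈ submoduleY μ := by
  have hf : AEStronglyMeasurable f (orthantMeasure n) := f.aestronglyMeasurable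
  have hm : ∀ β : Fin n → ℝ, Measurable fun x => mpow x β := fun β => by
    unfold mpow; fun_prop
  have hR : Measurable (weightR μ) := hm _
  have hS : Measurable (weightS μ) := (hm _).div_const _
  constructor
  · refine ⟨((Complex.measurable_ofReal.comp (hS.mul hR)).aestronglyMeasurable.mul hf), ?_⟩
    rw [eLpNorm_one_eq_lintegral_enorm]
    refine lt_of_le_of_lt (le_of_eq (lintegral_congr_ae ?_)) (lt_top_iff_ne_top.2 h1)
    filter_upwards [ae_mem_orthant n] with x hx
    rw [enorm_mul, weightS_mul_weightR μ hx]
    congr 1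
    rw [← ofReal_norm, Complex.norm_real, Real.norm_eq_abs,
      abs_of_nonneg (div_nonneg (weightW_pos μ hx).le (constC_pos hμ).le)]
  · refine memLp_top_of_bound ((Complex.measurable_ofReal.comp hR).aestronglyMeasurable.mul hf) M ?_
    filter_upwards [h2, ae_mem_orthant n] with x h1 hx
    have hr : 0 < weightR μ x := mpow_pos hx _
    rw [norm_mul, Complex.norm_real, Real.norm_eq_abs, abs_of_pos hr]
    calc weightR μ x * ‖f x‖ ≤ weightR μ x * (M * weightW μ x) := by gcongr
      _ = M * (weightR μ x * weightW μ x) := by ring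
      _ = M := by rw [weightR_mul_weightW μ hx, mul_one]

/-! ### The resolvent as an integral operator on `Y` -/

/-- The integral operator whose kernel is that of the resolvent. -/
def resolventFn (μ : Fin n → ℝ) (l : ℝ) (f : (Fin n → ℝ) → ℂ) (x : Fin n → ℝ) : ℂ :=
  ∫ y, ((resolventKernel μ l x y).toReal : ℂ) * f y ∂(orthantMeasure n)

/-- An inequality is enough and needs no finiteness of the kernel: where its value is `⊤`, `toReal`
gives `0`. -/
lemma enorm_kernel_mul_le (μ : Fin n → ℝ) (l : ℝ) (x y : Fin n → ℝ) (z : ℂ) :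
    ‖((resolventKernel μ l x y).toReal : ℂ) * z‖ₑ ≤ resolventKernel μ l x y * ‖z‖ₑ := by
  rw [enorm_mul]
  gcongr
  rw [← ofReal_norm, Complex.norm_real, Real.norm_eq_abs, abs_of_nonneg (by positivity)]
  exact ENNReal.ofReal_toReal_le

lemma enorm_resolventFn_le (μ : Fin n → ℝ) (l : ℝ) (f : (Fin n → ℝ) → ℂ) (x : Fin n → ℝ) :
    ‖resolventFn μ l f x‖ₑ ≤
      ∫⁻ y, resolventKernel μ l x y * ‖f y‖ₑ ∂(orthantMeasure n) := by
  rw [resolventFn]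
  exact (enorm_integral_le_lintegral_enorm _).trans
    (lintegral_mono fun y => enorm_kernel_mul_le μ l x y (f y))

lemma measurable_kernel_left (μ : Fin n → ℝ) (l : ℝ) (x : Fin n → ℝ) :
    Measurable (resolventKernel μ l x) :=
  (measurable_resolventKernel μ l).of_uncurry_left

/-- A maximum principle: `|f|` is dominated by a multiple of `w`, and a positive kernel preserves
this domination. -/
lemma lintegral_kernel_mul_enorm_le {μ : Fin n → ℝ} (hμ : ∀ i, -(1 / 2 : ℝ) < μ i) {l : ℝ}
    (hl : 0 < l) (f : spaceY μ) {x : Fin n → ℝ} (hx : x ∈ orthant n) :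
    ∫⁻ y, resolventKernel μ l x y * ‖toFn f y‖ₑ ∂(orthantMeasure n) ≤
      ENNReal.ofReal (l⁻¹ * normLinfty μ f * weightW μ x) := by
  have hN : 0 ≤ normLinfty μ f := apply_nonneg _ _
  calc ∫⁻ y, resolventKernel μ l x y * ‖toFn f y‖ₑ ∂(orthantMeasure n)
      ≤ ∫⁻ y, ENNReal.ofReal (normLinfty μ f) *
          (resolventKernel μ l x y * ENNReal.ofReal (weightW μ y)) ∂(orthantMeasure n) := by
        refine lintegral_mono_ae ?_
        filter_upwards [norm_toFn_le μ f] with y hy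
        rw [mul_left_comm, ← ENNReal.ofReal_mul hN, ← ofReal_norm]
        gcongr
    _ = _ := by
        rw [lintegral_const_mul _ ((measurable_kernel_left μ l x).fun_mul
          (measurable_weightW μ).ennreal_ofReal), lintegral_resolventKernel_weight hμ hl hx,
          ← ENNReal.ofReal_mul (by positivity), ← ENNReal.ofReal_mul hN]
        congr 1
        ring

lemma stronglyMeasurable_kernel_mul (μ : Fin n → ℝ) (l : ℝ) (f : spaceY μ) :
    StronglyMeasurable (Function.uncurry fun x y : Fin n → ℝ =>
      ((resolventKernel μ l x y).toReal : ℂ) * toFn f y) := by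
  refine StronglyMeasurable.mul ?_
    ((AEEqFun.stronglyMeasurable (toFn f)).comp_measurable measurable_snd)
  exact (Complex.measurable_ofReal.comp
    (measurable_resolventKernel μ l).ennreal_toReal).stronglyMeasurable

lemma integrable_kernel_mul {μ : Fin n → ℝ} (hμ : ∀ i, -(1 / 2 : ℝ) < μ i) {l : ℝ}
    (hl : 0 < l) (f : spaceY μ) {x : Fin n → ℝ} (hx : x ∈ orthant n) :
    Integrable (fun y => ((resolventKernel μ l x y).toReal : ℂ) * toFn f y) (orthantMeasure n) := by
  refine ⟨((stronglyMeasurable_kernel_mul μ l f).comp_measurable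
    (measurable_const.prodMk measurable_id)).aestronglyMeasurable, ?_⟩
  exact ((lintegral_mono fun y => enorm_kernel_mul_le μ l x y _).trans
    (lintegral_kernel_mul_enorm_le hμ hl f hx)).trans_lt ENNReal.ofReal_lt_top

lemma stronglyMeasurable_resolventFn (μ : Fin n → ℝ) (l : ℝ) (f : spaceY μ) :
    StronglyMeasurable (resolventFn μ l (toFn f)) :=
  (stronglyMeasurable_kernel_mul μ l f).integral_prod_right

lemma norm_resolventFn_le {μ : Fin n → ℝ} (hμ : ∀ i, -(1 / 2 : ℝ) < μ i) {l : ℝ}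
    (hl : 0 < l) (f : spaceY μ) {x : Fin n → ℝ} (hx : x ∈ orthant n) :
    ‖resolventFn μ l (toFn f) x‖ ≤ l⁻¹ * normLinfty μ f * weightW μ x := by
  have h := (enorm_resolventFn_le μ l (toFn f) x).trans
    (lintegral_kernel_mul_enorm_le hμ hl f hx)
  rw [← ofReal_norm] at h
  have hN : 0 ≤ normLinfty μ f := apply_nonneg _ _
  have := weightW_pos μ hx
  exact (ENNReal.ofReal_le_ofReal_iff (by positivity)).1 h

/-- By Tonelli and the symmetry of the kernel, the kernel acts on the weight `s r = w / C_μ` instead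
of on `|f|`, and there it is multiplication by `1 / l`. -/
lemma lintegral_resolventFn_le {μ : Fin n → ℝ} (hμ : ∀ i, -(1 / 2 : ℝ) < μ i) {l : ℝ}
    (hl : 0 < l) (f : spaceY μ) :
    ∫⁻ x, ENNReal.ofReal (weightW μ x / constC μ) * ‖resolventFn μ l (toFn f) x‖ₑ
      ∂(orthantMeasure n) ≤ ENNReal.ofReal (l⁻¹ * normL1 μ f) := by
  have hC := constC_pos hμ
  have hw : Measurable fun x => ENNReal.ofReal (weightW μ x / constC μ) :=
    ((measurable_weightW μ).div_const _).ennreal_ofReal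
  have hf : Measurable fun x => ‖toFn f x‖ₑ := (AEEqFun.stronglyMeasurable (toFn f)).enorm
  calc _ ≤ ∫⁻ x, ∫⁻ y, ENNReal.ofReal (weightW μ x / constC μ) *
          (resolventKernel μ l x y * ‖toFn f y‖ₑ) ∂(orthantMeasure n) ∂(orthantMeasure n) := by
        refine lintegral_mono fun x => ?_
        rw [lintegral_const_mul _ ((measurable_kernel_left μ l x).fun_mul hf)]
        gcongr
        exact enorm_resolventFn_le μ l _ x
    _ = ∫⁻ y, ∫⁻ x, ENNReal.ofReal (weightW μ x / constC μ) *
          (resolventKernel μ l x y * ‖toFn f y‖ₑ) ∂(orthantMeasure n) ∂(orthantMeasure n) := by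
        refine lintegral_lintegral_swap (Measurable.aemeasurable ?_)
        exact (hw.comp measurable_fst).mul
          ((measurable_resolventKernel μ l).mul (hf.comp measurable_snd))
    _ = ∫⁻ y, ENNReal.ofReal l⁻¹ * (ENNReal.ofReal (weightW μ y / constC μ) * ‖toFn f y‖ₑ)
          ∂(orthantMeasure n) := by
        refine lintegral_congr_ae ?_
        filter_upwards [ae_mem_orthant n] with y hy
        have e : ∀ x, ENNReal.ofReal (weightW μ x / constC μ) *
            (resolventKernel μ l x y * ‖toFn f y‖ₑ) =
            (ENNReal.ofReal (constC μ)⁻¹ * ‖toFn f y‖ₑ) *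
              (resolventKernel μ l y x * ENNReal.ofReal (weightW μ x)) := by
          intro x
          rw [resolventKernel_comm μ l x y, div_eq_mul_inv,
            ENNReal.ofReal_mul' (inv_nonneg.2 hC.le)]
          ring
        simp only [e]
        rw [lintegral_const_mul _ ((measurable_kernel_left μ l y).fun_mul
          (measurable_weightW μ).ennreal_ofReal), lintegral_resolventKernel_weight hμ hl hy,
          div_eq_mul_inv, ENNReal.ofReal_mul' (inv_nonneg.2 hC.le)]
        ring
    _ = _ := by
        rw [lintegral_const_mul _ (hw.fun_mul hf), ← normL1_eq hμ,
          ENNReal.ofReal_mul (inv_nonneg.2 hl.le)]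

/-- The resolvent `(l - S_μ)⁻¹` on `Y`. -/
def resolventY (μ : Fin n → ℝ) (hμ : ∀ i, -(1 / 2 : ℝ) < μ i) (l : ℝ) (hl : 0 < l) :
    spaceY μ →ₗ[ℂ] spaceY μ where
  toFun f := ⟨AEEqFun.mk (resolventFn μ l (toFn f))
      (stronglyMeasurable_resolventFn μ l f).aestronglyMeasurable, by
    refine mem_submoduleY hμ (M := l⁻¹ * normLinfty μ f) ?_ ?_
    · refine ne_of_lt (lt_of_le_of_lt (le_of_eq (lintegral_congr_ae ?_))
        ((lintegral_resolventFn_le hμ hl f).trans_lt ENNReal.ofReal_lt_top))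
      filter_upwards [AEEqFun.coeFn_mk (resolventFn μ l (toFn f))
        (stronglyMeasurable_resolventFn μ l f).aestronglyMeasurable] with x hx
      rw [hx]
    · filter_upwards [AEEqFun.coeFn_mk (resolventFn μ l (toFn f))
        (stronglyMeasurable_resolventFn μ l f).aestronglyMeasurable, ae_mem_orthant n] with x hx h
      rw [hx]
      exact norm_resolventFn_le hμ hl f h⟩
  map_add' f g := by
    refine Subtype.ext (AEEqFun.ext ?_)
    refine (AEEqFun.coeFn_mk _ _).trans (EventuallyEq.symm ((AEEqFun.coeFn_add _ _).trans ?_))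
    filter_upwards [AEEqFun.coeFn_mk (resolventFn μ l (toFn f))
      (stronglyMeasurable_resolventFn μ l f).aestronglyMeasurable,
      AEEqFun.coeFn_mk (resolventFn μ l (toFn g))
      (stronglyMeasurable_resolventFn μ l g).aestronglyMeasurable, ae_mem_orthant n] with x h1 h2 hx
    rw [Pi.add_apply, h1, h2, resolventFn, resolventFn, resolventFn,
      ← integral_add (integrable_kernel_mul hμ hl f hx) (integrable_kernel_mul hμ hl g hx)]
    refine integral_congr_ae ?_
    filter_upwards [AEEqFun.coeFn_add (toFn f) (toFn g)] with y hy
    simp [hy, mul_add]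
  map_smul' c f := by
    refine Subtype.ext (AEEqFun.ext ?_)
    refine (AEEqFun.coeFn_mk _ _).trans (EventuallyEq.symm ((AEEqFun.coeFn_smul _ _).trans ?_))
    filter_upwards [AEEqFun.coeFn_mk (resolventFn μ l (toFn f))
      (stronglyMeasurable_resolventFn μ l f).aestronglyMeasurable] with x h1
    rw [Pi.smul_apply, RingHom.id_apply, h1, resolventFn, resolventFn, ← integral_smul]
    refine integral_congr_ae ?_
    filter_upwards [AEEqFun.coeFn_smul c (toFn f)] with y hy
    simp [hy, mul_left_comm]

lemma toFn_resolventY {μ : Fin n → ℝ} {hμ : ∀ i, -(1 / 2 : ℝ) < μ i} {l : ℝ} {hl : 0 < l}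
    (f : spaceY μ) :
    toFn (resolventY μ hμ l hl f) =ᵐ[orthantMeasure n] resolventFn μ l (toFn f) :=
  AEEqFun.coeFn_mk _ _

lemma normLinfty_resolventY_le {μ : Fin n → ℝ} (hμ : ∀ i, -(1 / 2 : ℝ) < μ i) {l : ℝ} (hl : 0 < l)
    (f : spaceY μ) : normLinfty μ (resolventY μ hμ l hl f) ≤ l⁻¹ * normLinfty μ f := by
  have hN : 0 ≤ normLinfty μ f := apply_nonneg _ _
  refine normLinfty_le μ _ (by positivity) ?_
  filter_upwards [toFn_resolventY (hμ := hμ) (hl := hl) f, ae_mem_orthant n] with x h1 hx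
  rw [h1]
  exact norm_resolventFn_le hμ hl f hx

lemma normL1_resolventY_le {μ : Fin n → ℝ} (hμ : ∀ i, -(1 / 2 : ℝ) < μ i) {l : ℝ} (hl : 0 < l)
    (f : spaceY μ) : normL1 μ (resolventY μ hμ l hl f) ≤ l⁻¹ * normL1 μ f := by
  have hN : 0 ≤ normL1 μ f := apply_nonneg _ _
  refine (ENNReal.ofReal_le_ofReal_iff (by positivity)).1 ?_
  rw [normL1_eq hμ]
  refine (le_of_eq (lintegral_congr_ae ?_)).trans (lintegral_resolventFn_le hμ hl f)
  filter_upwards [toFn_resolventY (hμ := hμ) (hl := hl) f] with x h1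
  rw [h1]

lemma normY_resolventY_le {μ : Fin n → ℝ} (hμ : ∀ i, -(1 / 2 : ℝ) < μ i) {l : ℝ} (hl : 0 < l)
    (f : spaceY μ) : normY μ (resolventY μ hμ l hl f) ≤ l⁻¹ * normY μ f := by
  have hl' : 0 ≤ l⁻¹ := by positivity
  rw [normY, Seminorm.sup_apply, Seminorm.sup_apply]
  refine max_le ((normL1_resolventY_le hμ hl f).trans ?_)
    ((normLinfty_resolventY_le hμ hl f).trans ?_)
  · exact mul_le_mul_of_nonneg_left (le_max_left _ _) hl'
  · exact mul_le_mul_of_nonneg_left (le_max_right _ _) hl'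

/-- The resolvent is symmetric with respect to the pairing `∫ f g dx`. -/
lemma integral_resolventY_mul {μ : Fin n → ℝ} (hμ : ∀ i, -(1 / 2 : ℝ) < μ i) {l : ℝ} (hl : 0 < l)
    (f g : spaceY μ) :
    ∫ x, toFn (resolventY μ hμ l hl f) x * toFn g x ∂(orthantMeasure n) =
      ∫ x, toFn f x * toFn (resolventY μ hμ l hl g) x ∂(orthantMeasure n) := by
  have hC := constC_pos hμ
  have hf : Measurable fun x => ‖toFn f x‖ₑ := (AEEqFun.stronglyMeasurable (toFn f)).enorm
  have hg : Measurable fun x => ‖toFn g x‖ₑ := (AEEqFun.stronglyMeasurable (toFn g)).enorm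
  -- Fubini needs both norms of `Y`: the kernel applied to `|f|` is at most a multiple of `w` by the
  -- `L^∞(r)` norm of `f`, and `w |g|` is integrable by the `L¹(s r)` norm of `g`.
  have hint : Integrable (Function.uncurry fun x y : Fin n → ℝ =>
      ((resolventKernel μ l x y).toReal : ℂ) * toFn f y * toFn g x)
      ((orthantMeasure n).prod (orthantMeasure n)) := by
    refine ⟨((stronglyMeasurable_kernel_mul μ l f).mul ((AEEqFun.stronglyMeasurable
      (toFn g)).comp_measurable measurable_fst)).aestronglyMeasurable, ?_⟩
    have hm : Measurable fun z : (Fin n → ℝ) × (Fin n → ℝ) =>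
        resolventKernel μ l z.1 z.2 * ‖toFn f z.2‖ₑ * ‖toFn g z.1‖ₑ :=
      ((measurable_resolventKernel μ l).mul (hf.comp measurable_snd)).mul (hg.comp measurable_fst)
    calc _ ≤ ∫⁻ z, resolventKernel μ l z.1 z.2 * ‖toFn f z.2‖ₑ * ‖toFn g z.1‖ₑ
            ∂((orthantMeasure n).prod (orthantMeasure n)) := by
          refine lintegral_mono fun z => ?_
          simp only [Function.uncurry]
          rw [enorm_mul]
          gcongr
          exact enorm_kernel_mul_le μ l _ _ _
      _ = ∫⁻ x, ∫⁻ y, resolventKernel μ l x y * ‖toFn f y‖ₑ * ‖toFn g x‖ₑ ∂(orthantMeasure n)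
            ∂(orthantMeasure n) := lintegral_prod _ hm.aemeasurable
      _ ≤ ∫⁻ x, ENNReal.ofReal (l⁻¹ * normLinfty μ f * constC μ) *
            (ENNReal.ofReal (weightW μ x / constC μ) * ‖toFn g x‖ₑ) ∂(orthantMeasure n) := by
          refine lintegral_mono_ae ?_
          filter_upwards [ae_mem_orthant n] with x hx
          rw [lintegral_mul_const _ ((measurable_kernel_left μ l x).fun_mul hf), ← mul_assoc,
            ← ENNReal.ofReal_mul' (div_nonneg (weightW_pos μ hx).le hC.le)]
          gcongr
          refine (lintegral_kernel_mul_enorm_le hμ hl f hx).trans (le_of_eq ?_)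
          congr 1
          field_simp
      _ < ⊤ := by
          rw [lintegral_const_mul _ ((((measurable_weightW μ).div_const _).ennreal_ofReal).fun_mul hg),
            ← normL1_eq hμ]
          exact ENNReal.mul_lt_top ENNReal.ofReal_lt_top ENNReal.ofReal_lt_top
  calc _ = ∫ x, ∫ y, ((resolventKernel μ l x y).toReal : ℂ) * toFn f y * toFn g x
          ∂(orthantMeasure n) ∂(orthantMeasure n) := by
        refine integral_congr_ae ?_
        filter_upwards [toFn_resolventY (hμ := hμ) (hl := hl) f] with x hx
        rw [hx, resolventFn, integral_mul_const]
    _ = ∫ y, ∫ x, ((resolventKernel μ l x y).toReal : ℂ) * toFn f y * toFn g x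
          ∂(orthantMeasure n) ∂(orthantMeasure n) := integral_integral_swap hint
    _ = _ := by
        refine integral_congr_ae ?_
        filter_upwards [toFn_resolventY (hμ := hμ) (hl := hl) g] with y hy
        rw [hy, resolventFn, ← integral_const_mul]
        refine integral_congr_ae (Eventually.of_forall fun x => ?_)
        simp only [resolventKernel_comm μ l x y]
        ring

/-! ### Rapidly decreasing functions belong to `Y` -/

/-- Near `0` the condition `β > -1` suffices; beyond `1` the choice of `N` makes the integrand at
most `x ^ (-2)`. -/
lemma integrableOn_rpow_div_one_add_sq {β : ℝ} (hβ : -1 < β) {N : ℕ} (hN : β + 2 ≤ 2 * N) :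
    IntegrableOn (fun x : ℝ => x ^ β / (1 + x ^ 2) ^ N) (Set.Ioi 0) := by
  have hm : Measurable fun x : ℝ => x ^ β / (1 + x ^ 2) ^ N := by fun_prop
  rw [← Set.Ioc_union_Ioi_eq_Ioi (zero_le_one' ℝ)]
  refine IntegrableOn.union ?_ ?_
  · have h := (intervalIntegral.intervalIntegrable_rpow' hβ (a := 0) (b := 1))
    rw [intervalIntegrable_iff_integrableOn_Ioc_of_le zero_le_one] at h
    refine Integrable.mono' h hm.aestronglyMeasurable ?_
    filter_upwards [ae_restrict_mem measurableSet_Ioc] with x hx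
    have := Real.rpow_nonneg hx.1.le β
    rw [Real.norm_of_nonneg (by positivity)]
    exact div_le_self this (one_le_pow₀ (by nlinarith [sq_nonneg x]))
  · have h := integrableOn_Ioi_rpow_of_lt (show (-2 : ℝ) < -1 by norm_num) zero_lt_one
    refine Integrable.mono' h hm.aestronglyMeasurable ?_
    filter_upwards [ae_restrict_mem measurableSet_Ioi] with x hx
    have hx1 : (1 : ℝ) < x := hx
    have hx0 : 0 < x := zero_lt_one.trans hx1
    have := Real.rpow_nonneg hx0.le β
    rw [Real.norm_of_nonneg (by positivity), div_le_iff₀ (by positivity)]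
    calc x ^ β ≤ x ^ (-2 + 2 * (N : ℝ)) := Real.rpow_le_rpow_of_exponent_le hx1.le (by linarith)
      _ = x ^ (-2 : ℝ) * (x ^ 2) ^ N := by
        rw [Real.rpow_add hx0, ← pow_mul, ← Real.rpow_natCast x (2 * N)]
        push_cast
        rfl
      _ ≤ _ := by
        gcongr
        linarith

lemma weightW_sq (μ : Fin n → ℝ) {x : Fin n → ℝ} (hx : x ∈ orthant n) :
    weightW μ x * weightW μ x = mpow x fun i => 2 * μ i + 1 := by
  rw [weightW, ← mpow_add hx]
  congr 1
  ext i
  ring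

lemma prod_one_add_sq_pow_le (x : Fin n → ℝ) (N : ℕ) :
    ∏ i, (1 + x i ^ 2) ^ N ≤ (1 + ∑ i, x i ^ 2) ^ (n * N) := by
  calc ∏ i, (1 + x i ^ 2) ^ N ≤ ∏ _i : Fin n, (1 + ∑ j, x j ^ 2) ^ N := by
        refine Finset.prod_le_prod (fun i _ => by positivity) fun i _ => ?_
        have : x i ^ 2 ≤ ∑ j, x j ^ 2 :=
          Finset.single_le_sum (f := fun j => x j ^ 2) (fun j _ => sq_nonneg _) (Finset.mem_univ i)
        gcongr
    _ = _ := by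
        rw [Finset.prod_const, Finset.card_univ, Fintype.card_fin, ← pow_mul, mul_comm]

/-- Powers of `x` are integrable against a sufficiently rapidly decreasing function. -/
lemma exists_integrable_mpow_div {β : Fin n → ℝ} (hβ : ∀ i, -1 < β i) :
    ∃ m : ℕ, Integrable (fun x => mpow x β / (1 + ∑ i, x i ^ 2) ^ m) (orthantMeasure n) := by
  -- One `N` for all coordinates: the sum bounds each of its nonnegative summands.
  obtain ⟨N, hN⟩ := exists_nat_ge (∑ i, (|β i| + 2))
  have hN' : ∀ i, β i + 2 ≤ 2 * N := by
    intro i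
    have h1 : |β i| + 2 ≤ ∑ j, (|β j| + 2) :=
      Finset.single_le_sum (f := fun j => |β j| + 2) (fun j _ => by positivity) (Finset.mem_univ i)
    have h2 := le_abs_self (β i)
    have h3 : (0 : ℝ) ≤ N := N.cast_nonneg
    linarith
  have h := Integrable.fintype_prod (𝕜 := ℝ) (E := ℝ)
    (μ := fun _ => volume.restrict (Set.Ioi (0 : ℝ)))
    (f := fun i x => x ^ β i / (1 + x ^ 2) ^ N)
    fun i => integrableOn_rpow_div_one_add_sq (hβ i) (hN' i)
  rw [← orthantMeasure_eq_pi] at h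
  -- Each of the `n` one-variable factors `(1 + x_i²) ^ N` is at most `(1 + ‖x‖²) ^ N`, whence the
  -- exponent `n * N`.
  refine ⟨n * N, h.mono' ?_ ?_⟩
  · refine Measurable.aestronglyMeasurable ?_
    unfold mpow
    fun_prop
  · filter_upwards [ae_mem_orthant n] with x hx
    have := mpow_pos hx β
    rw [Real.norm_of_nonneg (by positivity), Finset.prod_div_distrib]
    refine div_le_div_of_nonneg_left this.le (Finset.prod_pos fun i _ => by positivity) ?_
    exact prod_one_add_sq_pow_le x N

/-- A continuous function `φ` such that `r φ` is rapidly decreasing belongs to `Y`. -/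
lemma exists_toFn_ae_eq {μ : Fin n → ℝ} (hμ : ∀ i, -(1 / 2 : ℝ) < μ i) {φ : (Fin n → ℝ) → ℂ}
    (hφ : ContinuousOn φ (orthant n))
    (hb : ∀ m : ℕ, ∃ C : ℝ, ∀ x ∈ orthant n,
      (1 + ∑ i, x i ^ 2) ^ m * ‖(weightR μ x : ℂ) * φ x‖ ≤ C) :
    ∃ f : spaceY μ, toFn f =ᵐ[orthantMeasure n] φ := by
  have hmeas : AEStronglyMeasurable φ (orthantMeasure n) :=
    hφ.aestronglyMeasurable isOpen_orthant.measurableSet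
  have hC := constC_pos hμ
  have key : ∀ m C, (∀ x ∈ orthant n, (1 + ∑ i, x i ^ 2) ^ m * ‖(weightR μ x : ℂ) * φ x‖ ≤ C) →
      ∀ x ∈ orthant n, ‖φ x‖ ≤ C / (1 + ∑ i, x i ^ 2) ^ m * weightW μ x := by
    intro m C h x hx
    have h1 := h x hx
    have hw := weightW_pos μ hx
    have hr : 0 < weightR μ x := mpow_pos hx _
    rw [norm_mul, Complex.norm_real, Real.norm_eq_abs, abs_of_pos hr] at h1
    have hp : 0 < (1 + ∑ i, x i ^ 2) ^ m := by positivity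
    calc ‖φ x‖ = (1 + ∑ i, x i ^ 2) ^ m * (weightR μ x * ‖φ x‖) / (1 + ∑ i, x i ^ 2) ^ m *
          weightW μ x := by
          rw [mul_div_cancel_left₀ _ hp.ne', mul_right_comm, weightR_mul_weightW μ hx, one_mul]
      _ ≤ _ := by gcongr
  -- The `L¹` weight `w / C_μ` meets the bound of `φ` by a decaying multiple of `w`, so `w² = x ^
  -- (2μ + 1)` has to be integrable against the decay.
  obtain ⟨m, hm⟩ := exists_integrable_mpow_div (β := fun i => 2 * μ i + 1)
    fun i => by linarith [hμ i]
  obtain ⟨C, hCm⟩ := hb m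
  obtain ⟨M, hM⟩ := hb 0
  refine ⟨⟨AEEqFun.mk φ hmeas, mem_submoduleY hμ ?_ (M := M) ?_⟩, AEEqFun.coeFn_mk _ _⟩
  · refine ne_of_lt (lt_of_le_of_lt ?_ (hm.const_mul (C / constC μ)).2)
    refine lintegral_mono_ae ?_
    filter_upwards [AEEqFun.coeFn_mk φ hmeas, ae_mem_orthant n] with x h1 hx
    have hw := weightW_pos μ hx
    have h2 := key m C hCm x hx
    rw [h1, ← ofReal_norm, ← ofReal_norm, ← ENNReal.ofReal_mul (by positivity)]
    refine ENNReal.ofReal_le_ofReal (le_trans ?_ (le_abs_self _))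
    calc weightW μ x / constC μ * ‖φ x‖
        ≤ weightW μ x / constC μ * (C / (1 + ∑ i, x i ^ 2) ^ m * weightW μ x) := by gcongr
      _ = C / constC μ * (weightW μ x * weightW μ x / (1 + ∑ i, x i ^ 2) ^ m) := by ring
      _ = _ := by rw [weightW_sq μ hx]
  · filter_upwards [AEEqFun.coeFn_mk φ hmeas, ae_mem_orthant n] with x h1 hx
    rw [h1]
    simpa using key 0 M hM x hx

lemma opTpow_zero (φ : (Fin n → ℝ) → ℂ) : opTpow 0 φ = φ := by
  have : ∀ (l : List (Fin n)) (g : (Fin n → ℝ) → ℂ),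
      l.foldl (fun g i => (opT i)^[(0 : Fin n → ℕ) i] g) g = g := by
    intro l
    induction l with
    | nil => intro g; rfl
    | cons a l ih => intro g; exact ih g
  exact this _ _

lemma norm_one_add_pow_mul (x : Fin n → ℝ) (m : ℕ) (z : ℂ) :
    ‖(((1 + ∑ i, x i ^ 2) ^ m : ℝ) : ℂ) * z‖ = (1 + ∑ i, x i ^ 2) ^ m * ‖z‖ := by
  rw [norm_mul, Complex.norm_real, Real.norm_of_nonneg (by positivity)]

/-- The decay of `T_i^j (r φ)` for `φ ∈ H_μ`. -/
lemma zemanian_opT_decay {μ : Fin n → ℝ} {φ : (Fin n → ℝ) → ℂ} (hφ : φ ∈ zemanian μ) (i : Fin n)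
    (j m : ℕ) : ∃ C : ℝ, ∀ x ∈ orthant n,
      (1 + ∑ i, x i ^ 2) ^ m * ‖(opT i)^[j] (fun y => (weightR μ y : ℂ) * φ y) x‖ ≤ C := by
  obtain ⟨C, hC⟩ := hφ.2 m (Pi.single i j)
  refine ⟨C, fun x hx => ?_⟩
  have := hC x hx
  rwa [opTpow_single, norm_one_add_pow_mul] at this

lemma zemanian_decay {μ : Fin n → ℝ} {φ : (Fin n → ℝ) → ℂ} (hφ : φ ∈ zemanian μ) (m : ℕ) :
    ∃ C : ℝ, ∀ x ∈ orthant n, (1 + ∑ i, x i ^ 2) ^ m * ‖(weightR μ x : ℂ) * φ x‖ ≤ C := by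
  obtain ⟨C, hC⟩ := hφ.2 m 0
  refine ⟨C, fun x hx => ?_⟩
  have := hC x hx
  rwa [opTpow_zero, norm_one_add_pow_mul] at this

lemma sq_le_one_add_sum_sq (x : Fin n → ℝ) (i : Fin n) : x i ^ 2 ≤ 1 + ∑ j, x j ^ 2 := by
  have : x i ^ 2 ≤ ∑ j, x j ^ 2 :=
    Finset.single_le_sum (f := fun j => x j ^ 2) (fun j _ => sq_nonneg _) (Finset.mem_univ i)
  linarith

/-- In `∑ ((2μ_i + 2) T_i + x_i² T_i²)` the factor `x_i²` costs one power of `1 + ‖x‖²`, hence `m +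
1` for the second-order terms. -/
lemma zemanian_bessel_decay {μ : Fin n → ℝ} {φ : (Fin n → ℝ) → ℂ} (hφ : φ ∈ zemanian μ) (m : ℕ) :
    ∃ C : ℝ, ∀ x ∈ orthant n, (1 + ∑ i, x i ^ 2) ^ m * ‖(weightR μ x : ℂ) * bessel μ φ x‖ ≤ C := by
  choose C1 hC1 using fun i : Fin n => zemanian_opT_decay hφ i 1 m
  choose C2 hC2 using fun i : Fin n => zemanian_opT_decay hφ i 2 (m + 1)
  refine ⟨∑ i, (|2 * μ i + 2| * C1 i + C2 i), fun x hx => ?_⟩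
  rw [weight_mul_bessel μ hφ.1 hx]
  refine (mul_le_mul_of_nonneg_left (norm_sum_le _ _) (by positivity)).trans ?_
  rw [Finset.mul_sum]
  refine Finset.sum_le_sum fun i _ => ?_
  have h1 := hC1 i x hx
  have h2 := hC2 i x hx
  simp only [Function.iterate_succ, Function.comp, Function.iterate_zero, id] at h1 h2
  refine (mul_le_mul_of_nonneg_left (norm_add_le _ _) (by positivity)).trans ?_
  rw [mul_add]
  refine add_le_add ?_ ?_
  · rw [norm_mul, Complex.norm_real, Real.norm_eq_abs, mul_left_comm]
    exact mul_le_mul_of_nonneg_left h1 (abs_nonneg _)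
  · refine le_trans ?_ h2
    rw [norm_mul, Complex.norm_real, Real.norm_of_nonneg (sq_nonneg _), pow_succ _ m, mul_assoc]
    exact mul_le_mul_of_nonneg_left (mul_le_mul_of_nonneg_right (sq_le_one_add_sum_sq x i)
      (norm_nonneg _)) (by positivity)

lemma exists_toFn_ae_eq_zemanian {μ : Fin n → ℝ} (hμ : ∀ i, -(1 / 2 : ℝ) < μ i)
    {φ : (Fin n → ℝ) → ℂ} (hφ : φ ∈ zemanian μ) :
    ∃ f : spaceY μ, toFn f =ᵐ[orthantMeasure n] φ :=
  exists_toFn_ae_eq hμ hφ.1.continuousOn (zemanian_decay hφ)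

lemma exists_toFn_ae_eq_bessel {μ : Fin n → ℝ} (hμ : ∀ i, -(1 / 2 : ℝ) < μ i)
    {φ : (Fin n → ℝ) → ℂ} (hφ : φ ∈ zemanian μ) :
    ∃ f : spaceY μ, toFn f =ᵐ[orthantMeasure n] bessel μ φ :=
  exists_toFn_ae_eq hμ (contDiffOn_bessel μ hφ.1).continuousOn (zemanian_bessel_decay hφ)

/-! ### Gaussians belong to `H_μ` -/

lemma contDiff_expSq (a : Fin n → ℝ) : ContDiff ℝ ∞ (expSq a) := by
  unfold expSq
  fun_prop

lemma contDiffOn_gauss (μ a : Fin n → ℝ) :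
    ContDiffOn ℝ ∞ (fun x => (gauss μ a x : ℂ)) (orthant n) :=
  Complex.ofRealCLM.contDiff.comp_contDiffOn
    ((contDiffOn_mpow _).mul (contDiff_expSq a).contDiffOn)

lemma hasFDerivAt_expSq (a x : Fin n → ℝ) : HasFDerivAt (expSq a)
    (expSq a x • -∑ j, (a j * (2 * x j)) •
      ContinuousLinearMap.proj (R := ℝ) (φ := fun _ : Fin n => ℝ) j) x := by
  unfold expSq
  refine HasFDerivAt.exp (HasFDerivAt.neg (HasFDerivAt.fun_sum fun j _ => ?_))
  have h := ((hasFDerivAt_apply (𝕜 := ℝ) j x).pow 2).const_mul (a j)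
  refine h.congr_fderiv ?_
  ext v
  simp
  ring

lemma opT_expSq (a : Fin n → ℝ) (c : ℂ) (i : Fin n) {x : Fin n → ℝ} (hx : x ∈ orthant n) :
    opT i (fun y => c * (expSq a y : ℂ)) x = -2 * a i * (c * (expSq a x : ℂ)) := by
  have h : HasFDerivAt (fun y => c * (expSq a y : ℂ)) _ x :=
    (Complex.ofRealCLM.hasFDerivAt.comp x (hasFDerivAt_expSq a x)).const_mul c
  have hxi : (x i : ℂ) ≠ 0 := by exact_mod_cast (hx i).ne'
  rw [opT, pderiv, h.fderiv]
  simp only [smul_apply, ContinuousLinearMap.comp_apply, neg_apply, sum_apply,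
    ContinuousLinearMap.proj_apply, smul_eq_mul, Complex.ofRealCLM_apply]
  rw [Finset.sum_eq_single i]
  · rw [Pi.single_eq_same]
    push_cast
    field_simp
  · intro j _ hj
    rw [Pi.single_eq_of_ne hj, mul_zero]
  · simp

lemma weightR_mul_gauss (μ a : Fin n → ℝ) {x : Fin n → ℝ} (hx : x ∈ orthant n) :
    (weightR μ x : ℂ) * (gauss μ a x : ℂ) = (expSq a x : ℂ) := by
  rw [gauss, ← Complex.ofReal_mul, ← mul_assoc, weightR_mul_weightW μ hx, one_mul]

lemma opT_congr (i : Fin n) {f g : (Fin n → ℝ) → ℂ} (h : Set.EqOn f g (orthant n)) :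
    Set.EqOn (opT i f) (opT i g) (orthant n) := fun x hx => by
  rw [opT, opT, pderiv_congr i h hx]

/-- With `u = ∑ a_i x_i²` one has `1 + ‖x‖² ≤ M (1 + u)`, and `(1 + u) ^ m ≤ m! exp (1 + u)` is
beaten by `exp (-u)` up to the constant `m! e`. -/
lemma one_add_sum_sq_pow_mul_expSq_le {a : Fin n → ℝ} (ha : ∀ i, 0 < a i) (m : ℕ) :
    ∃ C : ℝ, ∀ x : Fin n → ℝ, (1 + ∑ i, x i ^ 2) ^ m * expSq a x ≤ C := by
  set M : ℝ := 1 + ∑ i, (a i)⁻¹ with hM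
  have hMi : ∀ i, (a i)⁻¹ ≤ M := fun i => by
    have : (a i)⁻¹ ≤ ∑ i, (a i)⁻¹ := Finset.single_le_sum (f := fun i => (a i)⁻¹)
      (fun j _ => (inv_pos.2 (ha j)).le) (Finset.mem_univ i)
    linarith
  have hM1 : 1 ≤ M := by
    have : 0 ≤ ∑ i, (a i)⁻¹ := Finset.sum_nonneg fun j _ => (inv_pos.2 (ha j)).le
    linarith
  refine ⟨M ^ m * (m.factorial * Real.exp 1), fun x => ?_⟩
  set u : ℝ := ∑ i, a i * x i ^ 2 with hu
  have hu0 : 0 ≤ u := Finset.sum_nonneg fun i _ => mul_nonneg (ha i).le (sq_nonneg _)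
  have h1 : 1 + ∑ i, x i ^ 2 ≤ M * (1 + u) := by
    have : ∑ i, x i ^ 2 ≤ M * u := by
      rw [hu, Finset.mul_sum]
      refine Finset.sum_le_sum fun i _ => ?_
      calc x i ^ 2 = (a i)⁻¹ * (a i * x i ^ 2) := by
            rw [← mul_assoc, inv_mul_cancel₀ (ha i).ne', one_mul]
        _ ≤ _ := mul_le_mul_of_nonneg_right (hMi i) (mul_nonneg (ha i).le (sq_nonneg _))
    linarith
  have h2 : (1 + u) ^ m ≤ m.factorial * Real.exp (1 + u) := by
    have := Real.pow_div_factorial_le_exp (1 + u) (by linarith) m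
    rwa [div_le_iff₀ (by positivity), mul_comm] at this
  have h3 : Real.exp (1 + u) * expSq a x = Real.exp 1 := by
    rw [expSq, ← Real.exp_add]
    congr 1
    ring
  have h0 : 0 < expSq a x := expSq_pos a x
  calc (1 + ∑ i, x i ^ 2) ^ m * expSq a x ≤ (M * (1 + u)) ^ m * expSq a x := by gcongr
    _ = M ^ m * ((1 + u) ^ m * expSq a x) := by rw [mul_pow, mul_assoc]
    _ ≤ M ^ m * ((m.factorial * Real.exp (1 + u)) * expSq a x) := by gcongr
    _ = _ := by rw [mul_assoc (m.factorial : ℝ), h3]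

/-- Dividing by `w` leaves `expSq a`, an eigenfunction of each `T_i` with eigenvalue `-2 a_i`. Thus
`T^k` only contributes a constant factor. -/
lemma gauss_mem_zemanian (μ : Fin n → ℝ) {a : Fin n → ℝ} (ha : ∀ i, 0 < a i) :
    (fun x => (gauss μ a x : ℂ)) ∈ zemanian μ := by
  refine ⟨contDiffOn_gauss μ a, fun m k => ?_⟩
  obtain ⟨c, hc⟩ := opTpow_induction
    (P := fun g => ∃ c : ℂ, Set.EqOn g (fun y => c * (expSq a y : ℂ)) (orthant n))
    (by
      rintro i g ⟨c, hc⟩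
      refine ⟨-2 * a i * c, fun x hx => ?_⟩
      simp only [opT_congr i hc hx, opT_expSq a c i hx, mul_assoc])
    k (φ := fun y => (weightR μ y : ℂ) * (gauss μ a y : ℂ))
    ⟨1, fun x hx => by simp only [weightR_mul_gauss μ a hx, one_mul]⟩
  obtain ⟨C, hC⟩ := one_add_sum_sq_pow_mul_expSq_le ha m
  refine ⟨‖c‖ * C, fun x hx => ?_⟩
  rw [norm_one_add_pow_mul, hc hx, norm_mul, Complex.norm_real,
    Real.norm_of_nonneg (expSq_pos a x).le, mul_left_comm]
  exact mul_le_mul_of_nonneg_left (hC x) (norm_nonneg _)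

/-- The factor of the Gaussian in `S_μ (gauss μ a)`. -/
def besselFactor (μ a x : Fin n → ℝ) : ℝ := ∑ i, (4 * a i ^ 2 * x i ^ 2 - 4 * a i * (μ i + 1))

/-- On `expSq a` the operator `(2μ_i + 2) T_i + x_i² T_i²` acts through the eigenvalue `-2 a_i` of
`T_i`. -/
lemma bessel_gauss (μ a : Fin n → ℝ) {x : Fin n → ℝ} (hx : x ∈ orthant n) :
    bessel μ (fun y => (gauss μ a y : ℂ)) x = ((gauss μ a x * besselFactor μ a x : ℝ) : ℂ) := by
  have h := weight_mul_bessel μ (contDiffOn_gauss μ a) hx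
  have h1 : Set.EqOn (fun y => (weightR μ y : ℂ) * (gauss μ a y : ℂ))
      (fun y => 1 * (expSq a y : ℂ)) (orthant n) := fun y hy => by
    simp only [weightR_mul_gauss μ a hy, one_mul]
  have h2 : ∀ i, Set.EqOn (opT i (fun y => (weightR μ y : ℂ) * (gauss μ a y : ℂ)))
      (fun y => (-2 * a i) * (expSq a y : ℂ)) (orthant n) := fun i y hy => by
    rw [opT_congr i h1 hy, opT_expSq a 1 i hy, one_mul]
  have h3 : ∀ i, opT i (opT i (fun y => (weightR μ y : ℂ) * (gauss μ a y : ℂ))) x =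
      -2 * a i * (-2 * a i * (expSq a x : ℂ)) := fun i => by
    rw [opT_congr i (h2 i) hx, opT_expSq a _ i hx]
  have hw : (weightW μ x : ℂ) * (weightR μ x : ℂ) = 1 := by
    rw [← Complex.ofReal_mul, mul_comm, weightR_mul_weightW μ hx, Complex.ofReal_one]
  calc bessel μ (fun y => (gauss μ a y : ℂ)) x
      = (weightW μ x : ℂ) * ((weightR μ x : ℂ) * bessel μ (fun y => (gauss μ a y : ℂ)) x) := by
        rw [← mul_assoc, hw, one_mul]
    _ = _ := by
        rw [h, gauss, besselFactor, Finset.mul_sum, Finset.mul_sum]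
        push_cast
        refine Finset.sum_congr rfl fun i _ => ?_
        rw [h2 i hx, h3 i]
        ring

/-! ### The evolution of Gaussians -/

lemma heatParam_pos {a : Fin n → ℝ} (ha : ∀ i, 0 < a i) {t : ℝ} (ht : 0 ≤ t) (i : Fin n) :
    0 < heatParam a t i := by
  have := ha i
  unfold heatParam
  positivity

lemma heatParam_le {a : Fin n → ℝ} (ha : ∀ i, 0 < a i) {t : ℝ} (ht : 0 ≤ t) (i : Fin n) :
    heatParam a t i ≤ a i := by
  have := ha i
  unfold heatParam
  refine div_le_self this.le ?_
  have : 0 ≤ 4 * a i * t := by positivity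
  linarith

lemma weightW_mul_heatExp (μ a : Fin n → ℝ) (t : ℝ) (x : Fin n → ℝ) :
    weightW μ x * heatExp μ a t x = heatCoeff μ a t * gauss μ (heatParam a t) x := by
  rw [heatExp, gauss]
  ring

lemma heatExp_time_zero (μ a x : Fin n → ℝ) : heatExp μ a 0 x = expSq a x := by
  simp [heatExp, heatCoeff, expSq, heatParam]

/-- Writing `H_t` as one exponential makes its positivity and its continuity and derivative in `t`
accessible. -/
lemma heatExp_eq_exp (μ : Fin n → ℝ) {a : Fin n → ℝ} (ha : ∀ i, 0 < a i) {t : ℝ} (ht : 0 ≤ t)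
    (x : Fin n → ℝ) : heatExp μ a t x =
      Real.exp (∑ i, (-(μ i + 1) * Real.log (1 + 4 * a i * t) -
        a i * x i ^ 2 / (1 + 4 * a i * t))) := by
  rw [heatExp, heatCoeff, expSq, Finset.sum_sub_distrib, Real.exp_sub, Real.exp_sum, div_eq_mul_inv,
    ← Real.exp_neg]
  congr 1
  · refine Finset.prod_congr rfl fun i _ => ?_
    have := ha i
    rw [Real.rpow_def_of_pos (by positivity), mul_comm]
  · congr 2
    refine Finset.sum_congr rfl fun i _ => ?_
    rw [heatParam]
    ring

/-- The functions `w H_t` solve the heat equation for `S_μ`. -/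
lemma hasDerivAt_heatExp (μ : Fin n → ℝ) {a : Fin n → ℝ} (ha : ∀ i, 0 < a i) {t : ℝ} (ht : 0 < t)
    (x : Fin n → ℝ) : HasDerivAt (fun s => heatExp μ a s x)
      (heatExp μ a t x * besselFactor μ (heatParam a t) x) t := by
  have h : HasDerivAt (fun s => Real.exp (∑ i, (-(μ i + 1) * Real.log (1 + 4 * a i * s) -
        a i * x i ^ 2 / (1 + 4 * a i * s))))
      (heatExp μ a t x * besselFactor μ (heatParam a t) x) t := by
    rw [heatExp_eq_exp μ ha ht.le, besselFactor]
    refine HasDerivAt.exp (HasDerivAt.fun_sum fun i _ => ?_)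
    have := ha i
    have hp : 1 + 4 * a i * t ≠ 0 := by positivity
    have h1 : HasDerivAt (fun s => 1 + 4 * a i * s) (4 * a i) t := by
      simpa using ((hasDerivAt_id t).const_mul (4 * a i)).const_add 1
    refine (((h1.log hp).const_mul (-(μ i + 1))).sub
      ((hasDerivAt_const t (a i * x i ^ 2)).div h1 hp)).congr_deriv ?_
    rw [heatParam]
    field_simp
    ring
  refine h.congr_of_eventuallyEq ?_
  filter_upwards [Ioi_mem_nhds ht] with s hs
  exact heatExp_eq_exp μ ha (le_of_lt hs) x

lemma heatExp_nonneg (μ : Fin n → ℝ) {a : Fin n → ℝ} (ha : ∀ i, 0 < a i) {t : ℝ} (ht : 0 ≤ t)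
    (x : Fin n → ℝ) : 0 ≤ heatExp μ a t x := by
  rw [heatExp_eq_exp μ ha ht]
  exact Real.exp_nonneg _

lemma heatCoeff_le_one {μ : Fin n → ℝ} (hμ : ∀ i, -(1 / 2 : ℝ) < μ i) {a : Fin n → ℝ}
    (ha : ∀ i, 0 < a i) {t : ℝ} (ht : 0 ≤ t) : heatCoeff μ a t ≤ 1 := by
  refine Finset.prod_le_one (fun i _ => ?_) fun i _ => ?_
  · have := ha i
    positivity
  · have := ha i
    have h : 0 ≤ 4 * a i * t := by positivity
    exact Real.rpow_le_one_of_one_le_of_nonpos (by linarith) (by linarith [hμ i])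

lemma expSq_le_one {a : Fin n → ℝ} (ha : ∀ i, 0 < a i) (x : Fin n → ℝ) : expSq a x ≤ 1 := by
  refine Real.exp_le_one_iff.2 (neg_nonpos.2 (Finset.sum_nonneg fun i _ => ?_))
  exact mul_nonneg (ha i).le (sq_nonneg _)

lemma heatExp_le_one {μ : Fin n → ℝ} (hμ : ∀ i, -(1 / 2 : ℝ) < μ i) {a : Fin n → ℝ}
    (ha : ∀ i, 0 < a i) {t : ℝ} (ht : 0 ≤ t) (x : Fin n → ℝ) : heatExp μ a t x ≤ 1 :=
  mul_le_one₀ (heatCoeff_le_one hμ ha ht) (expSq_pos _ _).le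
    (expSq_le_one (heatParam_pos ha ht) x)

/-- The bound is uniform in `t` and `x`, so a multiple of `|f| w` dominates the time derivative
under the integral. The parameters `b` stay below `a`, and `b_i x_i² exp (-∑ b_j x_j²) ≤ 1` absorbs
the unbounded factor. -/
lemma abs_heatExp_mul_besselFactor_le {μ : Fin n → ℝ} (hμ : ∀ i, -(1 / 2 : ℝ) < μ i)
    {a : Fin n → ℝ} (ha : ∀ i, 0 < a i) {t : ℝ} (ht : 0 ≤ t) (x : Fin n → ℝ) :
    |heatExp μ a t x * besselFactor μ (heatParam a t) x| ≤ ∑ i, (4 * a i + 4 * a i * (μ i + 1)) := by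
  set b := heatParam a t with hb
  have hb0 := heatParam_pos ha ht
  have hba := heatParam_le ha ht
  have hH0 := heatExp_nonneg μ ha ht x
  have hH1 := heatExp_le_one hμ ha ht x
  rw [besselFactor, Finset.mul_sum]
  refine (Finset.abs_sum_le_sum_abs _ _).trans (Finset.sum_le_sum fun i _ => ?_)
  rw [mul_sub]
  have hμi : 0 < μ i + 1 := by linarith [hμ i]
  have h0 := hb0 i
  have h1 := hba i
  refine (abs_sub _ _).trans (add_le_add ?_ ?_)
  · have h2 : b i * x i ^ 2 * expSq b x ≤ 1 := by
      have h3 : b i * x i ^ 2 ≤ ∑ j, b j * x j ^ 2 :=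
        Finset.single_le_sum (f := fun j => b j * x j ^ 2)
          (fun j _ => mul_nonneg (hb0 j).le (sq_nonneg _)) (Finset.mem_univ i)
      have h4 := (Real.add_one_le_exp (∑ j, b j * x j ^ 2))
      rw [expSq, Real.exp_neg, ← div_eq_mul_inv, div_le_one (Real.exp_pos _)]
      linarith
    have h5 : heatExp μ a t x ≤ expSq b x := by
      rw [heatExp]
      exact mul_le_of_le_one_left (expSq_pos _ _).le (heatCoeff_le_one hμ ha ht)
    rw [abs_of_nonneg (by positivity)]
    calc heatExp μ a t x * (4 * b i ^ 2 * x i ^ 2) ≤ expSq b x * (4 * b i ^ 2 * x i ^ 2) := by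
          gcongr
      _ = 4 * b i * (b i * x i ^ 2 * expSq b x) := by ring
      _ ≤ 4 * b i * 1 := by gcongr
      _ ≤ 4 * a i := by linarith
  · rw [abs_of_nonneg (by positivity)]
    calc heatExp μ a t x * (4 * b i * (μ i + 1)) ≤ 1 * (4 * a i * (μ i + 1)) := by gcongr
      _ = _ := one_mul _

lemma measurable_heatExp (μ a : Fin n → ℝ) :
    Measurable fun z : (Fin n → ℝ) × ℝ => heatExp μ a z.2 z.1 := by
  unfold heatExp heatCoeff expSq heatParam
  fun_prop

/-! ### Pairing with the evolution of Gaussians -/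

/-- The pairing of `f` with `w H_t`. -/
def heatPairing (μ a : Fin n → ℝ) (f : spaceY μ) (t : ℝ) : ℂ :=
  ∫ x, toFn f x * ((weightW μ x * heatExp μ a t x : ℝ) : ℂ) ∂(orthantMeasure n)

lemma integrable_toFn_mul_weightW {μ : Fin n → ℝ} (hμ : ∀ i, -(1 / 2 : ℝ) < μ i) (f : spaceY μ) :
    Integrable (fun x => toFn f x * (weightW μ x : ℂ)) (orthantMeasure n) := by
  refine integrable_mul hμ f
    (Complex.continuous_ofReal.comp_continuousOn (contDiffOn_mpow _).continuousOn) ⟨1, fun x hx => ?_⟩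
  rw [← Complex.ofReal_mul]
  simp [weightR_mul_weightW μ hx]

lemma heatPairing_time_zero (μ a : Fin n → ℝ) (f : spaceY μ) :
    heatPairing μ a f 0 = ∫ x, toFn f x * (gauss μ a x : ℂ) ∂(orthantMeasure n) := by
  simp only [heatPairing, heatExp_time_zero, gauss]

lemma norm_mul_weightW_mul_le {μ : Fin n → ℝ} (z : ℂ) (x : Fin n → ℝ) {h D : ℝ} (hD : |h| ≤ D) :
    ‖z * ((weightW μ x * h : ℝ) : ℂ)‖ ≤ ‖z * (weightW μ x : ℂ)‖ * D := by
  rw [Complex.ofReal_mul, ← mul_assoc, norm_mul, Complex.norm_real, Real.norm_eq_abs]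
  gcongr

lemma abs_heatExp_le_one {μ : Fin n → ℝ} (hμ : ∀ i, -(1 / 2 : ℝ) < μ i) {a : Fin n → ℝ}
    (ha : ∀ i, 0 < a i) {t : ℝ} (ht : 0 ≤ t) (x : Fin n → ℝ) : |heatExp μ a t x| ≤ 1 := by
  rw [abs_of_nonneg (heatExp_nonneg μ ha ht x)]
  exact heatExp_le_one hμ ha ht x

lemma aestronglyMeasurable_mul_weightW_mul {μ : Fin n → ℝ} (f : spaceY μ) {h : (Fin n → ℝ) → ℝ}
    (hh : Measurable h) : AEStronglyMeasurable
      (fun x => toFn f x * ((weightW μ x * h x : ℝ) : ℂ)) (orthantMeasure n) :=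
  (toFn f).aestronglyMeasurable.mul
    (Complex.measurable_ofReal.comp ((measurable_weightW μ).mul hh)).aestronglyMeasurable

lemma measurable_heatExp_left (μ a : Fin n → ℝ) (t : ℝ) : Measurable (heatExp μ a t) := by
  unfold heatExp heatCoeff expSq heatParam
  fun_prop

lemma norm_heatPairing_le {μ : Fin n → ℝ} (hμ : ∀ i, -(1 / 2 : ℝ) < μ i) {a : Fin n → ℝ}
    (ha : ∀ i, 0 < a i) (f : spaceY μ) {t : ℝ} (ht : 0 ≤ t) :
    ‖heatPairing μ a f t‖ ≤ ∫ x, ‖toFn f x * (weightW μ x : ℂ)‖ ∂(orthantMeasure n) := by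
  refine norm_integral_le_of_norm_le (integrable_toFn_mul_weightW hμ f).norm
    (Eventually.of_forall fun x => ?_)
  simpa using norm_mul_weightW_mul_le (toFn f x) x (abs_heatExp_le_one hμ ha ht x)

lemma continuousWithinAt_heatPairing {μ : Fin n → ℝ} (hμ : ∀ i, -(1 / 2 : ℝ) < μ i)
    {a : Fin n → ℝ} (ha : ∀ i, 0 < a i) (f : spaceY μ) {t : ℝ} (ht : 0 ≤ t) :
    ContinuousWithinAt (heatPairing μ a f) (Set.Ici 0) t := by
  unfold heatPairing
  refine continuousWithinAt_of_dominated
    (bound := fun x => ‖toFn f x * (weightW μ x : ℂ)‖ * 1) ?_ ?_ ?_ ?_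
  · exact Eventually.of_forall fun s =>
      aestronglyMeasurable_mul_weightW_mul f (measurable_heatExp_left μ a s)
  · filter_upwards [self_mem_nhdsWithin] with s hs
    exact Eventually.of_forall fun x =>
      norm_mul_weightW_mul_le (toFn f x) x (abs_heatExp_le_one hμ ha hs x)
  · exact (integrable_toFn_mul_weightW hμ f).norm.mul_const 1
  · refine Eventually.of_forall fun x => ContinuousWithinAt.mul continuousWithinAt_const ?_
    refine Complex.continuous_ofReal.continuousAt.comp_continuousWithinAt
      (ContinuousWithinAt.mul continuousWithinAt_const ?_)
    have hc : ContinuousWithinAt (fun s => Real.exp (∑ i, (-(μ i + 1) * Real.log (1 + 4 * a i * s) -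
        a i * x i ^ 2 / (1 + 4 * a i * s)))) (Set.Ici 0) t := by
      have hp : ∀ i, 1 + 4 * a i * t ≠ 0 := fun i => by
        have := ha i
        positivity
      have hl : ∀ i, ContinuousAt (fun s => 1 + 4 * a i * s) t := fun i => by fun_prop
      refine ContinuousAt.continuousWithinAt (ContinuousAt.rexp ?_)
      refine tendsto_finsetSum _ fun i _ => ?_
      exact (continuousAt_const.mul ((hl i).log (hp i))).sub (continuousAt_const.div (hl i) (hp i))
    exact hc.congr (fun s hs => heatExp_eq_exp μ ha hs x) (heatExp_eq_exp μ ha ht x)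

lemma hasDerivAt_heatPairing {μ : Fin n → ℝ} (hμ : ∀ i, -(1 / 2 : ℝ) < μ i)
    {a : Fin n → ℝ} (ha : ∀ i, 0 < a i) (f : spaceY μ) {t : ℝ} (ht : 0 < t) :
    HasDerivAt (heatPairing μ a f)
      (∫ x, toFn f x * ((weightW μ x * (heatExp μ a t x * besselFactor μ (heatParam a t) x) : ℝ) : ℂ)
        ∂(orthantMeasure n)) t := by
  unfold heatPairing
  refine (hasDerivAt_integral_of_dominated_loc_of_deriv_le
    (F := fun s x => toFn f x * ((weightW μ x * heatExp μ a s x : ℝ) : ℂ))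
    (F' := fun s x => toFn f x *
      ((weightW μ x * (heatExp μ a s x * besselFactor μ (heatParam a s) x) : ℝ) : ℂ))
    (bound := fun x => ‖toFn f x * (weightW μ x : ℂ)‖ * ∑ i, (4 * a i + 4 * a i * (μ i + 1)))
    (Ioi_mem_nhds ht) ?_ ?_ ?_ ?_ ?_ ?_).2
  · exact Eventually.of_forall fun s =>
      aestronglyMeasurable_mul_weightW_mul f (measurable_heatExp_left μ a s)
  · refine ((integrable_toFn_mul_weightW hμ f).norm.mul_const 1).mono'
      (aestronglyMeasurable_mul_weightW_mul f (measurable_heatExp_left μ a t))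
      (Eventually.of_forall fun x =>
        norm_mul_weightW_mul_le (toFn f x) x (abs_heatExp_le_one hμ ha ht.le x))
  · refine aestronglyMeasurable_mul_weightW_mul f ((measurable_heatExp_left μ a t).mul ?_)
    unfold besselFactor
    fun_prop
  · exact Eventually.of_forall fun x s hs =>
      norm_mul_weightW_mul_le (toFn f x) x (abs_heatExp_mul_besselFactor_le hμ ha (le_of_lt hs) x)
  · exact (integrable_toFn_mul_weightW hμ f).norm.mul_const _
  · refine Eventually.of_forall fun x s hs => ?_
    exact (((hasDerivAt_heatExp μ ha hs x).const_mul (weightW μ x)).ofReal_comp).const_mul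
      (toFn f x)

lemma integrableOn_exp_neg_mul {l : ℝ} (hl : 0 < l) :
    IntegrableOn (fun t => Real.exp (-(l * t))) (Set.Ioi (0 : ℝ)) := by
  simpa [neg_mul] using integrableOn_exp_mul_Ioi (a := -l) (by linarith) 0

/-- If `S_μ f = g` against Gaussians, then `(l - S_μ) f = l f - g` in integrated form. -/
lemma integral_exp_mul_heatPairing {μ : Fin n → ℝ} (hμ : ∀ i, -(1 / 2 : ℝ) < μ i) {f g : spaceY μ}
    (h : ∀ a : Fin n → ℝ, (∀ i, 0 < a i) →
      ∫ x, toFn g x * (gauss μ a x : ℂ) ∂(orthantMeasure n) =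
        ∫ x, toFn f x * bessel μ (fun y => (gauss μ a y : ℂ)) x ∂(orthantMeasure n))
    {l : ℝ} (hl : 0 < l) {a : Fin n → ℝ} (ha : ∀ i, 0 < a i) :
    ∫ t in Set.Ioi (0 : ℝ), (Real.exp (-(l * t)) : ℂ) *
        (heatPairing μ a g t - l * heatPairing μ a f t) =
      -∫ x, toFn f x * (gauss μ a x : ℂ) ∂(orthantMeasure n) := by
  -- At each time `w H_t` is `heatCoeff μ a t` times a Gaussian. Its time derivative is therefore
  -- `S_μ` of a function to which the hypothesis applies, and `S_μ` passes from it to `f`.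
  have hd : ∀ t : ℝ, 0 < t → HasDerivAt (heatPairing μ a f) (heatPairing μ a g t) t := by
    intro t ht
    refine (hasDerivAt_heatPairing hμ ha f ht).congr_deriv ?_
    have e1 : heatPairing μ a g t =
        heatCoeff μ a t * ∫ x, toFn g x * (gauss μ (heatParam a t) x : ℂ) ∂(orthantMeasure n) := by
      rw [heatPairing, ← integral_const_mul]
      refine integral_congr_ae (Eventually.of_forall fun x => ?_)
      simp only [weightW_mul_heatExp]
      push_cast
      ring
    rw [e1, h _ (heatParam_pos ha ht.le), ← integral_const_mul]
    refine integral_congr_ae ?_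
    filter_upwards [ae_mem_orthant n] with x hx
    rw [bessel_gauss μ _ hx, ← mul_assoc (weightW μ x), weightW_mul_heatExp]
    push_cast
    ring
  have hexp : ∀ t : ℝ, HasDerivAt (fun t : ℝ => (Real.exp (-(l * t)) : ℂ))
      (((Real.exp (-(l * t)) * (-l) : ℝ)) : ℂ) t := by
    intro t
    have h1 : HasDerivAt (fun t : ℝ => -(l * t)) (-l) t := by
      simpa using ((hasDerivAt_id' t).const_mul l).fun_neg
    exact h1.exp.ofReal_comp
  set Cf := ∫ x, ‖toFn f x * (weightW μ x : ℂ)‖ ∂(orthantMeasure n)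
  set Cg := ∫ x, ‖toFn g x * (weightW μ x : ℂ)‖ ∂(orthantMeasure n)
  have hint := integrableOn_exp_neg_mul hl
  have hcont : ∀ u : spaceY μ, ContinuousOn (heatPairing μ a u) (Set.Ioi 0) := fun u t ht =>
    (continuousWithinAt_heatPairing hμ ha u (le_of_lt ht)).mono Set.Ioi_subset_Ici_self
  -- The integrand is the derivative of `exp (-l t) ⟨f, w H_t⟩`, which starts at `⟨f, gauss⟩` and
  -- tends to `0` because the pairing is bounded in `t`.
  have key := integral_Ioi_of_hasDerivAt_of_tendsto (a := 0) (m := 0)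
    (f := fun t => (Real.exp (-(l * t)) : ℂ) * heatPairing μ a f t)
    (f' := fun t => (Real.exp (-(l * t)) : ℂ) * (heatPairing μ a g t - l * heatPairing μ a f t))
    ?_ ?_ ?_ ?_
  · rw [key, heatPairing_time_zero]
    simp
  · exact (hexp 0).continuousAt.continuousWithinAt.mul
      (continuousWithinAt_heatPairing hμ ha f le_rfl)
  · intro t ht
    refine ((hexp t).mul (hd t ht)).congr_deriv ?_
    push_cast
    ring
  · refine (hint.mul_const (Cg + l * Cf)).mono' ?_ ?_
    · refine ContinuousOn.aestronglyMeasurable ?_ measurableSet_Ioi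
      refine ContinuousOn.mul (fun t _ => (hexp t).continuousAt.continuousWithinAt) ?_
      exact (hcont g).sub (continuousOn_const.mul (hcont f))
    · filter_upwards [ae_restrict_mem measurableSet_Ioi] with t ht
      rw [norm_mul, Complex.norm_real, Real.norm_of_nonneg (Real.exp_nonneg _)]
      gcongr
      refine (norm_sub_le _ _).trans (add_le_add (norm_heatPairing_le hμ ha g (le_of_lt ht)) ?_)
      rw [norm_mul, Complex.norm_real, Real.norm_of_nonneg hl.le]
      exact mul_le_mul_of_nonneg_left (norm_heatPairing_le hμ ha f (le_of_lt ht)) hl.le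
  · have h0 : Tendsto (fun t => Real.exp (-(l * t)) * Cf) atTop (𝓝 0) := by
      have : Tendsto (fun t : ℝ => -(l * t)) atTop atBot :=
        tendsto_neg_atTop_atBot.comp (tendsto_id.const_mul_atTop hl)
      simpa using (Real.tendsto_exp_atBot.comp this).mul_const Cf
    refine squeeze_zero_norm' ?_ h0
    filter_upwards [eventually_ge_atTop 0] with t ht
    rw [norm_mul, Complex.norm_real, Real.norm_of_nonneg (Real.exp_nonneg _)]
    gcongr
    exact norm_heatPairing_le hμ ha f ht

/-! ### The resolvent on Gaussians -/

lemma exists_toFn_ae_eq_gauss {μ : Fin n → ℝ} (hμ : ∀ i, -(1 / 2 : ℝ) < μ i) {a : Fin n → ℝ}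
    (ha : ∀ i, 0 < a i) :
    ∃ G : spaceY μ, toFn G =ᵐ[orthantMeasure n] fun x => (gauss μ a x : ℂ) :=
  exists_toFn_ae_eq_zemanian hμ (gauss_mem_zemanian μ ha)

/-- The extended nonnegative identity `lintegral_resolventKernel_mul` passes to Bochner integrals
since `H_t ≤ 1` keeps both sides finite. -/
lemma resolventFn_gauss {μ : Fin n → ℝ} (hμ : ∀ i, -(1 / 2 : ℝ) < μ i) {l : ℝ} (hl : 0 < l)
    {a : Fin n → ℝ} (ha : ∀ i, 0 < a i) {x : Fin n → ℝ} (hx : x ∈ orthant n) :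
    resolventFn μ l (fun y => (gauss μ a y : ℂ)) x =
      ∫ t in Set.Ioi (0 : ℝ),
        ((Real.exp (-(l * t)) * (weightW μ x * heatExp μ a t x) : ℝ) : ℂ) := by
  have hw := weightW_pos μ hx
  have hint : IntegrableOn (fun t => Real.exp (-(l * t)) * (weightW μ x * heatExp μ a t x))
      (Set.Ioi (0 : ℝ)) := by
    refine ((integrableOn_exp_neg_mul hl).mul_const (weightW μ x)).mono' ?_ ?_
    · refine Measurable.aestronglyMeasurable ?_
      unfold heatExp heatCoeff expSq heatParam
      fun_prop
    · filter_upwards [ae_restrict_mem measurableSet_Ioi] with t ht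
      have h0 := heatExp_nonneg μ ha (le_of_lt ht) x
      rw [Real.norm_of_nonneg (by positivity)]
      gcongr
      exact mul_le_of_le_one_right hw.le (heatExp_le_one hμ ha (le_of_lt ht) x)
  have h1 := lintegral_resolventKernel_mul hμ l (fun i => (ha i).le) hx
  rw [← ofReal_integral_eq_lintegral_ofReal hint] at h1
  · have hne : ∫⁻ y, resolventKernel μ l x y * ENNReal.ofReal (gauss μ a y) ∂(orthantMeasure n) ≠ ⊤ :=
      h1 ▸ ENNReal.ofReal_ne_top
    have hm : Measurable fun y => resolventKernel μ l x y * ENNReal.ofReal (gauss μ a y) :=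
      (measurable_kernel_left μ l x).mul (measurable_gauss μ a).ennreal_ofReal
    have h2 := integral_toReal hm.aemeasurable (ae_lt_top hm hne)
    rw [h1, ENNReal.toReal_ofReal] at h2
    · rw [integral_complex_ofReal, ← h2, ← integral_complex_ofReal, resolventFn]
      refine integral_congr_ae ?_
      filter_upwards [ae_mem_orthant n] with y hy
      have hg : 0 ≤ gauss μ a y := mul_nonneg (weightW_pos μ hy).le (expSq_pos _ _).le
      rw [ENNReal.toReal_mul, ENNReal.toReal_ofReal hg]
      push_cast
      rfl
    · refine setIntegral_nonneg measurableSet_Ioi fun t ht => ?_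
      have h0 := heatExp_nonneg μ ha (le_of_lt ht) x
      positivity
  · filter_upwards [ae_restrict_mem measurableSet_Ioi] with t ht
    have h0 := heatExp_nonneg μ ha (le_of_lt ht) x
    positivity

lemma resolventFn_congr_ae (μ : Fin n → ℝ) (l : ℝ) {f g : (Fin n → ℝ) → ℂ}
    (h : f =ᵐ[orthantMeasure n] g) : resolventFn μ l f = resolventFn μ l g := by
  ext x
  refine integral_congr_ae ?_
  filter_upwards [h] with y hy
  rw [hy]

/-- The pairing of the resolvent with a Gaussian. -/
lemma integral_resolventY_mul_gauss {μ : Fin n → ℝ} (hμ : ∀ i, -(1 / 2 : ℝ) < μ i) {l : ℝ}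
    (hl : 0 < l) (f : spaceY μ) {a : Fin n → ℝ} (ha : ∀ i, 0 < a i) :
    ∫ x, toFn (resolventY μ hμ l hl f) x * (gauss μ a x : ℂ) ∂(orthantMeasure n) =
      ∫ t in Set.Ioi (0 : ℝ), (Real.exp (-(l * t)) : ℂ) * heatPairing μ a f t := by
  -- The Gaussian is taken as an element of `Y`, so that symmetry moves the resolvent onto it, where
  -- its action is explicit.
  obtain ⟨G, hG⟩ := exists_toFn_ae_eq_gauss hμ ha
  have e1 : ∫ x, toFn (resolventY μ hμ l hl f) x * (gauss μ a x : ℂ) ∂(orthantMeasure n) =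
      ∫ x, toFn (resolventY μ hμ l hl f) x * toFn G x ∂(orthantMeasure n) := by
    refine integral_congr_ae ?_
    filter_upwards [hG] with x hx
    rw [hx]
  have hint : Integrable (Function.uncurry fun (x : Fin n → ℝ) (t : ℝ) => toFn f x *
      ((Real.exp (-(l * t)) * (weightW μ x * heatExp μ a t x) : ℝ) : ℂ))
      ((orthantMeasure n).prod (volume.restrict (Set.Ioi 0))) := by
    have h0 : Integrable (fun t : ℝ => (Real.exp (-(l * t)) : ℂ))
        (volume.restrict (Set.Ioi 0)) := (integrableOn_exp_neg_mul hl).ofReal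
    have h1 := (integrable_toFn_mul_weightW hμ f).mul_prod h0
    have hm : Measurable fun z : (Fin n → ℝ) × ℝ => (heatExp μ a z.2 z.1 : ℂ) :=
      (measurable_heatExp μ a).complex_ofReal
    have h2 := h1.mul_bdd (c := 1) hm.aestronglyMeasurable ?_
    · refine h2.congr (Eventually.of_forall fun z => ?_)
      simp only [Function.uncurry, Complex.ofReal_mul]
      ring
    · have h3 : ∀ᵐ z ∂((orthantMeasure n).prod (volume.restrict (Set.Ioi (0 : ℝ)))),
          z.2 ∈ Set.Ioi (0 : ℝ) :=
        Measure.quasiMeasurePreserving_snd.ae (ae_restrict_mem measurableSet_Ioi)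
      filter_upwards [h3] with z hz
      rw [Complex.norm_real, Real.norm_eq_abs]
      exact abs_heatExp_le_one hμ ha (le_of_lt hz) z.1
  rw [e1, integral_resolventY_mul]
  calc _ = ∫ x, (∫ t in Set.Ioi (0 : ℝ), toFn f x *
        ((Real.exp (-(l * t)) * (weightW μ x * heatExp μ a t x) : ℝ) : ℂ)) ∂(orthantMeasure n) := by
        refine integral_congr_ae ?_
        filter_upwards [toFn_resolventY (hμ := hμ) (hl := hl) G, ae_mem_orthant n] with x h1 hx
        rw [h1, resolventFn_congr_ae μ l hG, resolventFn_gauss hμ hl ha hx, integral_const_mul]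
    _ = _ := by
        rw [integral_integral_swap hint]
        refine integral_congr_ae (Eventually.of_forall fun t => ?_)
        simp only [heatPairing]
        rw [← integral_const_mul]
        refine integral_congr_ae (Eventually.of_forall fun x => ?_)
        simp only [Complex.ofReal_mul]
        ring

/-! ### Gaussians separate the points of `Y` -/

/-- A bounded continuous injective function which is `exp (-x²)` on the half line. -/
def expSqInj (x : ℝ) : ℝ := if 0 ≤ x then Real.exp (-x ^ 2) else 2 - Real.exp (-x ^ 2)

lemma continuous_expSqInj : Continuous expSqInj := by
  unfold expSqInj
  refine Continuous.if_le (by fun_prop) (by fun_prop) continuous_const continuous_id ?_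
  rintro x rfl
  norm_num

lemma abs_expSqInj_le (x : ℝ) : |expSqInj x| ≤ 2 := by
  have h1 : Real.exp (-x ^ 2) ≤ 1 := Real.exp_le_one_iff.2 (by nlinarith [sq_nonneg x])
  have h2 := Real.exp_pos (-x ^ 2)
  unfold expSqInj
  split_ifs <;> rw [abs_le] <;> constructor <;> linarith

/-- The branch `x < 0` takes values above `1` and the other one values at most `1`; on each branch
`x²` and the sign of `x` are determined. Injectivity on the whole line makes the coordinates
`expSqInj (x i)` separate all points of the space, not only those of the orthant. -/
lemma injective_expSqInj : Function.Injective expSqInj := by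
  have hlt : ∀ x : ℝ, x < 0 → Real.exp (-x ^ 2) < 1 := fun x hx => by
    rw [← Real.exp_zero]
    exact Real.exp_lt_exp.2 (by nlinarith)
  have hle : ∀ x : ℝ, Real.exp (-x ^ 2) ≤ 1 := fun x =>
    Real.exp_le_one_iff.2 (by nlinarith [sq_nonneg x])
  intro x y h
  unfold expSqInj at h
  split_ifs at h with hx hy hy
  · have := Real.exp_injective h
    nlinarith
  · linarith [hlt y (not_le.1 hy), hle x]
  · linarith [hlt x (not_le.1 hx), hle y]
  · have h' : Real.exp (-x ^ 2) = Real.exp (-y ^ 2) := by linarith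
    have := Real.exp_injective h'
    nlinarith

/-- An integrable function all of whose moments against monomials in a bounded injective
continuous function of the coordinates vanish is zero. -/
lemma ae_eq_zero_of_moments_eq_zero {ν : Measure (Fin n → ℝ)} {F : (Fin n → ℝ) → ℝ}
    (hF : Integrable F ν)
    (h : ∀ k : Fin n → ℕ, ∫ x, F x * ∏ i, expSqInj (x i) ^ k i ∂ν = 0) : F =ᵐ[ν] 0 := by
  set z : Fin n → BoundedContinuousFunction (Fin n → ℝ) ℝ := fun i =>
    BoundedContinuousFunction.ofNormedAddCommGroup (fun x => expSqInj (x i))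
      (continuous_expSqInj.comp (continuous_apply i)) 2 fun x => abs_expSqInj_le _ with hz
  -- The algebra generated by the functions `z i` is spanned by the monomials of the hypothesis, so
  -- `F` integrates to zero against all of it.
  set A : StarSubalgebra ℝ (BoundedContinuousFunction (Fin n → ℝ) ℝ) :=
    { Algebra.adjoin ℝ (Set.range z) with
      star_mem' := fun {g} hg => by
        have : star g = g := by
          ext x
          simp
        rw [this]
        exact hg } with hA
  have hzA : ∀ i, z i ∈ A := fun i => Algebra.subset_adjoin (Set.mem_range_self i)
  have hzero : ∀ g ∈ A, ∫ x, F x * g x ∂ν = 0 := by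
    intro g hg
    have hg' : g ∈ Submodule.span ℝ ((Submonoid.closure (Set.range z) : Submonoid _) :
        Set (BoundedContinuousFunction (Fin n → ℝ) ℝ)) := by
      rw [← Algebra.adjoin_eq_span]
      exact hg
    clear hg
    have hint : ∀ g : BoundedContinuousFunction (Fin n → ℝ) ℝ, Integrable (fun x => F x * g x) ν :=
      fun g => hF.mul_bdd (c := ‖g‖) g.continuous.measurable.aestronglyMeasurable
        (Eventually.of_forall fun x => g.norm_coe_le_norm x)
    induction hg' using Submodule.span_induction with
    | mem g hg =>
      have hk : ∃ k : Fin n → ℕ, ∀ x, g x = ∏ i, expSqInj (x i) ^ k i := by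
        induction hg using Submonoid.closure_induction with
        | mem g hg =>
          obtain ⟨i, rfl⟩ := hg
          refine ⟨Pi.single i 1, fun x => ?_⟩
          rw [Finset.prod_eq_single i]
          · simp [hz]
          · intro j _ hj
            simp [Pi.single_eq_of_ne hj]
          · simp
        | one => exact ⟨0, fun x => by simp⟩
        | mul g₁ g₂ _ _ h₁ h₂ =>
          obtain ⟨k₁, h₁⟩ := h₁
          obtain ⟨k₂, h₂⟩ := h₂
          refine ⟨k₁ + k₂, fun x => ?_⟩
          simp [h₁, h₂, pow_add, Finset.prod_mul_distrib]
      obtain ⟨k, hk⟩ := hk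
      simp only [hk]
      exact h k
    | zero => simp
    | add g₁ g₂ _ _ h₁ h₂ =>
      simp only [BoundedContinuousFunction.coe_add, Pi.add_apply, mul_add]
      rw [integral_add (hint g₁) (hint g₂), h₁, h₂, add_zero]
    | smul c g _ h₁ =>
      simp only [BoundedContinuousFunction.coe_smul, smul_eq_mul, mul_left_comm _ c]
      rw [integral_const_mul, h₁, mul_zero]
  -- The positive and negative parts of `F` are densities of two finite measures that agree on a
  -- point-separating algebra of bounded continuous functions. Such measures coincide, so the two
  -- parts agree almost everywhere.
  have hfin : IsFiniteMeasure (ν.withDensity fun x => ENNReal.ofReal (F x)) :=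
    isFiniteMeasure_withDensity_ofReal hF.2
  have hfin' : IsFiniteMeasure (ν.withDensity fun x => ENNReal.ofReal (-F x)) :=
    isFiniteMeasure_withDensity_ofReal hF.neg.2
  have hmF : AEMeasurable (fun x => ENNReal.ofReal (F x)) ν := hF.1.aemeasurable.ennreal_ofReal
  have hmF' : AEMeasurable (fun x => ENNReal.ofReal (-F x)) ν :=
    hF.1.aemeasurable.neg.ennreal_ofReal
  have hext : (ν.withDensity fun x => ENNReal.ofReal (F x)) =
      ν.withDensity fun x => ENNReal.ofReal (-F x) := by
    refine ext_of_forall_mem_subalgebra_integral_eq_of_polish (A := A) ?_ fun g hg => ?_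
    · intro x y hxy
      obtain ⟨i, hi⟩ := Function.ne_iff.1 hxy
      refine ⟨z i, ⟨_, ⟨z i, hzA i, rfl⟩, rfl⟩, fun h => hi (injective_expSqInj h)⟩
    · rw [integral_withDensity_eq_integral_toReal_smul₀ hmF
        (Eventually.of_forall fun _ => ENNReal.ofReal_lt_top),
        integral_withDensity_eq_integral_toReal_smul₀ hmF'
        (Eventually.of_forall fun _ => ENNReal.ofReal_lt_top), ← sub_eq_zero, ← integral_sub]
      · rw [← hzero g hg]
        refine integral_congr_ae (Eventually.of_forall fun x => ?_)
        simp only [smul_eq_mul, ENNReal.toReal_ofReal', ← sub_mul, max_zero_sub_max_neg_zero_eq_self]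
      · simp only [smul_eq_mul, ENNReal.toReal_ofReal']
        exact hF.pos_part.mul_bdd (c := ‖g‖) g.continuous.measurable.aestronglyMeasurable
          (Eventually.of_forall fun x => g.norm_coe_le_norm x)
      · simp only [smul_eq_mul, ENNReal.toReal_ofReal']
        exact hF.neg_part.mul_bdd (c := ‖g‖) g.continuous.measurable.aestronglyMeasurable
          (Eventually.of_forall fun x => g.norm_coe_le_norm x)
  rw [withDensity_eq_iff hmF hmF' hF.lintegral_lt_top.ne] at hext
  filter_upwards [hext] with x hx
  have h1 := congrArg ENNReal.toReal hx
  simp only [ENNReal.toReal_ofReal'] at h1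
  rw [← max_zero_sub_max_neg_zero_eq_self (F x), h1, sub_self]
  rfl

/-- Gaussians separate the points of `Y`. -/
lemma eq_zero_of_integral_gauss {μ : Fin n → ℝ} (hμ : ∀ i, -(1 / 2 : ℝ) < μ i) {f : spaceY μ}
    (h : ∀ a : Fin n → ℝ, (∀ i, 0 < a i) →
      ∫ x, toFn f x * (gauss μ a x : ℂ) ∂(orthantMeasure n) = 0) : f = 0 := by
  set F : (Fin n → ℝ) → ℂ := fun x => toFn f x * (gauss μ 1 x : ℂ) with hFdef
  have hF : Integrable F (orthantMeasure n) := by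
    have hm : AEStronglyMeasurable (fun x => (expSq (1 : Fin n → ℝ) x : ℂ)) (orthantMeasure n) :=
      (Complex.continuous_ofReal.comp (contDiff_expSq _).continuous).aestronglyMeasurable
    refine ((integrable_toFn_mul_weightW hμ f).mul_bdd (c := 1) hm
      (Eventually.of_forall fun x => ?_)).congr (Eventually.of_forall fun x => ?_)
    · rw [Complex.norm_real, Real.norm_of_nonneg (expSq_pos _ _).le]
      exact expSq_le_one (fun _ => zero_lt_one) x
    · simp only [hFdef, gauss, Complex.ofReal_mul]
      ring
  -- On the orthant `gauss μ 1` times the monomial with exponents `k` is the Gaussian with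
  -- parameters `1 + k i`. The base Gaussian keeps the parameters positive when some `k i` vanishes.
  have hmom : ∀ k : Fin n → ℕ,
      ∫ x, F x * ((∏ i, expSqInj (x i) ^ k i : ℝ) : ℂ) ∂(orthantMeasure n) = 0 := by
    intro k
    rw [← h (fun i => 1 + k i) fun i => by positivity]
    refine integral_congr_ae ?_
    filter_upwards [ae_mem_orthant n] with x hx
    have e : ∏ i, expSqInj (x i) ^ k i = Real.exp (-∑ i, k i * x i ^ 2) := by
      rw [← Finset.sum_neg_distrib, Real.exp_sum]
      refine Finset.prod_congr rfl fun i _ => ?_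
      rw [expSqInj, if_pos (hx i).le, ← Real.exp_nat_mul]
      congr 1
      ring
    simp only [hFdef, mul_assoc, ← Complex.ofReal_mul]
    congr 2
    rw [e, gauss, gauss, expSq, expSq, mul_assoc, ← Real.exp_add]
    congr 2
    simp only [add_mul, Finset.sum_add_distrib, Pi.one_apply]
    ring
  have hb : ∀ k : Fin n → ℕ, Integrable
      (fun x => F x * ((∏ i, expSqInj (x i) ^ k i : ℝ) : ℂ)) (orthantMeasure n) := by
    intro k
    have hc : Continuous fun x : Fin n → ℝ => ((∏ i, expSqInj (x i) ^ k i : ℝ) : ℂ) :=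
      Complex.continuous_ofReal.comp (continuous_finsetProd _ fun i _ =>
        (continuous_expSqInj.comp (continuous_apply i)).pow _)
    refine hF.mul_bdd (c := ∏ i, 2 ^ k i) hc.aestronglyMeasurable (Eventually.of_forall fun x => ?_)
    rw [Complex.norm_real, Real.norm_eq_abs, Finset.abs_prod]
    refine Finset.prod_le_prod (fun i _ => abs_nonneg _) fun i _ => ?_
    rw [abs_pow]
    exact pow_le_pow_left₀ (abs_nonneg _) (abs_expSqInj_le _) _
  have hre := ae_eq_zero_of_moments_eq_zero hF.re fun k => by
    have h1 := integral_re (hb k)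
    rw [hmom k, map_zero] at h1
    rw [← h1]
    refine integral_congr_ae (Eventually.of_forall fun x => ?_)
    simp only [RCLike.re_eq_complex_re, Complex.re_mul_ofReal]
  have him := ae_eq_zero_of_moments_eq_zero hF.im fun k => by
    have h1 := integral_im (hb k)
    rw [hmom k, map_zero] at h1
    rw [← h1]
    refine integral_congr_ae (Eventually.of_forall fun x => ?_)
    simp only [RCLike.im_eq_complex_im, Complex.im_mul_ofReal]
  refine toFn_injective (AEEqFun.ext ?_)
  filter_upwards [hre, him, ae_mem_orthant n, AEEqFun.coeFn_zero (α := Fin n → ℝ) (β := ℂ)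
    (μ := orthantMeasure n)] with x h1 h2 hx h3
  rw [toFn_zero, h3]
  have h4 : F x = 0 := Complex.ext h1 h2
  have h5 : (gauss μ 1 x : ℂ) ≠ 0 := by
    exact_mod_cast (mul_pos (weightW_pos μ hx) (expSq_pos _ _)).ne'
  exact (mul_eq_zero.1 h4).resolve_right h5

/-! ### Symmetry of `S_μ` on `H_μ` -/

/-- Rapid decay at infinity on the orthant. -/
def RapidDecay (g : (Fin n → ℝ) → ℂ) : Prop :=
  ∀ m : ℕ, ∃ C : ℝ, ∀ x ∈ orthant n, (1 + ∑ i, x i ^ 2) ^ m * ‖g x‖ ≤ C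

lemma RapidDecay.add {f g : (Fin n → ℝ) → ℂ} (hf : RapidDecay f) (hg : RapidDecay g) :
    RapidDecay fun x => f x + g x := fun m => by
  obtain ⟨C, hC⟩ := hf m
  obtain ⟨D, hD⟩ := hg m
  refine ⟨C + D, fun x hx => ?_⟩
  calc (1 + ∑ i, x i ^ 2) ^ m * ‖f x + g x‖ ≤ (1 + ∑ i, x i ^ 2) ^ m * (‖f x‖ + ‖g x‖) := by
        gcongr
        exact norm_add_le _ _
    _ ≤ _ := by
        rw [mul_add]
        exact add_le_add (hC x hx) (hD x hx)

/-- Products with functions of polynomial growth. -/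
lemma RapidDecay.mul {f g : (Fin n → ℝ) → ℂ} (hf : RapidDecay f) {D : ℝ} {j : ℕ} (hD : 0 ≤ D)
    (hg : ∀ x ∈ orthant n, ‖g x‖ ≤ D * (1 + ∑ i, x i ^ 2) ^ j) :
    RapidDecay fun x => g x * f x := fun m => by
  obtain ⟨C, hC⟩ := hf (m + j)
  refine ⟨D * C, fun x hx => ?_⟩
  calc (1 + ∑ i, x i ^ 2) ^ m * ‖g x * f x‖
      ≤ (1 + ∑ i, x i ^ 2) ^ m * (D * (1 + ∑ i, x i ^ 2) ^ j * ‖f x‖) := by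
        rw [norm_mul]
        gcongr
        exact hg x hx
    _ = D * ((1 + ∑ i, x i ^ 2) ^ (m + j) * ‖f x‖) := by ring
    _ ≤ _ := mul_le_mul_of_nonneg_left (hC x hx) hD

lemma RapidDecay.const_mul {f : (Fin n → ℝ) → ℂ} (hf : RapidDecay f) (c : ℂ) :
    RapidDecay fun x => c * f x :=
  hf.mul (g := fun _ => c) (j := 0) (norm_nonneg c) fun x _ => by simp

lemma RapidDecay.integrable {g : (Fin n → ℝ) → ℂ} (hg : RapidDecay g)
    (hc : ContinuousOn g (orthant n)) {β : Fin n → ℝ} (hβ : ∀ i, -1 < β i) :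
    Integrable (fun x => (mpow x β : ℂ) * g x) (orthantMeasure n) := by
  obtain ⟨m, hm⟩ := exists_integrable_mpow_div hβ
  obtain ⟨C, hC⟩ := hg m
  refine (hm.const_mul C).mono' ?_ ?_
  · refine ContinuousOn.aestronglyMeasurable (ContinuousOn.mul ?_ hc) isOpen_orthant.measurableSet
    exact Complex.continuous_ofReal.comp_continuousOn (contDiffOn_mpow _).continuousOn
  · filter_upwards [ae_mem_orthant n] with x hx
    have h0 := mpow_pos hx β
    have h1 := hC x hx
    have hp : 0 < (1 + ∑ i, x i ^ 2) ^ m := by positivity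
    rw [norm_mul, Complex.norm_real, Real.norm_of_nonneg h0.le, mul_div_assoc', le_div_iff₀ hp]
    calc mpow x β * ‖g x‖ * (1 + ∑ i, x i ^ 2) ^ m
        = mpow x β * ((1 + ∑ i, x i ^ 2) ^ m * ‖g x‖) := by ring
      _ ≤ mpow x β * C := by gcongr
      _ = _ := mul_comm _ _

lemma norm_coord_le {x : Fin n → ℝ} (hx : x ∈ orthant n) (i : Fin n) :
    ‖(x i : ℂ)‖ ≤ 1 * (1 + ∑ j, x j ^ 2) ^ 1 := by
  have h := sq_le_one_add_sum_sq x i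
  have h0 : 0 ≤ ∑ j, x j ^ 2 := Finset.sum_nonneg fun _ _ => sq_nonneg _
  rw [Complex.norm_real, Real.norm_of_nonneg (hx i).le]
  nlinarith [hx i]

/-- If `|f t| ≤ D |t| ^ p` with `p > 1`, then `f` is differentiable at `0` with derivative `0`. -/
lemma hasDerivAt_zero_of_norm_le_rpow {f : ℝ → ℂ} {D p : ℝ} (hp : 1 < p)
    (h : ∀ t, ‖f t‖ ≤ D * |t| ^ p) : HasDerivAt f 0 0 := by
  have hf0 : f 0 = 0 := by
    have := h 0
    rwa [abs_zero, Real.zero_rpow (by linarith), mul_zero, norm_le_zero_iff] at this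
  rw [hasDerivAt_iff_tendsto_slope_zero]
  simp only [zero_add, hf0, sub_zero]
  have hlim : Tendsto (fun t : ℝ => D * |t| ^ (p - 1)) (𝓝[≠] 0) (𝓝 0) := by
    have hc : Continuous fun t : ℝ => D * |t| ^ (p - 1) :=
      continuous_const.mul (continuous_abs.rpow_const fun _ => Or.inr (by linarith))
    have := hc.tendsto 0
    rw [abs_zero, Real.zero_rpow (by linarith), mul_zero] at this
    exact this.mono_left nhdsWithin_le_nhds
  refine squeeze_zero_norm' ?_ hlim
  filter_upwards [self_mem_nhdsWithin] with t ht
  have ht0 : 0 < |t| := abs_pos.2 ht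
  rw [norm_smul, norm_inv, Real.norm_eq_abs, Real.rpow_sub_one ht0.ne', inv_mul_le_iff₀ ht0]
  refine (h t).trans (le_of_eq ?_)
  field_simp

/-- The integral over the orthant of a partial derivative `∂_i (x^β k)` with `β_i > 1` vanishes. -/
lemma integral_pderiv_mpow_mul {β : Fin n → ℝ} (i : Fin n) (hβi : 1 < β i) {k : (Fin n → ℝ) → ℂ}
    (hk : ContDiffOn ℝ ∞ k (orthant n)) {C : ℝ} (hb : ∀ x ∈ orthant n, ‖k x‖ ≤ C)
    (hint : Integrable (fun x => (mpow x β : ℂ) * k x) (orthantMeasure n))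
    (hint' : Integrable (pderiv i fun x => (mpow x β : ℂ) * k x) (orthantMeasure n)) :
    ∫ x, pderiv i (fun x => (mpow x β : ℂ) * k x) x ∂(orthantMeasure n) = 0 := by
  set W : (Fin n → ℝ) → ℂ := fun x => (mpow x β : ℂ) * k x with hW
  have hWs : ContDiffOn ℝ ∞ W (orthant n) :=
    (Complex.ofRealCLM.contDiff.comp_contDiffOn (contDiffOn_mpow _)).mul hk
  have hmeas : MeasurableSet (orthant n) := isOpen_orthant.measurableSet
  -- Extended by zero, `W` is differentiable along `e_i` at every point. If `x` is off the orthant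
  -- and `x + t e_i` in it, then `x_i ≤ 0 < x_i + t ≤ t`, so `W` there is at most a constant times
  -- `t ^ β_i`; as `β_i > 1`, the derivative at `x` is `0`.
  have hline : ∀ x, HasLineDerivAt ℝ ((orthant n).indicator W)
      ((orthant n).indicator (pderiv i W) x) x (Pi.single i 1) := by
    intro x
    by_cases hx : x ∈ orthant n
    · have hd : HasFDerivAt W (fderiv ℝ W x) x :=
        ((hWs.contDiffAt (isOpen_orthant.mem_nhds hx)).differentiableAt (by simp)).hasFDerivAt
      rw [Set.indicator_of_mem hx]
      refine HasFDerivAt.hasLineDerivAt (hd.congr_of_eventuallyEq ?_) _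
      filter_upwards [isOpen_orthant.mem_nhds hx] with y hy
      rw [Set.indicator_of_mem hy]
    · rw [Set.indicator_of_notMem hx]
      refine hasDerivAt_zero_of_norm_le_rpow
        (D := |∏ j ∈ Finset.univ.erase i, x j ^ β j| * |C|) hβi fun t => ?_
      by_cases hy : x + t • (Pi.single i 1 : Fin n → ℝ) ∈ orthant n
      · have hj : ∀ j, j ≠ i → (x + t • (Pi.single i 1 : Fin n → ℝ)) j = x j := fun j hj => by
          simp [hj]
        have hi : (x + t • (Pi.single i 1 : Fin n → ℝ)) i = x i + t := by simp
        have hxi : x i ≤ 0 := by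
          by_contra hcon
          refine hx fun j => ?_
          by_cases hji : j = i
          · subst hji
            exact not_le.1 hcon
          · rw [← hj j hji]
            exact hy j
        have hyi := hy i
        rw [hi] at hyi
        have ht : 0 < t := by linarith
        rw [Set.indicator_of_mem hy, hW, norm_mul, Complex.norm_real, Real.norm_eq_abs, mpow,
          ← Finset.mul_prod_erase _ _ (Finset.mem_univ i), hi, abs_mul,
          abs_of_pos (Real.rpow_pos_of_pos hyi _), abs_of_pos ht,
          Finset.prod_congr rfl fun j h => by rw [hj j (Finset.ne_of_mem_erase h)]]
        have h1 : (x i + t) ^ β i ≤ t ^ β i :=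
          Real.rpow_le_rpow hyi.le (by linarith) (by linarith)
        have h2 : ‖k (x + t • (Pi.single i 1 : Fin n → ℝ))‖ ≤ |C| := (hb _ hy).trans (le_abs_self C)
        calc _ ≤ t ^ β i * |∏ j ∈ Finset.univ.erase i, x j ^ β j| * |C| := by gcongr
          _ = _ := by ring
      · rw [Set.indicator_of_notMem hy, norm_zero]
        positivity
  have hi1 : Integrable ((orthant n).indicator W) := (integrable_indicator_iff hmeas).2 hint
  have hi2 : Integrable ((orthant n).indicator (pderiv i W)) :=
    (integrable_indicator_iff hmeas).2 hint'
  -- Integration by parts over the whole space against the constant `1`.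
  have h := integral_bilinear_hasLineDerivAt_right_eq_neg_left_of_integrable (μ := volume)
    (f := (orthant n).indicator W) (f' := (orthant n).indicator (pderiv i W))
    (g := fun _ : Fin n → ℝ => (1 : ℂ)) (g' := fun _ => 0) (v := Pi.single i (1 : ℝ))
    (B := ContinuousLinearMap.mul ℝ ℂ) (by simpa using hi2) (by simp) (by simpa using hi1)
    (fun x _ => hline x) (fun x _ => hasDerivAt_const _ _)
  simp only [ContinuousLinearMap.mul_apply', mul_zero, integral_zero, mul_one] at h
  rw [integral_indicator hmeas] at h
  exact neg_eq_zero.1 h.symm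

lemma pderiv_eq_mul_opT (i : Fin n) (f : (Fin n → ℝ) → ℂ) {x : Fin n → ℝ} (hx : x ∈ orthant n) :
    pderiv i f x = x i * opT i f x := by
  have hxi : (x i : ℂ) ≠ 0 := by exact_mod_cast (hx i).ne'
  rw [opT]
  push_cast
  rw [← mul_assoc, mul_inv_cancel₀ hxi, one_mul]

lemma opT_mul (i : Fin n) {f g : (Fin n → ℝ) → ℂ} {x : Fin n → ℝ} (hf : DifferentiableAt ℝ f x)
    (hg : DifferentiableAt ℝ g x) :
    opT i (fun y => f y * g y) x = opT i f x * g x + f x * opT i g x := by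
  simp only [opT, pderiv, fderiv_fun_mul hf hg, add_apply, smul_apply, smul_eq_mul]
  ring

lemma opT_add_const_mul (i : Fin n) {f g : (Fin n → ℝ) → ℂ} {x : Fin n → ℝ} (c : ℂ)
    (hf : DifferentiableAt ℝ f x) (hg : DifferentiableAt ℝ g x) :
    opT i (fun y => f y + c * g y) x = opT i f x + c * opT i g x := by
  simp only [opT, pderiv, fderiv_fun_add hf (hg.const_mul c), fderiv_const_mul hg, add_apply,
    smul_apply, smul_eq_mul]
  ring

lemma mpow_add_single (β : Fin n → ℝ) (i : Fin n) {x : Fin n → ℝ} (hx : x ∈ orthant n) :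
    mpow x (fun j => β j + (Pi.single i 1 : Fin n → ℝ) j) = mpow x β * x i := by
  rw [mpow_add hx]
  congr 1
  rw [mpow, Finset.prod_eq_single i]
  · simp
  · intro j _ hj
    simp [Pi.single_eq_of_ne hj]
  · simp

lemma differentiableAt_of_contDiffOn {f : (Fin n → ℝ) → ℂ} (hf : ContDiffOn ℝ ∞ f (orthant n))
    {x : Fin n → ℝ} (hx : x ∈ orthant n) : DifferentiableAt ℝ f x :=
  (hf.contDiffAt (isOpen_orthant.mem_nhds hx)).differentiableAt (by simp)

/-- The `i`-th term in `∫ (S_μ φ g - φ S_μ g) dx = 0` for a Gaussian `g`, in terms of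
`u = x^(-μ-1/2) φ`. -/
lemma integral_bessel_term {μ : Fin n → ℝ} (hμ : ∀ i, -(1 / 2 : ℝ) < μ i)
    {φ : (Fin n → ℝ) → ℂ} (hφ : φ ∈ zemanian μ) {a : Fin n → ℝ} (ha : ∀ i, 0 < a i) (i : Fin n)
    {u : (Fin n → ℝ) → ℂ} (hu : u = fun y => (weightR μ y : ℂ) * φ y) :
    let h : (Fin n → ℝ) → ℂ := fun x => (mpow x (fun j => 2 * μ j + 1) : ℂ) *
      ((((2 * μ i + 2 : ℝ) : ℂ) * (opT i u x + 2 * a i * u x) +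
        (x i : ℂ) ^ 2 * (opT i (opT i u) x - 4 * a i ^ 2 * u x)) * (expSq a x : ℂ))
    Integrable h (orthantMeasure n) ∧ ∫ x, h x ∂(orthantMeasure n) = 0 := by
  intro h
  have hus : ContDiffOn ℝ ∞ u (orthant n) := hu ▸ contDiffOn_weight μ hφ.1
  have hu1s := contDiffOn_opT i hus
  have hu2s := contDiffOn_opT i hu1s
  have hvs : ContDiffOn ℝ ∞ (fun x => (expSq a x : ℂ)) (orthant n) :=
    (Complex.ofRealCLM.contDiff.comp (contDiff_expSq a)).contDiffOn
  have hx1 : ContDiffOn ℝ ∞ (fun x : Fin n → ℝ => (x i : ℂ)) (orthant n) :=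
    (Complex.ofRealCLM.contDiff.comp (contDiff_apply ℝ ℝ i)).contDiffOn
  have hv1 : ∀ x ∈ orthant n, ‖(expSq a x : ℂ)‖ ≤ 1 * (1 + ∑ j, x j ^ 2) ^ 0 := fun x _ => by
    rw [Complex.norm_real, Real.norm_of_nonneg (expSq_pos _ _).le, pow_zero, mul_one]
    exact expSq_le_one ha x
  have hud : RapidDecay u := by
    rw [hu]
    exact zemanian_decay hφ
  have hu1d : RapidDecay (opT i u) := by
    rw [hu]
    exact zemanian_opT_decay hφ i 1
  have hu2d : RapidDecay (opT i (opT i u)) := by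
    rw [hu]
    exact zemanian_opT_decay hφ i 2
  -- For `v = expSq a` one has `T_i v = -2 a_i v`, so `g v` is the Wronskian `(T_i u) v - u (T_i
  -- v)`. The terms `u` and `v` carry no weight; `h` will be `∂_i (x ^ (2μ + 1) x_i g v)`.
  set g : (Fin n → ℝ) → ℂ := fun x => opT i u x + 2 * a i * u x with hg
  have hgs : ContDiffOn ℝ ∞ g (orthant n) := hu1s.add (contDiffOn_const.mul hus)
  have hgd : RapidDecay g := hu1d.add (hud.const_mul _)
  set k : (Fin n → ℝ) → ℂ := fun x => g x * (expSq a x : ℂ) with hk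
  have hks : ContDiffOn ℝ ∞ k (orthant n) := hgs.mul hvs
  have hkd : RapidDecay k := by
    have := hgd.mul zero_le_one hv1
    simpa only [hk, mul_comm] using this
  -- The extra factor `x_i`, from `∂_i = x_i T_i`, raises the exponent to `β_i = 2μ_i + 2`. It
  -- exceeds `1` exactly when `μ_i > -1/2`, which is what removes the boundary term at `x_i = 0`.
  set β : Fin n → ℝ := fun j => (2 * μ j + 1) + (Pi.single i 1 : Fin n → ℝ) j with hβ
  have hβ0 : ∀ j, -1 < β j := fun j => by
    have h1 : (0 : ℝ) ≤ (Pi.single i 1 : Fin n → ℝ) j := by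
      by_cases hj : j = i
      · subst hj; simp
      · simp [hj]
    simp only [hβ]
    linarith [hμ j]
  have hβi : β i = 2 * μ i + 2 := by
    simp only [hβ, Pi.single_eq_same]
    ring
  have hderiv : ∀ x ∈ orthant n, pderiv i (fun y => (mpow y β : ℂ) * k y) x = h x := by
    intro x hx
    have hxi : (x i : ℂ) ≠ 0 := by exact_mod_cast (hx i).ne'
    have hT : opT i k x = (opT i (opT i u) x - 4 * a i ^ 2 * u x) * (expSq a x : ℂ) := by
      have hTv := opT_expSq a 1 i hx
      simp only [one_mul] at hTv
      rw [hk, opT_mul i (differentiableAt_of_contDiffOn hgs hx)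
        (differentiableAt_of_contDiffOn hvs hx), hTv, hg,
        opT_add_const_mul i _ (differentiableAt_of_contDiffOn hu1s hx)
        (differentiableAt_of_contDiffOn hus hx)]
      ring
    rw [pderiv_mpow_mul β i hx (differentiableAt_of_contDiffOn hks hx), pderiv_eq_mul_opT i k hx,
      hT, hβi, hβ, mpow_add_single _ i hx]
    simp only [h, hk, hg]
    push_cast
    field_simp
  have hhi : Integrable h (orthantMeasure n) := by
    have hd2 : RapidDecay fun x => (x i : ℂ) * ((x i : ℂ) *
        (opT i (opT i u) x + (-(4 * (a i : ℂ) ^ 2)) * u x)) :=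
      ((hu2d.add (hud.const_mul _)).mul zero_le_one fun x hx => norm_coord_le hx i).mul
        zero_le_one fun x hx => norm_coord_le hx i
    have hd := ((hgd.const_mul ((2 * μ i + 2 : ℝ) : ℂ)).add hd2).mul zero_le_one hv1
    have hc : ContDiffOn ℝ ∞ (fun x => (expSq a x : ℂ) * (((2 * μ i + 2 : ℝ) : ℂ) * g x +
        (x i : ℂ) * ((x i : ℂ) * (opT i (opT i u) x + (-(4 * (a i : ℂ) ^ 2)) * u x))))
        (orthant n) :=
      hvs.mul ((contDiffOn_const.mul hgs).add (hx1.mul (hx1.mul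
        (hu2s.add (contDiffOn_const.mul hus)))))
    refine (hd.integrable hc.continuousOn (β := fun j => 2 * μ j + 1)
      fun j => by linarith [hμ j]).congr (Eventually.of_forall fun x => ?_)
    simp only [h, hg]
    ring
  refine ⟨hhi, ?_⟩
  have hae : h =ᵐ[orthantMeasure n] pderiv i fun y => (mpow y β : ℂ) * k y := by
    filter_upwards [ae_mem_orthant n] with x hx
    rw [hderiv x hx]
  obtain ⟨C, hC⟩ := hkd 0
  rw [integral_congr_ae hae]
  refine integral_pderiv_mpow_mul i (by rw [hβi]; linarith [hμ i]) hks (C := C)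
    (fun x hx => by simpa using hC x hx) (hkd.integrable hks.continuousOn hβ0) (hhi.congr hae)

/-- `S_μ` is symmetric: pairing of elements of `H_μ` with Gaussians. -/
lemma integral_bessel_mul_gauss {μ : Fin n → ℝ} (hμ : ∀ i, -(1 / 2 : ℝ) < μ i)
    {φ : (Fin n → ℝ) → ℂ} (hφ : φ ∈ zemanian μ) {a : Fin n → ℝ} (ha : ∀ i, 0 < a i)
    {f g : spaceY μ} (hf : toFn f =ᵐ[orthantMeasure n] φ)
    (hg : toFn g =ᵐ[orthantMeasure n] bessel μ φ) :
    ∫ x, toFn g x * (gauss μ a x : ℂ) ∂(orthantMeasure n) =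
      ∫ x, toFn f x * bessel μ (fun y => (gauss μ a y : ℂ)) x ∂(orthantMeasure n) := by
  have hG := gauss_mem_zemanian μ ha
  have h1 := fun i => integral_bessel_term hμ hφ ha i rfl
  rw [← sub_eq_zero, ← integral_sub (integrable_mul hμ g hG.1.continuousOn (zemanian_bound hG))
    (integrable_mul hμ f (contDiffOn_bessel μ hG.1).continuousOn (zemanian_bessel_bound hG))]
  -- Zero is expanded into the sum of the vanishing integrals of `integral_bessel_term`; what
  -- remains is a pointwise identity of integrands.
  rw [← Finset.sum_eq_zero fun i (_ : i ∈ Finset.univ) => (h1 i).2,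
    ← integral_finsetSum _ fun i _ => (h1 i).1]
  refine integral_congr_ae ?_
  filter_upwards [hf, hg, ae_mem_orthant n] with x hfx hgx hx
  have hb := weight_mul_bessel μ hφ.1 hx
  have hw : (weightW μ x : ℂ) * (weightR μ x : ℂ) = 1 := by
    rw [← Complex.ofReal_mul, mul_comm, weightR_mul_weightW μ hx, Complex.ofReal_one]
  rw [hfx, hgx, bessel_gauss μ a hx, ← weightW_sq μ hx]
  have e1 : bessel μ φ x * (gauss μ a x : ℂ) = ((weightW μ x * weightW μ x * expSq a x : ℝ) : ℂ) *
      ((weightR μ x : ℂ) * bessel μ φ x) := by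
    rw [gauss]
    push_cast
    linear_combination (-(weightW μ x : ℂ) * expSq a x * bessel μ φ x) * hw
  have e2 : φ x * ((gauss μ a x * besselFactor μ a x : ℝ) : ℂ) =
      ((weightW μ x * weightW μ x * expSq a x : ℝ) : ℂ) *
        (((weightR μ x : ℂ) * φ x) * (besselFactor μ a x : ℂ)) := by
    rw [gauss]
    push_cast
    linear_combination (-(weightW μ x : ℂ) * expSq a x * besselFactor μ a x * φ x) * hw
  rw [e1, e2, ← mul_sub, hb, besselFactor, Complex.ofReal_sum, Finset.mul_sum,
    ← Finset.sum_sub_distrib, Finset.mul_sum]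
  refine Finset.sum_congr rfl fun i _ => ?_
  push_cast
  ring

/-! ### The resolvent of `(S_μ)_Y` -/

lemma toFn_sub {μ : Fin n → ℝ} (f g : spaceY μ) : toFn (f - g) = toFn f - toFn g := rfl

lemma integral_toFn_sub_mul {μ : Fin n → ℝ} {f g : spaceY μ} {w : (Fin n → ℝ) → ℂ}
    (hf : Integrable (fun x => toFn f x * w x) (orthantMeasure n))
    (hg : Integrable (fun x => toFn g x * w x) (orthantMeasure n)) :
    ∫ x, toFn (f - g) x * w x ∂(orthantMeasure n) =
      (∫ x, toFn f x * w x ∂(orthantMeasure n)) - ∫ x, toFn g x * w x ∂(orthantMeasure n) := by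
  rw [← integral_sub hf hg]
  refine integral_congr_ae ?_
  filter_upwards [AEEqFun.coeFn_sub (toFn f) (toFn g)] with x hx
  rw [toFn_sub, hx, Pi.sub_apply, sub_mul]

lemma integral_toFn_smul_mul {μ : Fin n → ℝ} (c : ℂ) (f : spaceY μ) (w : (Fin n → ℝ) → ℂ) :
    ∫ x, toFn (c • f) x * w x ∂(orthantMeasure n) =
      c * ∫ x, toFn f x * w x ∂(orthantMeasure n) := by
  rw [← integral_const_mul]
  refine integral_congr_ae ?_
  filter_upwards [AEEqFun.coeFn_smul c (toFn f)] with x hx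
  rw [toFn_smul, hx, Pi.smul_apply, smul_eq_mul, mul_assoc]

lemma integrable_toFn_mul_zemanian {μ : Fin n → ℝ} (hμ : ∀ i, -(1 / 2 : ℝ) < μ i) (f : spaceY μ)
    {φ : (Fin n → ℝ) → ℂ} (hφ : φ ∈ zemanian μ) :
    Integrable (fun x => toFn f x * φ x) (orthantMeasure n) :=
  integrable_mul hμ f hφ.1.continuousOn (zemanian_bound hφ)

lemma integrable_toFn_mul_bessel {μ : Fin n → ℝ} (hμ : ∀ i, -(1 / 2 : ℝ) < μ i) (f : spaceY μ)
    {φ : (Fin n → ℝ) → ℂ} (hφ : φ ∈ zemanian μ) :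
    Integrable (fun x => toFn f x * bessel μ φ x) (orthantMeasure n) :=
  integrable_mul hμ f (contDiffOn_bessel μ hφ.1).continuousOn (zemanian_bessel_bound hφ)

lemma heatPairing_smul_sub {μ : Fin n → ℝ} (hμ : ∀ i, -(1 / 2 : ℝ) < μ i) {a : Fin n → ℝ}
    (ha : ∀ i, 0 < a i) (l : ℂ) (f g : spaceY μ) {t : ℝ} (ht : 0 ≤ t) :
    heatPairing μ a (l • f - g) t = l * heatPairing μ a f t - heatPairing μ a g t := by
  have hint : ∀ u : spaceY μ, Integrable
      (fun x => toFn u x * ((weightW μ x * heatExp μ a t x : ℝ) : ℂ)) (orthantMeasure n) := fun u =>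
    ((integrable_toFn_mul_weightW hμ u).norm.mul_const 1).mono'
      (aestronglyMeasurable_mul_weightW_mul u (measurable_heatExp_left μ a t))
      (Eventually.of_forall fun x =>
        norm_mul_weightW_mul_le (toFn u x) x (abs_heatExp_le_one hμ ha ht x))
  rw [heatPairing, integral_toFn_sub_mul (hint _) (hint _), integral_toFn_smul_mul]
  rfl

/-- The resolvent is a left inverse of `l - S_μ`, even for the weak definition of `S_μ` in which
only Gaussians are test functions. -/
lemma resolventY_smul_sub {μ : Fin n → ℝ} (hμ : ∀ i, -(1 / 2 : ℝ) < μ i) {f g : spaceY μ}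
    (h : ∀ a : Fin n → ℝ, (∀ i, 0 < a i) →
      ∫ x, toFn g x * (gauss μ a x : ℂ) ∂(orthantMeasure n) =
        ∫ x, toFn f x * bessel μ (fun y => (gauss μ a y : ℂ)) x ∂(orthantMeasure n))
    {l : ℝ} (hl : 0 < l) : resolventY μ hμ l hl ((l : ℂ) • f - g) = f := by
  rw [← sub_eq_zero]
  -- Paired with a Gaussian, the resolvent of `l f - g` is the Laplace integral of `l ⟨f, w H_t⟩ -
  -- ⟨g, w H_t⟩`, which `integral_exp_mul_heatPairing` evaluates.
  refine eq_zero_of_integral_gauss hμ fun a ha => ?_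
  have hG := gauss_mem_zemanian μ ha
  rw [integral_toFn_sub_mul (integrable_toFn_mul_zemanian hμ _ hG)
    (integrable_toFn_mul_zemanian hμ _ hG), integral_resolventY_mul_gauss hμ hl _ ha, sub_eq_zero,
    ← neg_inj, ← integral_exp_mul_heatPairing hμ h hl ha, ← integral_neg]
  refine setIntegral_congr_fun measurableSet_Ioi fun t ht => ?_
  simp only [heatPairing_smul_sub hμ ha _ f g (le_of_lt ht)]
  ring

lemma resolventY_of_mem_graph {μ : Fin n → ℝ} {hμ : ∀ i, -(1 / 2 : ℝ) < μ i} {f g : spaceY μ}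
    (h : (f, g) ∈ besselGraph μ hμ) {l : ℝ} (hl : 0 < l) :
    resolventY μ hμ l hl ((l : ℂ) • f - g) = f :=
  resolventY_smul_sub hμ (fun _ ha => h _ (gauss_mem_zemanian μ ha)) hl

/-- The right inverse follows from the left one by duality. For `φ` in `H_μ`, both `φ` and `S_μ φ`
represent elements of `Y`, so `φ = R (l φ - S_μ φ)`; by symmetry of `R`, `⟨h, φ⟩ = ⟨R h, l φ - S_μ
φ⟩`. -/
lemma resolventY_mem_graph {μ : Fin n → ℝ} (hμ : ∀ i, -(1 / 2 : ℝ) < μ i) {l : ℝ} (hl : 0 < l)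
    (h : spaceY μ) :
    (resolventY μ hμ l hl h, (l : ℂ) • resolventY μ hμ l hl h - h) ∈ besselGraph μ hμ := by
  intro φ hφ
  obtain ⟨f, hf⟩ := exists_toFn_ae_eq_zemanian hμ hφ
  obtain ⟨g, hg⟩ := exists_toFn_ae_eq_bessel hμ hφ
  have hfg := resolventY_smul_sub hμ
    (fun a ha => integral_bessel_mul_gauss hμ hφ ha hf hg) hl
  set u := resolventY μ hμ l hl h
  have e : ∀ v : spaceY μ, ∫ x, toFn v x * φ x ∂(orthantMeasure n) =
      ∫ x, toFn f x * toFn v x ∂(orthantMeasure n) := fun v => by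
    refine integral_congr_ae ?_
    filter_upwards [hf] with x hx
    rw [hx, mul_comm]
  have e' : ∫ x, toFn u x * bessel μ φ x ∂(orthantMeasure n) =
      ∫ x, toFn g x * toFn u x ∂(orthantMeasure n) := by
    refine integral_congr_ae ?_
    filter_upwards [hg] with x hx
    rw [hx, mul_comm]
  have hif : Integrable (fun x => toFn f x * toFn u x) (orthantMeasure n) :=
    (integrable_toFn_mul_zemanian hμ u hφ).congr (by
      filter_upwards [hf] with x hx
      rw [hx, mul_comm])
  have hifl : Integrable (fun x => toFn ((l : ℂ) • f) x * toFn u x) (orthantMeasure n) :=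
    (hif.const_mul (l : ℂ)).congr (by
      filter_upwards [AEEqFun.coeFn_smul (l : ℂ) (toFn f)] with x hx
      rw [toFn_smul, hx, Pi.smul_apply, smul_eq_mul, mul_assoc])
  have hig : Integrable (fun x => toFn g x * toFn u x) (orthantMeasure n) :=
    (integrable_toFn_mul_bessel hμ u hφ).congr (by
      filter_upwards [hg] with x hx
      rw [hx, mul_comm])
  show ∫ x, toFn ((l : ℂ) • u - h) x * φ x ∂(orthantMeasure n) =
    ∫ x, toFn u x * bessel μ φ x ∂(orthantMeasure n)
  rw [integral_toFn_sub_mul (integrable_toFn_mul_zemanian hμ _ hφ)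
    (integrable_toFn_mul_zemanian hμ _ hφ), integral_toFn_smul_mul, e', e, e]
  have hsym := integral_resolventY_mul hμ hl ((l : ℂ) • f - g) h
  rw [hfg, integral_toFn_sub_mul hifl hig, integral_toFn_smul_mul] at hsym
  rw [hsym]
  ring

lemma mem_domain_of_mem_graph {μ : Fin n → ℝ} {hμ : ∀ i, -(1 / 2 : ℝ) < μ i} {f g : spaceY μ}
    (h : (f, g) ∈ besselGraph μ hμ) :
    ∃ hf : f ∈ (besselY μ hμ).domain, besselY μ hμ ⟨f, hf⟩ = g := by
  rw [← Submodule.toLinearPMap_graph_eq (besselGraph μ hμ) (besselGraph_functional μ hμ)] at h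
  obtain ⟨y, hy, hyg⟩ := (LinearPMap.mem_graph_iff _).1 h
  have hy' : (y : spaceY μ) = f := hy
  refine ⟨hy' ▸ y.2, ?_⟩
  subst hy'
  exact hyg

lemma besselY_mem_graph {μ : Fin n → ℝ} {hμ : ∀ i, -(1 / 2 : ℝ) < μ i}
    (f : (besselY μ hμ).domain) : ((f : spaceY μ), besselY μ hμ f) ∈ besselGraph μ hμ := by
  rw [← Submodule.toLinearPMap_graph_eq (besselGraph μ hμ) (besselGraph_functional μ hμ)]
  exact LinearPMap.mem_graph _ f

/-! ### The resolvent on `B` -/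

lemma mem_powDomain_succ {μ : Fin n → ℝ} {hμ : ∀ i, -(1 / 2 : ℝ) < μ i} {k : ℕ} {f : spaceY μ} :
    f ∈ powDomain μ hμ (k + 1) ↔
      ∃ hf : f ∈ (besselY μ hμ).domain, besselY μ hμ ⟨f, hf⟩ ∈ powDomain μ hμ k := by
  constructor
  · rintro ⟨y, hy, rfl⟩
    exact ⟨y.2, hy⟩
  · rintro ⟨hf, h⟩
    exact ⟨⟨f, hf⟩, h, rfl⟩

lemma powDomain_succ_le (μ : Fin n → ℝ) (hμ : ∀ i, -(1 / 2 : ℝ) < μ i) (k : ℕ) :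
    powDomain μ hμ (k + 1) ≤ powDomain μ hμ k := by
  induction k with
  | zero => exact fun _ _ => Submodule.mem_top
  | succ k ih =>
    intro f hf
    obtain ⟨hf, h⟩ := mem_powDomain_succ.1 hf
    exact mem_powDomain_succ.2 ⟨hf, ih h⟩

/-- Induction on `k` through `S_μ R f = l R f - f`, whose right side is as regular as `R f` and `f`.
-/
lemma resolventY_mem_powDomain {μ : Fin n → ℝ} {hμ : ∀ i, -(1 / 2 : ℝ) < μ i} {l : ℝ} (hl : 0 < l)
    {k : ℕ} {f : spaceY μ} (hf : f ∈ powDomain μ hμ k) :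
    resolventY μ hμ l hl f ∈ powDomain μ hμ k := by
  induction k with
  | zero => exact Submodule.mem_top
  | succ k ih =>
    obtain ⟨h1, h2⟩ := mem_domain_of_mem_graph (resolventY_mem_graph hμ hl f)
    refine mem_powDomain_succ.2 ⟨h1, ?_⟩
    have hf' := powDomain_succ_le μ hμ k hf
    rw [h2]
    exact Submodule.sub_mem _ (Submodule.smul_mem _ _ (ih hf')) hf'

/-- The resolvent `(l - S_μ)⁻¹` on `B`. -/
def resolventB (μ : Fin n → ℝ) (hμ : ∀ i, -(1 / 2 : ℝ) < μ i) (l : ℝ) (hl : 0 < l) :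
    spaceB μ hμ →ₗ[ℂ] spaceB μ hμ :=
  (resolventY μ hμ l hl).restrict (p := ⨅ k, powDomain μ hμ k) (q := ⨅ k, powDomain μ hμ k)
    fun _ hf => (Submodule.mem_iInf _).2 fun k =>
      resolventY_mem_powDomain hl ((Submodule.mem_iInf _).1 hf k)

variable {μ : Fin n → ℝ} {hμ : ∀ i, -(1 / 2 : ℝ) < μ i}

lemma inclB_injective : Function.Injective (inclB μ hμ) := Subtype.val_injective

lemma inclB_resolventB {l : ℝ} (hl : 0 < l) (f : spaceB μ hμ) :
    inclB μ hμ (resolventB μ hμ l hl f) = resolventY μ hμ l hl (inclB μ hμ f) := rfl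

lemma besselB_mem_graph (f : spaceB μ hμ) :
    (inclB μ hμ f, inclB μ hμ (besselB μ hμ f)) ∈ besselGraph μ hμ :=
  besselY_mem_graph ⟨inclB μ hμ f, inclB_mem_domain f⟩

lemma besselB_resolventB {l : ℝ} (hl : 0 < l) (f : spaceB μ hμ) :
    besselB μ hμ (resolventB μ hμ l hl f) = (l : ℂ) • resolventB μ hμ l hl f - f := by
  obtain ⟨h1, h2⟩ := mem_domain_of_mem_graph (resolventY_mem_graph hμ hl (inclB μ hμ f))
  refine inclB_injective (Eq.trans ?_ h2)
  rfl

lemma resolventB_besselB {l : ℝ} (hl : 0 < l) (f : spaceB μ hμ) :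
    resolventB μ hμ l hl (besselB μ hμ f) = (l : ℂ) • resolventB μ hμ l hl f - f := by
  refine inclB_injective ?_
  have h := resolventY_of_mem_graph (besselB_mem_graph f) hl
  rw [map_sub, map_smul] at h
  rw [map_sub, map_smul, inclB_resolventB, inclB_resolventB, eq_sub_iff_add_eq]
  nth_rewrite 1 [← h]
  abel

/-- `S_μ R` and `R S_μ` both equal `l R - 1`, so `R` commutes with every power of `S_μ`. -/
lemma inclB_besselB_pow_resolventB {l : ℝ} (hl : 0 < l) (k : ℕ) (f : spaceB μ hμ) :
    inclB μ hμ ((besselB μ hμ ^ k) (resolventB μ hμ l hl f)) =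
      resolventY μ hμ l hl (inclB μ hμ ((besselB μ hμ ^ k) f)) := by
  have h : Commute (besselB μ hμ) (resolventB μ hμ l hl) := LinearMap.ext fun f =>
    (besselB_resolventB hl f).trans (resolventB_besselB hl f).symm
  have h1 : (besselB μ hμ ^ k) (resolventB μ hμ l hl f) =
      resolventB μ hμ l hl ((besselB μ hμ ^ k) f) := LinearMap.congr_fun (h.pow_left k) f
  rw [h1, inclB_resolventB]

lemma rho_resolventB_le {l : ℝ} (hl : 0 < l) (m : ℕ) (f : spaceB μ hμ) :
    rho μ hμ m (resolventB μ hμ l hl f) ≤ l⁻¹ * rho μ hμ m f := by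
  have h0 : 0 ≤ rho μ hμ m f := apply_nonneg _ _
  refine Seminorm.finset_sup_apply_le (by positivity) fun k hk => ?_
  have h1 : normY μ (inclB μ hμ ((besselB μ hμ ^ k) f)) ≤ rho μ hμ m f :=
    Seminorm.le_finset_sup_apply (x := f)
      (p := fun k => (normY μ).comp (inclB μ hμ ∘ₗ (besselB μ hμ ^ k))) hk
  rw [Seminorm.comp_apply, LinearMap.comp_apply, inclB_besselB_pow_resolventB]
  exact (normY_resolventY_le hμ hl _).trans (mul_le_mul_of_nonneg_left h1 (by positivity))

lemma continuous_resolventB {l : ℝ} (hl : 0 < l) : Continuous (resolventB μ hμ l hl) := by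
  refine (withSeminorms_rho μ hμ).continuous_of_isBounded (withSeminorms_rho μ hμ) _
    fun m => ⟨{m}, ⟨l⁻¹, by positivity⟩, fun f => ?_⟩
  rw [Finset.sup_singleton]
  exact rho_resolventB_le hl m f

/-- The resolvent `(l - S_μ)⁻¹` on `B` as a continuous linear map. -/
def resolventBCLM (μ : Fin n → ℝ) (hμ : ∀ i, -(1 / 2 : ℝ) < μ i) (l : ℝ) (hl : 0 < l) :
    spaceB μ hμ →L[ℂ] spaceB μ hμ :=
  ⟨resolventB μ hμ l hl, continuous_resolventB hl⟩

/-! ### The resolvent on the strong dual -/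

/-- A continuous linear map sends bounded sets to bounded sets, so precomposition with it respects
uniform convergence on bounded sets. -/
lemma continuous_besselDual (μ : Fin n → ℝ) (hμ : ∀ i, -(1 / 2 : ℝ) < μ i) :
    Continuous (besselDual μ hμ) :=
  (ContinuousLinearMap.precomp ℂ (⟨besselB μ hμ, continuous_besselB μ hμ⟩ :
    spaceB μ hμ →L[ℂ] spaceB μ hμ)).continuous

/-- The resolvent `(l - S_μ)⁻¹` on the strong dual of `B`. -/
def resolventDual (μ : Fin n → ℝ) (hμ : ∀ i, -(1 / 2 : ℝ) < μ i) (l : ℝ) (hl : 0 < l) :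
    dualB μ hμ →L[ℂ] dualB μ hμ :=
  ContinuousLinearMap.precomp ℂ (resolventBCLM μ hμ l hl)

/-- The image of a bounded subset of `B` under all operators `l (l - S_μ)⁻¹` is bounded. -/
lemma isVonNBounded_resolventB {S : Set (spaceB μ hμ)} (hS : Bornology.IsVonNBounded ℂ S) :
    Bornology.IsVonNBounded ℂ
      {g | ∃ (l : ℝ) (hl : 0 < l), ∃ f ∈ S, g = (l : ℂ) • resolventB μ hμ l hl f} := by
  rw [(withSeminorms_rho μ hμ).isVonNBounded_iff_seminorm_bounded] at hS ⊢
  intro m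
  obtain ⟨r, hr, h⟩ := hS m
  refine ⟨r, hr, ?_⟩
  rintro _ ⟨l, hl, f, hf, rfl⟩
  -- In `ρ_m(l R f) ≤ ρ_m(f)` no constant appears, so the radius `r` of `S` serves for all `l`.
  refine lt_of_le_of_lt ?_ (h f hf)
  rw [map_smul_eq_mul, Complex.norm_real, Real.norm_of_nonneg hl.le]
  refine (mul_le_mul_of_nonneg_left (rho_resolventB_le hl m f) hl.le).trans (le_of_eq ?_)
  rw [← mul_assoc, mul_inv_cancel₀ hl.ne', one_mul]

/-- The unit ball of `p` contains all functionals mapping some bounded set `S` into some `V`. The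
set of all `l R_l f` with `f` in `S` is still bounded, so the functionals mapping it into `V` form a
neighbourhood `U`, and every transposed `l R_l` sends `U` into that ball. The seminorm `q` is the
supremum of `p` composed with these operators. -/
lemma equicontinuous_resolventDual (p : Seminorm ℂ (dualB μ hμ)) (hp : Continuous p) :
    ∃ q : Seminorm ℂ (dualB μ hμ), Continuous q ∧
      ∀ (l : ℝ) (hl : 0 < l) (T : dualB μ hμ), p ((l : ℂ) • resolventDual μ hμ l hl T) ≤ q T := by
  have hball : p.ball 0 1 ∈ 𝓝 (0 : dualB μ hμ) := p.ball_mem_nhds hp one_pos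
  obtain ⟨⟨S, V⟩, ⟨hS, hV⟩, hSV⟩ := ContinuousLinearMap.hasBasis_nhds_zero.mem_iff.1 hball
  set U : Set (dualB μ hμ) := {T | ∀ g ∈
    {g | ∃ (l : ℝ) (hl : 0 < l), ∃ f ∈ S, g = (l : ℂ) • resolventB μ hμ l hl f}, T g ∈ V} with hU
  have hUn : U ∈ 𝓝 (0 : dualB μ hμ) :=
    ContinuousLinearMap.hasBasis_nhds_zero.mem_of_mem (i := (_, V))
      ⟨isVonNBounded_resolventB hS, hV⟩
  have hUp : ∀ T ∈ U, ∀ (l : ℝ) (hl : 0 < l), p ((l : ℂ) • resolventDual μ hμ l hl T) ≤ 1 := by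
    intro T hT l hl
    have : (l : ℂ) • resolventDual μ hμ l hl T ∈ p.ball 0 1 := hSV fun f hf => by
      have := hT _ ⟨l, hl, f, hf, rfl⟩
      rwa [map_smul] at this
    exact ((Seminorm.mem_ball_zero _).1 this).le
  set P : {l : ℝ // 0 < l} → Seminorm ℂ (dualB μ hμ) := fun l =>
    p.comp ((l : ℂ) • (resolventDual μ hμ l.1 l.2 : dualB μ hμ →ₗ[ℂ] dualB μ hμ)) with hP
  -- `U` contains `c • T` for some `c ≠ 0`, so the values at `T` are at most `‖c‖⁻¹`. Pointwise
  -- boundedness is needed for the supremum of the seminorms to be computed pointwise.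
  have hbdd : ∀ T, BddAbove (Set.range fun l => P l T) := by
    intro T
    have hlim : Tendsto (fun c : ℂ => c • T) (𝓝[≠] 0) (𝓝 0) := by
      have : Tendsto (fun c : ℂ => c • T) (𝓝 0) (𝓝 ((0 : ℂ) • T)) :=
        (continuous_id.smul continuous_const).tendsto 0
      have h0 : (0 : ℂ) • T = 0 := zero_smul ℂ T
      rw [h0] at this
      exact this.mono_left nhdsWithin_le_nhds
    obtain ⟨c, hcU, hc⟩ := ((hlim.eventually_mem hUn).and self_mem_nhdsWithin).exists
    refine ⟨‖c‖⁻¹, ?_⟩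
    rintro _ ⟨l, rfl⟩
    have h1 := hUp _ hcU l.1 l.2
    rw [(resolventDual μ hμ l.1 l.2).map_smul, smul_comm, map_smul_eq_mul] at h1
    have hc0 : 0 < ‖c‖ := norm_pos_iff.2 hc
    rw [← one_div, le_div_iff₀ hc0, mul_comm]
    exact h1
  have hbdd' : BddAbove (Set.range P) := Seminorm.bddAbove_range_iff.2 hbdd
  have hsup : ∀ T, (⨆ l, P l) T = ⨆ l, P l T := fun T => by
    rw [Seminorm.coe_iSup_eq hbdd', iSup_apply]
  refine ⟨⨆ l, P l, ?_, fun l hl T => ?_⟩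
  -- The supremum is at most `1` on the neighbourhood `U` of zero, which makes it continuous.
  · refine Seminorm.continuous' (r := 1) (mem_of_superset hUn fun T hT => ?_)
    have : Nonempty {l : ℝ // 0 < l} := ⟨⟨1, one_pos⟩⟩
    rw [Seminorm.mem_closedBall_zero, hsup]
    exact ciSup_le fun l => hUp T hT l.1 l.2
  · rw [hsup]
    exact le_ciSup (hbdd T) ⟨l, hl⟩

lemma isClosed_neg_besselDual (μ : Fin n → ℝ) (hμ : ∀ i, -(1 / 2 : ℝ) < μ i) :
    ((-besselDual μ hμ).toPMap ⊤).IsClosed := by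
  have h : (((-besselDual μ hμ).toPMap ⊤).graph : Set (dualB μ hμ × dualB μ hμ)) =
      {p | p.2 = -besselDual μ hμ p.1} := by
    ext ⟨T, U⟩
    rw [SetLike.mem_coe, LinearPMap.mem_graph_iff]
    constructor
    · rintro ⟨y, rfl, rfl⟩
      rfl
    · rintro h
      exact ⟨⟨T, Submodule.mem_top⟩, rfl, h.symm⟩
  rw [LinearPMap.IsClosed, h]
  exact isClosed_eq continuous_snd ((continuous_besselDual μ hμ).neg.comp continuous_fst)

lemma isNonnegativeOperator_neg_besselDual (μ : Fin n → ℝ) (hμ : ∀ i, -(1 / 2 : ℝ) < μ i) :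
    IsNonnegativeOperator ((-besselDual μ hμ).toPMap ⊤) := by
  refine ⟨isClosed_neg_besselDual μ hμ,
    fun l => if hl : 0 < l then resolventDual μ hμ l hl else 0, fun l hl => ?_, fun p hp => ?_⟩
  · simp only [dif_pos hl]
    refine ⟨fun T => ⟨⟨resolventDual μ hμ l hl T, Submodule.mem_top⟩, rfl, ?_⟩, fun T => ?_⟩
    · refine ContinuousLinearMap.ext fun f => ?_
      show (l : ℂ) * T (resolventB μ hμ l hl f) + -T (resolventB μ hμ l hl (besselB μ hμ f)) = T f
      rw [resolventB_besselB, map_sub, map_smul, smul_eq_mul]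
      ring
    · refine ContinuousLinearMap.ext fun f => ?_
      show (l : ℂ) * (T : dualB μ hμ) (resolventB μ hμ l hl f) +
        -(T : dualB μ hμ) (besselB μ hμ (resolventB μ hμ l hl f)) = (T : dualB μ hμ) f
      rw [besselB_resolventB, map_sub, map_smul, smul_eq_mul]
      ring
  · obtain ⟨q, hq, h⟩ := equicontinuous_resolventDual p hp
    refine ⟨q, hq, fun l hl T => ?_⟩
    simp only [dif_pos hl]
    exact h l hl T

end FractionalBessel

end

open FractionalBessel in
theorem theorem4p9 {n : ℕ} (μ : Fin n → ℝ) (hμ : ∀ i, -(1 / 2 : ℝ) < μ i) :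
    -- `-(S_μ)_{B'}` is continuous for the strong topology of `B'`
    Continuous (-besselDual μ hμ) ∧
    -- `-(S_μ)_{B'}`, with domain the whole space `B'`, is non-negative
    IsNonnegativeOperator ((-besselDual μ hμ).toPMap ⊤) ∧
    -- `B'` is sequentially complete
    (∀ u : ℕ → dualB μ hμ, CauchySeq u → ∃ T : dualB μ hμ, Tendsto u atTop (𝓝 T)) := by
  refine ⟨(continuous_besselDual μ hμ).neg, isNonnegativeOperator_neg_besselDual μ hμ, ?_⟩
  -- The countable family `ρ_m` makes `B` first countable, so continuity of a linear form can be
  -- tested on convergent sequences. These are bounded, so a limit of continuous forms that is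
  -- uniform on bounded sets is continuous, and the strong dual is complete.
  have : FirstCountableTopology (spaceB μ hμ) := (withSeminorms_rho μ hμ).firstCountableTopology
  exact fun u hu => cauchySeq_tendsto_of_complete hu
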